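/- Let $n$ and $k$ be integers with $1\le k\le n-1$ and $k\neq n-k$. Let $V$ be an $n$-dimensional vector space over a field of characteristic $\neq 2$, equipped with a nondegenerate symplectic (alternating bilinear) form $\xi$. For a subspace $U$ of $V$ put $U^\perp=\{v\in V:\xi(u,v)=0\text{ for all }u\in U\}$ and $\mathrm{Rad}(U)=U\cap U^\perp$; call $U$ regular if $\dim\mathrm{Rad}(U)=0$ and tangential if $\dim\mathrm{Rad}(U)=1$. For $0\le j\le n$ let $(\mathbf{T\text{-}R})_j$ be the set of all $j$-dimensional subspaces of $V$ that are regular or tangential. For $1\le j\le n-1$ the Grassmann space $\mathbf{P}((\mathbf{T\text{-}R}),j)$ is the point-line geometry with point set $(\mathbf{T\text{-}R})_j$ whose lines are the nonempty pencils $\{U\in(\mathbf{T\text{-}R})_j: H\subseteq U\subseteq B\}$ with $H\in(\mathbf{T\text{-}R})_{j-1}$, $B\in(\mathbf{T\text{-}R})_{j+1}$, $H\subseteq B$. Two distinct elements of $(\mathbf{T\text{-}R})_j$ are adjacent, written $U\sim W$, if some line of $\mathbf{P}((\mathbf{T\text{-}R}),j)$ contains both. (i) If $k>1$, then $\mathbf{P}((\mathbf{T\text{-}R}),k-1)$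 can be defined in terms of the structure $\langle(\mathbf{T\text{-}R})_k,\sim\rangle$, and hence also in terms of $\mathbf{P}((\mathbf{T\text{-}R}),k)$. (ii) If $k<n-1$, then $\mathbf{P}((\mathbf{T\text{-}R}),k+1)$ can be defined in terms of the structure $\langle(\mathbf{T\text{-}R})_k,\sim\rangle$, and hence also in terms of $\mathbf{P}((\mathbf{T\text{-}R}),k)$. Here "can be defined" means: there are first-order formulas without parameters, in the language of the structure from which one defines and depending only on $n$ and $k$ (not on the field, on $V$ or on $\xi$), that interpret the point-line geometry $\mathbf{P}((\mathbf{T\text{-}R}),k\mp1)$, i.e. points and lines are the classes of tuples of fixed lengths satisfying given formulas modulo definable equivalence relations, and the incidence of points with lines is definable. Moreover, each $X\in(\mathbf{T\text{-}R})_{k\mp1}$ is hereby identified with the set of the $U\in(\mathbf{T\text{-}R})_k$ incident with it: the relation $X\subseteq U$ in case (i), and $U\subseteq X$ in case (ii), between tuples representing $X$ and elements $U\in(\mathbf{T\text{-}R})_k$ is given by one of the formulas. -/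

import Mathlib

universe u v

namespace SympGrassmann

/-! ### First-order definability of a point-line geometry in a structure -/

/-- Relation symbols of the language of point-line geometries: "is a point", "lies on". -/
inductive PLRel : ℕ → Type
  | point : PLRel 1
  | inc : PLRel 2

/-- The first-order language of point-line geometries. -/
def plLanguage : FirstOrder.Language.{0, 0} := ⟨fun _ => Empty, PLRel⟩

/-- A point-line geometry with point set `P` and set of lines `Ln` (lines are sets of points), as a
first-order structure. The two sorts are put in one universe `P ⊕ Ln`; an element is a line
exactly if it is not a point. -/
@[reducible]
def plStructure {P : Type*} (Ln : Set (Set P)) : plLanguage.Structure (P ⊕ Ln) where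
  funMap := fun f _ => Empty.elim f
  RelMap
    | .point => fun x => ∃ p : P, x 0 = Sum.inl p
    | .inc => fun x => ∃ (p : P) (l : Ln), x 0 = Sum.inl p ∧ x 1 = Sum.inr l ∧ p ∈ l.1

/-- A parameter-free first-order definition scheme in the language `L` for a point-line geometry:
points are given by tuples of length `ptDim` satisfying `ptDom` modulo `ptEq`, lines by tuples of
length `lnDim` satisfying `lnDom` modulo `lnEq`, and `inc` expresses that a point is on a line.
The formula `link` expresses a relation between the defined points and the elements of the
structure in which the definition takes place. -/
structure GeometryScheme (L : FirstOrder.Language.{0, 0}) where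
  ptDim : ℕ
  lnDim : ℕ
  ptDom : L.Formula (Fin ptDim)
  ptEq : L.Formula (Fin ptDim ⊕ Fin ptDim)
  lnDom : L.Formula (Fin lnDim)
  lnEq : L.Formula (Fin lnDim ⊕ Fin lnDim)
  inc : L.Formula (Fin ptDim ⊕ Fin lnDim)
  link : L.Formula (Fin ptDim ⊕ Unit)

/-- The scheme `S`, evaluated in the structure `M`, defines the point-line geometry `(P, Ln)`
(an interpretation without parameters in the usual model-theoretic sense), and it does so in such
a way that the relation `R` between the points of this geometry and the elements of `M` is
defined by `S.link`. -/
def GeometryScheme.Defines {L : FirstOrder.Language.{0, 0}} (S : GeometryScheme L)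
    (M : Type*) [L.Structure M] {P : Type*} (Ln : Set (Set P)) (R : P → M → Prop) : Prop :=
  ∃ (f : {x : Fin S.ptDim → M // S.ptDom.Realize x} → P)
    (g : {y : Fin S.lnDim → M // S.lnDom.Realize y} → Ln),
    Function.Surjective f ∧ Function.Surjective g ∧
    (∀ x x', S.ptEq.Realize (Sum.elim x.1 x'.1) ↔ f x = f x') ∧
    (∀ y y', S.lnEq.Realize (Sum.elim y.1 y'.1) ↔ g y = g y') ∧
    (∀ x y, S.inc.Realize (Sum.elim x.1 y.1) ↔ f x ∈ (g y).1) ∧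
    (∀ x m, S.link.Realize (Sum.elim x.1 (fun _ : Unit => m)) ↔ R (f x) m)

/-! ### Regular and tangential subspaces, their Grassmann spaces and adjacency -/

section

variable {K V : Type*} [Field K] [AddCommGroup V] [Module K V]

/-- The radical `U ∩ U^⊥` of a subspace. -/
def rad (ξ : LinearMap.BilinForm K V) (U : Submodule K V) : Submodule K V :=
  U ⊓ ξ.orthogonal U

/-- `U` is regular if its radical is zero. -/
def IsRegular (ξ : LinearMap.BilinForm K V) (U : Submodule K V) : Prop :=
  rad ξ U = ⊥

/-- `U` is tangential if its radical is a projective point. -/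
def IsTangential (ξ : LinearMap.BilinForm K V) (U : Submodule K V) : Prop :=
  Module.finrank K (rad ξ U) = 1

/-- The regular or tangential subspaces of (linear) dimension `k`. -/
abbrev TR (ξ : LinearMap.BilinForm K V) (k : ℕ) : Type _ :=
  {U : Submodule K V // Module.finrank K U = k ∧ (IsRegular ξ U ∨ IsTangential ξ U)}

/-- The nonempty pencils `{U ∈ (T-R)_k : H ⊆ U ⊆ B}`, where `H ∈ (T-R)_{k-1}`,
`B ∈ (T-R)_{k+1}` and `H ⊆ B`. These are the lines of the Grassmann space on `(T-R)_k`. -/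
def pencils (ξ : LinearMap.BilinForm K V) (k : ℕ) : Set (Set (TR ξ k)) :=
  {l | l.Nonempty ∧ ∃ (j : ℕ) (H : TR ξ j) (B : TR ξ (k + 1)),
    j + 1 = k ∧ H.1 ≤ B.1 ∧ l = {U | H.1 ≤ U.1 ∧ U.1 ≤ B.1}}

/-- Adjacency on `(T-R)_k`: two distinct elements are adjacent if they are collinear in the
Grassmann space. -/
def adjacency (ξ : LinearMap.BilinForm K V) (k : ℕ) : SimpleGraph (TR ξ k) where
  Adj U W := U ≠ W ∧ ∃ l ∈ pencils ξ k, U ∈ l ∧ W ∈ l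
  symm := ⟨fun _ _ h => ⟨h.1.symm, h.2.imp fun _ hl => ⟨hl.1, hl.2.2, hl.2.1⟩⟩⟩
  loopless := ⟨fun _ h => h.1 rfl⟩

/-- The set `(T-R)_k` with its binary adjacency, as a first-order structure. -/
instance adjacencyStructure (ξ : LinearMap.BilinForm K V) (k : ℕ) :
    FirstOrder.Language.graph.Structure (TR ξ k) :=
  (adjacency ξ k).structure

/-- The Grassmann space `((T-R)_k, pencils)`, as a first-order structure. -/
instance grassmannStructure (ξ : LinearMap.BilinForm K V) (k : ℕ) :
    plLanguage.Structure (TR ξ k ⊕ pencils ξ k) :=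
  plStructure (pencils ξ k)

end

/-- The data of the ambient symplectic space: characteristic different from two, `ξ` a
nondegenerate symplectic form, and `dim V = n`. -/
def IsSymplecticSpace {K V : Type*} [Field K] [AddCommGroup V] [Module K V]
    (ξ : LinearMap.BilinForm K V) (n : ℕ) : Prop :=
  ringChar K ≠ 2 ∧ FiniteDimensional K V ∧ Module.finrank K V = n ∧ ξ.IsAlt ∧ ξ.Nondegenerate

/-- For symplectic spaces of dimension `n`, the Grassmann space on `(T-R)_j` can be defined in
terms of the binary adjacency on `(T-R)_k`, each `X ∈ (T-R)_j` being identified with the set of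
the `U ∈ (T-R)_k` incident with it (comparable by inclusion). The formulas depend on the
dimensions alone. -/
def DefinableFromAdjacency (n k j : ℕ) : Prop :=
  ∃ S : GeometryScheme FirstOrder.Language.graph,
    ∀ (K : Type u) (V : Type v) [Field K] [AddCommGroup V] [Module K V]
      (ξ : LinearMap.BilinForm K V), IsSymplecticSpace ξ n →
      S.Defines (TR ξ k) (pencils ξ j) (fun X U => X.1 ≤ U.1 ∨ U.1 ≤ X.1)

/-- The same, in terms of the Grassmann space on `(T-R)_k`. -/
def DefinableFromGrassmann (n k j : ℕ) : Prop :=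
  ∃ S : GeometryScheme plLanguage,
    ∀ (K : Type u) (V : Type v) [Field K] [AddCommGroup V] [Module K V]
      (ξ : LinearMap.BilinForm K V), IsSymplecticSpace ξ n →
      S.Defines (TR ξ k ⊕ pencils ξ k) (pencils ξ j)
        (fun X m => ∃ U : TR ξ k, m = Sum.inl U ∧ (X.1 ≤ U.1 ∨ U.1 ≤ X.1))

end SympGrassmann

/-!
An element of the neighbouring Grassmannian is coded by tuples of elements of `TR ξ k` through the
set of elements incident with it, a line by two distinct collinear points on it. All relations
between codes are given by formulas that are the same in all graphs.

* For even `k`, every maximal clique of the adjacency is the star of a subspace of dimension `k - 1`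
  or the top of a subspace of dimension `k + 1`, and it is determined by three of its elements. The
  maximal length of a triangular system of cliques is `k` for stars and `n - k` for tops, so that
  `k ≠ n - k` allows one to recognize the stars. This gives the dimension `k - 1`.
* For odd `k ≥ 3`, a regular subspace of dimension `k + 1` is the sum of a pair of non-adjacent
  elements, and the elements below it can be recovered from such a pair as its hull. This gives the
  dimension `k + 1`; for `k = 1` the structure is the orthogonality of the points.
* The duality `U ↦ U^⊥` exchanges the dimensions `k - 1`, `k + 1` of `(n, k)` with the dimensions
  `n - k + 1`, `n - k - 1` of `(n, n - k)`, which settles the remaining cases because `n` is even.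
-/

universe w

namespace SympGrassmann

section Definability

open FirstOrder FirstOrder.Language FirstOrder.Language.Structure

/-! ### Relations defined by one formula in all graphs -/

/-- A relation between the entries of an `α`-tuple that makes sense in every set with a binary
relation. The binary relation is an explicit argument, so that the notions defined below can be
used without reference to first-order logic. -/
abbrev GraphRelation (α : Type) : Type (v + 1) :=
  ∀ M : Type v, (M → M → Prop) → (α → M) → Prop

/-- The relation `R` is defined by one parameter-free formula in the language of graphs, the same
for all structures. -/
def UniformlyDefinable {α : Type} (R : GraphRelation.{v} α) : Prop :=
  ∃ φ : Language.graph.Formula α, ∀ (M : Type v) [Language.graph.Structure M] (x : α → M),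
    φ.Realize x ↔ R M (fun a b => RelMap adj ![a, b]) x

namespace UniformlyDefinable

variable {α β : Type} {R R' : GraphRelation.{v} α}

theorem rel (a b : α) : UniformlyDefinable.{v} fun _ A x => A (x a) (x b) :=
  ⟨adj.formula₂ (.var a) (.var b), fun M _ x => by
    simp only [Formula.realize_rel₂, Term.realize_var]⟩

theorem eq (a b : α) : UniformlyDefinable.{v} fun _ _ x => x a = x b :=
  ⟨(Term.var a).equal (.var b), fun M _ x => by
    simp only [Formula.realize_equal, Term.realize_var]⟩

theorem comp (h : UniformlyDefinable R) (t : α → β) :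
    UniformlyDefinable fun M A x => R M A (x ∘ t) := by
  obtain ⟨φ, hφ⟩ := h
  exact ⟨φ.relabel t, fun M _ x => by rw [Formula.realize_relabel, hφ]⟩

theorem not (h : UniformlyDefinable R) : UniformlyDefinable fun M A x => ¬ R M A x := by
  obtain ⟨φ, hφ⟩ := h
  exact ⟨φ.not, fun M _ x => by rw [Formula.realize_not, hφ]⟩

theorem and (h : UniformlyDefinable R) (h' : UniformlyDefinable R') :
    UniformlyDefinable fun M A x => R M A x ∧ R' M A x := by
  obtain ⟨φ, hφ⟩ := h
  obtain ⟨ψ, hψ⟩ := h'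
  exact ⟨φ ⊓ ψ, fun M _ x => by rw [Formula.realize_inf, hφ, hψ]⟩

theorem or (h : UniformlyDefinable R) (h' : UniformlyDefinable R') :
    UniformlyDefinable fun M A x => R M A x ∨ R' M A x := by
  obtain ⟨φ, hφ⟩ := h
  obtain ⟨ψ, hψ⟩ := h'
  exact ⟨φ ⊔ ψ, fun M _ x => by rw [Formula.realize_sup, hφ, hψ]⟩

theorem imp (h : UniformlyDefinable R) (h' : UniformlyDefinable R') :
    UniformlyDefinable fun M A x => R M A x → R' M A x := by
  obtain ⟨φ, hφ⟩ := h
  obtain ⟨ψ, hψ⟩ := h'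
  exact ⟨φ.imp ψ, fun M _ x => by rw [Formula.realize_imp, hφ, hψ]⟩

theorem iff (h : UniformlyDefinable R) (h' : UniformlyDefinable R') :
    UniformlyDefinable fun M A x => R M A x ↔ R' M A x := by
  obtain ⟨φ, hφ⟩ := h
  obtain ⟨ψ, hψ⟩ := h'
  exact ⟨φ.iff ψ, fun M _ x => by rw [Formula.realize_iff, hφ, hψ]⟩

theorem forall_index {ι : Type} [Finite ι] {R : ι → GraphRelation.{v} α}
    (h : ∀ i, UniformlyDefinable (R i)) : UniformlyDefinable fun M A x => ∀ i, R i M A x := by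
  choose φ hφ using h
  exact ⟨Formula.iInf φ, fun M _ x => by simp only [Formula.realize_iInf, hφ]⟩

theorem imp_of_const {p : Prop} (h : UniformlyDefinable R) :
    UniformlyDefinable fun M A x => p → R M A x := by
  by_cases hp : p
  · simpa only [hp, forall_const] using h
  · exact ⟨⊤, fun M _ x => by simp only [Formula.realize_top, hp, false_imp_iff]⟩

theorem exists_tuple [Finite β] {Q : ∀ M : Type v, (M → M → Prop) → (α → M) → (β → M) → Prop}
    (h : UniformlyDefinable fun M A (x : α ⊕ β → M) => Q M A (x ∘ Sum.inl) (x ∘ Sum.inr)) :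
    UniformlyDefinable fun M A x => ∃ z : β → M, Q M A x z := by
  obtain ⟨φ, hφ⟩ := h
  exact ⟨φ.iExs β, fun M _ x => by
    simp only [Formula.realize_iExs, hφ, Sum.elim_comp_inl, Sum.elim_comp_inr]⟩

theorem exists_family {ι : Type} [Finite ι] [Finite β]
    {Q : ∀ M : Type v, (M → M → Prop) → (α → M) → (ι → β → M) → Prop}
    (h : UniformlyDefinable fun M A (x : α ⊕ ι × β → M) =>
      Q M A (x ∘ Sum.inl) (fun i j => x (Sum.inr (i, j)))) :
    UniformlyDefinable fun M A x => ∃ z : ι → β → M, Q M A x z := by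
  obtain ⟨φ, hφ⟩ := exists_tuple (Q := fun M A x z => Q M A x fun i j => z (i, j)) h
  exact ⟨φ, fun M _ x => (hφ M x).trans (Equiv.curry ι β M).exists_congr_left⟩

theorem exists_elem {Q : ∀ M : Type v, (M → M → Prop) → (α → M) → M → Prop}
    (h : UniformlyDefinable fun M A (x : α ⊕ Unit → M) =>
      Q M A (x ∘ Sum.inl) (x (Sum.inr ()))) :
    UniformlyDefinable fun M A x => ∃ z : M, Q M A x z := by
  obtain ⟨φ, hφ⟩ := exists_tuple (Q := fun M A x z => Q M A x (z ())) h
  exact ⟨φ, fun M _ x => (hφ M x).trans (Equiv.funUnique Unit M).exists_congr_left⟩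

theorem forall_tuple [Finite β] {Q : ∀ M : Type v, (M → M → Prop) → (α → M) → (β → M) → Prop}
    (h : UniformlyDefinable fun M A (x : α ⊕ β → M) => Q M A (x ∘ Sum.inl) (x ∘ Sum.inr)) :
    UniformlyDefinable fun M A x => ∀ z : β → M, Q M A x z := by
  obtain ⟨φ, hφ⟩ := h
  exact ⟨φ.iAlls β, fun M _ x => by
    simp only [Formula.realize_iAlls, hφ, Sum.elim_comp_inl, Sum.elim_comp_inr]⟩

theorem forall_elem {Q : ∀ M : Type v, (M → M → Prop) → (α → M) → M → Prop}
    (h : UniformlyDefinable fun M A (x : α ⊕ Unit → M) =>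
      Q M A (x ∘ Sum.inl) (x (Sum.inr ()))) :
    UniformlyDefinable fun M A x => ∀ z : M, Q M A x z := by
  obtain ⟨φ, hφ⟩ := forall_tuple (Q := fun M A x z => Q M A x (z ())) h
  exact ⟨φ, fun M _ x => (hφ M x).trans (Equiv.funUnique Unit M).forall_congr_left⟩

theorem iff_of_equiv (h : UniformlyDefinable R) {M M' : Type v} {A : M → M → Prop}
    {A' : M' → M' → Prop} (e : M ≃ M') (he : ∀ a b, A a b ↔ A' (e a) (e b)) (x : α → M) :
    R M A x ↔ R M' A' (e ∘ x) := by
  obtain ⟨φ, hφ⟩ := h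
  let _ : Language.graph.Structure M := { RelMap := fun | .adj => fun x => A (x 0) (x 1) }
  let _ : Language.graph.Structure M' := { RelMap := fun | .adj => fun x => A' (x 0) (x 1) }
  let E : M ≃[Language.graph] M' :=
    { e with
      map_fun' := fun f => isEmptyElim f
      map_rel' := fun r x => by
        cases r
        exact (he _ _).symm }
  exact (hφ M x).symm.trans ((StrongHomClass.realize_formula E φ).symm.trans (hφ M' (e ∘ x)))

end UniformlyDefinable

/-! ### Definition schemes from codes of points -/

/-- Codes of the points of a geometry by `m`-tuples of vertices of a graph: `Dom` holds for the
tuples that are codes, `Mem t U` relates the point coded by `t` to the vertex `U`, `Adj` expresses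
that the coded points are distinct and collinear, and `Line t t'` is the line through two such
points. Everything is uniformly definable. -/
structure TupleCoding (m : ℕ) where
  Dom : GraphRelation.{v} (Fin m)
  Mem : ∀ M : Type v, (M → M → Prop) → (Fin m → M) → M → Prop
  Adj : ∀ M : Type v, (M → M → Prop) → (Fin m → M) → (Fin m → M) → Prop
  Line : ∀ M : Type v, (M → M → Prop) → (Fin m → M) → (Fin m → M) → (Fin m → M) → Prop
  definable_dom : UniformlyDefinable Dom
  definable_mem : UniformlyDefinable
    fun M A (x : Fin m ⊕ Unit → M) => Mem M A (x ∘ Sum.inl) (x (Sum.inr ()))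
  definable_adj : UniformlyDefinable
    fun M A (x : Fin m ⊕ Fin m → M) => Adj M A (x ∘ Sum.inl) (x ∘ Sum.inr)
  definable_line : UniformlyDefinable fun M A (x : (Fin m ⊕ Fin m) ⊕ Fin m → M) =>
    Line M A (x ∘ Sum.inl ∘ Sum.inl) (x ∘ Sum.inl ∘ Sum.inr) (x ∘ Sum.inr)

namespace TupleCoding

variable {m : ℕ}

/-- In the graph `(M, A)`, the tuples in the domain of `C` code the points of the geometry
`(P, Ln)` via `f`, a point `p` being determined by the set of the vertices `U` with `R p U`. -/
structure Represents (C : TupleCoding.{v} m) {M : Type v} (A : M → M → Prop) {P : Type*}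
    (Ln : Set (Set P)) (R : P → M → Prop) (f : {t // C.Dom M A t} → P) : Prop where
  surjective : Function.Surjective f
  mem_iff : ∀ t U, C.Mem M A t.1 U ↔ R (f t) U
  ext : ∀ t t', (∀ U, R (f t) U ↔ R (f t') U) → f t = f t'
  adj_iff : ∀ t t', C.Adj M A t.1 t'.1 ↔ f t ≠ f t' ∧ ∃ l ∈ Ln, f t ∈ l ∧ f t' ∈ l
  line_iff : ∀ l ∈ Ln, ∀ t t', f t ≠ f t' → f t ∈ l → f t' ∈ l →
    ∀ s, C.Line M A t.1 t'.1 s.1 ↔ f s ∈ l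

/-- The `2m`-tuple `y` consists of the codes of two distinct collinear points. -/
def LineDom (C : TupleCoding.{v} m) : GraphRelation.{v} (Fin (m + m)) := fun M A y =>
  C.Dom M A (y ∘ Fin.castAdd m) ∧ C.Dom M A (y ∘ Fin.natAdd m) ∧
    C.Adj M A (y ∘ Fin.castAdd m) (y ∘ Fin.natAdd m)

/-- The pairs of codes `y` and `y'` determine the same line. -/
def LineEq (C : TupleCoding.{v} m) (M : Type v) (A : M → M → Prop) (y y' : Fin (m + m) → M) :
    Prop :=
  ∀ z, C.Dom M A z → (C.Line M A (y ∘ Fin.castAdd m) (y ∘ Fin.natAdd m) z ↔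
    C.Line M A (y' ∘ Fin.castAdd m) (y' ∘ Fin.natAdd m) z)

theorem definable_lineDom (C : TupleCoding.{v} m) : UniformlyDefinable C.LineDom :=
  (C.definable_dom.comp _).and ((C.definable_dom.comp _).and
    (C.definable_adj.comp (Sum.elim (Fin.castAdd m) (Fin.natAdd m))))

theorem definable_lineEq (C : TupleCoding.{v} m) : UniformlyDefinable
    fun M A (x : Fin (m + m) ⊕ Fin (m + m) → M) => C.LineEq M A (x ∘ Sum.inl) (x ∘ Sum.inr) := by
  have line (c : Fin (m + m) → Fin (m + m) ⊕ Fin (m + m)) := C.definable_line.comp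
    (Sum.elim (Sum.elim (Sum.inl ∘ c ∘ Fin.castAdd m) (Sum.inl ∘ c ∘ Fin.natAdd m)) Sum.inr)
  exact .forall_tuple ((C.definable_dom.comp Sum.inr).imp ((line Sum.inl).iff (line Sum.inr)))

theorem Represents.exists_line_map {C : TupleCoding.{v} m} {M : Type v} {A : M → M → Prop}
    {P : Type*} {Ln : Set (Set P)} {R : P → M → Prop} {f : {t // C.Dom M A t} → P}
    (h : C.Represents A Ln R f) (hLn : ∀ l ∈ Ln, l.Nontrivial) :
    ∃ g : {y // C.LineDom M A y} → Ln, Function.Surjective g ∧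
      (∀ y (t : {t // C.Dom M A t}),
        C.Line M A (y.1 ∘ Fin.castAdd m) (y.1 ∘ Fin.natAdd m) t.1 ↔ f t ∈ (g y).1) ∧
      ∀ y y', C.LineEq M A y.1 y'.1 ↔ g y = g y' := by
  have exists_line (y : {y // C.LineDom M A y}) :
      ∃ l : Ln, f ⟨_, y.2.1⟩ ∈ l.1 ∧ f ⟨_, y.2.2.1⟩ ∈ l.1 := by
    obtain ⟨-, l, hl, hml⟩ := (h.adj_iff ⟨_, y.2.1⟩ ⟨_, y.2.2.1⟩).1 y.2.2.2
    exact ⟨⟨l, hl⟩, hml⟩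
  choose g hg using exists_line
  have line_iff (y : {y // C.LineDom M A y}) (t : {t // C.Dom M A t}) :
      C.Line M A (y.1 ∘ Fin.castAdd m) (y.1 ∘ Fin.natAdd m) t.1 ↔ f t ∈ (g y).1 :=
    h.line_iff _ (g y).2 ⟨_, y.2.1⟩ ⟨_, y.2.2.1⟩ ((h.adj_iff _ _).1 y.2.2.2).1 (hg y).1 (hg y).2 t
  refine ⟨g, fun l => ?_, line_iff, fun y y' => ⟨fun hy => ?_, fun hy t ht => ?_⟩⟩
  · obtain ⟨p, hp, q, hq, hpq⟩ := hLn l.1 l.2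
    obtain ⟨s, rfl⟩ := h.surjective p
    obtain ⟨t, rfl⟩ := h.surjective q
    have hs : Fin.append s.1 t.1 ∘ Fin.castAdd m = s.1 := funext (Fin.append_left _ _)
    have ht : Fin.append s.1 t.1 ∘ Fin.natAdd m = t.1 := funext (Fin.append_right _ _)
    have hst : C.LineDom M A (Fin.append s.1 t.1) := by
      rw [LineDom, hs, ht]
      exact ⟨s.2, t.2, (h.adj_iff s t).2 ⟨hpq, l.1, l.2, hp, hq⟩⟩
    refine ⟨⟨_, hst⟩, Subtype.ext (Set.ext fun r => ?_)⟩
    obtain ⟨c, rfl⟩ := h.surjective r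
    rw [← line_iff, ← h.line_iff l.1 l.2 s t hpq hp hq c, hs, ht]
  · refine Subtype.ext (Set.ext fun r => ?_)
    obtain ⟨t, rfl⟩ := h.surjective r
    rw [← line_iff, ← line_iff]
    exact hy t.1 t.2
  · exact (line_iff y ⟨t, ht⟩).trans (hy ▸ (line_iff y' ⟨t, ht⟩).symm)

/-- Lines have at least two points, so they are coded by the pairs of codes of distinct collinear
points. -/
theorem exists_scheme (C : TupleCoding.{v} m) : ∃ S : GeometryScheme Language.graph,
    ∀ (M : Type v) [Language.graph.Structure M] (P : Type w) (Ln : Set (Set P)) (R : P → M → Prop)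
      (f : {t // C.Dom M (fun a b => RelMap adj ![a, b]) t} → P),
      (∀ l ∈ Ln, l.Nontrivial) → C.Represents (fun a b => RelMap adj ![a, b]) Ln R f →
      S.Defines M Ln R := by
  obtain ⟨ptDom, hptDom⟩ := C.definable_dom
  obtain ⟨ptEq, hptEq⟩ := UniformlyDefinable.forall_elem
    (Q := fun M A (x : Fin m ⊕ Fin m → M) U =>
      C.Mem M A (x ∘ Sum.inl) U ↔ C.Mem M A (x ∘ Sum.inr) U)
    ((C.definable_mem.comp (Sum.map Sum.inl id)).iff (C.definable_mem.comp (Sum.map Sum.inr id)))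
  obtain ⟨lnDom, hlnDom⟩ := C.definable_lineDom
  obtain ⟨lnEq, hlnEq⟩ := C.definable_lineEq
  obtain ⟨inc, hinc⟩ := C.definable_line.comp (Sum.elim
    (Sum.elim (Sum.inr ∘ Fin.castAdd m) (Sum.inr ∘ Fin.natAdd m))
    (Sum.inl : Fin m → Fin m ⊕ Fin (m + m)))
  obtain ⟨link, hlink⟩ := C.definable_mem
  refine ⟨⟨m, m + m, ptDom, ptEq, lnDom, lnEq, inc, link⟩, fun M _ P Ln R f hLn h => ?_⟩
  obtain ⟨g, hg, hgline, hgeq⟩ := h.exists_line_map hLn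
  let dom : {x // ptDom.Realize x} ≃ {t // C.Dom M (fun a b => RelMap adj ![a, b]) t} :=
    Equiv.subtypeEquivRight (hptDom M)
  let lineDom : {y // lnDom.Realize y} ≃ {y // C.LineDom M (fun a b => RelMap adj ![a, b]) y} :=
    Equiv.subtypeEquivRight (hlnDom M)
  refine ⟨f ∘ dom, g ∘ lineDom, h.surjective.comp dom.surjective, hg.comp lineDom.surjective,
    fun x x' => (hptEq M _).trans ⟨fun hx => h.ext _ _ fun U => ?_, fun hx U => ?_⟩,
    fun y y' => (hlnEq M _).trans (hgeq (lineDom y) (lineDom y')),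
    fun x y => (hinc M _).trans (hgline (lineDom y) (dom x)),
    fun x U => (hlink M _).trans (h.mem_iff (dom x) U)⟩
  · exact (h.mem_iff (dom x) U).symm.trans ((hx U).trans (h.mem_iff (dom x') U))
  · exact (h.mem_iff (dom x) U).trans ((iff_of_eq (congrArg (R · U) hx)).trans
      (h.mem_iff (dom x') U).symm)

end TupleCoding

/-! ### Transport of definitions -/

section Transport

variable {L : FirstOrder.Language.{0, 0}}

/-- The tuples with a given formula, in isomorphic structures. -/
def realizeEquiv {M M' : Type*} [L.Structure M] [L.Structure M'] (e : M ≃[L] M') {α : Type}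
    (φ : L.Formula α) : {x : α → M // φ.Realize x} ≃ {x : α → M' // φ.Realize x} :=
  (Equiv.arrowCongr (Equiv.refl α) e.toEquiv).subtypeEquiv fun _ =>
    (StrongHomClass.realize_formula e φ).symm

theorem GeometryScheme.Defines.of_equiv {S : GeometryScheme L} {M M' P P' : Type*}
    [L.Structure M] [L.Structure M'] {Ln : Set (Set P)} {Ln' : Set (Set P')}
    {R : P → M → Prop} {R' : P' → M' → Prop} (e : M ≃[L] M') (p : P ≃ P')
    (hLn : ∀ l, p ⁻¹' l ∈ Ln ↔ l ∈ Ln') (hR : ∀ x m, R x m ↔ R' (p x) (e m))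
    (h : S.Defines M' Ln' R') : S.Defines M Ln R := by
  obtain ⟨f, g, hf, hg, hfe, hge, hinc, hlink⟩ := h
  have realize_elim {α β : Type} (φ : L.Formula (α ⊕ β)) (x : α → M) (y : β → M) :
      φ.Realize (Sum.elim x y) ↔ φ.Realize (Sum.elim (e ∘ x) (e ∘ y)) := by
    rw [← Sum.comp_elim]
    exact (StrongHomClass.realize_formula e φ).symm
  let lines : Ln ≃ Ln' := ((Equiv.Set.congr p).subtypeEquiv fun l => by
    rw [← hLn, Equiv.Set.congr_apply, p.preimage_image])
  refine ⟨p.symm ∘ f ∘ realizeEquiv e _, lines.symm ∘ g ∘ realizeEquiv e _,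
    p.symm.surjective.comp (hf.comp (Equiv.surjective _)),
    lines.symm.surjective.comp (hg.comp (Equiv.surjective _)), fun x x' => ?_, fun y y' => ?_,
    fun x y => ?_, fun x m => ?_⟩
  · exact (realize_elim _ _ _).trans ((hfe (realizeEquiv e _ x) (realizeEquiv e _ x')).trans
      p.symm.injective.eq_iff.symm)
  · exact (realize_elim _ _ _).trans ((hge (realizeEquiv e _ y) (realizeEquiv e _ y')).trans
      lines.symm.injective.eq_iff.symm)
  · refine (realize_elim _ _ _).trans ((hinc (realizeEquiv e _ x) (realizeEquiv e _ y)).trans ?_)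
    exact (p.symm.injective.mem_set_image).symm
  · rw [hR, realize_elim]
    refine (hlink (realizeEquiv e _ x) (e m)).trans ?_
    rw [Function.comp_apply, Function.comp_apply, p.apply_symm_apply]

end Transport

/-! ### From the collinearity graph to the geometry -/

section Relativization

attribute [local instance] plStructure

/-- The variable that constitutes a term of the language of graphs. -/
def graphTermVar {γ : Type} : Language.graph.Term γ → γ
  | .var a => a
  | .func f _ => isEmptyElim f

theorem realize_eq_graphTermVar {γ : Type} {M : Type*} [Language.graph.Structure M]
    (t : Language.graph.Term γ) (x : γ → M) : t.realize x = x (graphTermVar t) := by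
  cases t with
  | var a => rfl
  | func f _ => exact isEmptyElim f

variable {α : Type} {n : ℕ}

/-- The symbol `PLRel.point` as a member of `plLanguage.Relations`, for use in formulas. -/
def plPoint : plLanguage.Relations 1 := .point

/-- The symbol `PLRel.inc` as a member of `plLanguage.Relations`, for use in formulas. -/
def plInc : plLanguage.Relations 2 := .inc

/-- The formula stating that `a` and `b` are distinct and lie on a common line. -/
def collinearFormula (a b : α ⊕ Fin n) : plLanguage.BoundedFormula α n :=
  let onNewLine (c : α ⊕ Fin n) : plLanguage.BoundedFormula α (n + 1) :=
    plInc.boundedFormula₂ (.var (Sum.map id Fin.castSucc c))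
      (.var (Sum.inr (Fin.last n)))
  (Term.bdEqual (.var a) (.var b)).not ⊓ (onNewLine a ⊓ onNewLine b).ex

/-- A formula on graphs, read in a point-line geometry as a statement on the points and their
collinearity: quantifiers range over points only. -/
def relativize {n : ℕ} : Language.graph.BoundedFormula α n → plLanguage.BoundedFormula α n
  | .falsum => ⊥
  | .equal s t => Term.bdEqual (.var (graphTermVar s)) (.var (graphTermVar t))
  | .rel .adj ts => collinearFormula (graphTermVar (ts 0)) (graphTermVar (ts 1))
  | .imp φ ψ => (relativize φ).imp (relativize ψ)
  | .all φ => ((plPoint.boundedFormula₁ (.var (Sum.inr (Fin.last _)))).imp (relativize φ)).all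

variable {P : Type*} {Ln : Set (Set P)}

theorem relMap_point (x : P ⊕ Ln) : RelMap plPoint ![x] ↔
    ∃ p : P, x = Sum.inl p := Iff.rfl

theorem relMap_inc (x y : P ⊕ Ln) : RelMap plInc ![x, y] ↔
    ∃ (p : P) (l : Ln), x = Sum.inl p ∧ y = Sum.inr l ∧ p ∈ l.1 := Iff.rfl

theorem realize_collinearFormula (a b : α ⊕ Fin n) (x : α → P) (y : Fin n → P) :
    (collinearFormula a b).Realize (M := P ⊕ Ln) (Sum.inl ∘ x) (Sum.inl ∘ y) ↔
      Sum.elim x y a ≠ Sum.elim x y b ∧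
        ∃ l ∈ Ln, Sum.elim x y a ∈ l ∧ Sum.elim x y b ∈ l := by
  have elim_snoc (c : α ⊕ Fin n) (l : P ⊕ Ln) : Sum.elim (Sum.inl ∘ x)
      (Fin.snoc (α := fun _ => P ⊕ Ln) (Sum.inl ∘ y) l) (Sum.map id Fin.castSucc c) =
        Sum.inl (Sum.elim x y c) := by
    rcases c with c | c <;> simp
  simp only [collinearFormula, BoundedFormula.realize_inf, BoundedFormula.realize_not,
    BoundedFormula.realize_bdEqual, BoundedFormula.realize_ex, BoundedFormula.realize_rel₂,
    Term.realize_var, elim_snoc, Sum.elim_inr, Fin.snoc_last, relMap_inc]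
  simp only [← Sum.comp_elim, Function.comp_apply, Sum.inl.injEq]
  refine and_congr_right' ⟨?_, ?_⟩
  · rintro ⟨_, ⟨_, l, rfl, rfl, ha⟩, _, _, rfl, hl, hb⟩
    exact ⟨l, l.2, ha, Sum.inr_injective hl ▸ hb⟩
  · rintro ⟨l, hl, ha, hb⟩
    exact ⟨Sum.inr ⟨l, hl⟩, ⟨_, ⟨l, hl⟩, rfl, rfl, ha⟩, _, ⟨l, hl⟩, rfl, rfl, hb⟩

section

variable [Language.graph.Structure P]
  (hP : ∀ p q : P, RelMap adj ![p, q] ↔ p ≠ q ∧ ∃ l ∈ Ln, p ∈ l ∧ q ∈ l)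

include hP

theorem realize_relativize (φ : Language.graph.BoundedFormula α n) (x : α → P) (y : Fin n → P) :
    (relativize φ).Realize (M := P ⊕ Ln) (Sum.inl ∘ x) (Sum.inl ∘ y) ↔ φ.Realize x y := by
  induction φ with
  | falsum => exact Iff.rfl
  | equal s t =>
    simp only [relativize, BoundedFormula.realize_bdEqual, Term.realize_var, ← Sum.comp_elim,
      Function.comp_apply, Sum.inl.injEq, BoundedFormula.Realize, realize_eq_graphTermVar]
  | rel r ts =>
    cases r
    refine (realize_collinearFormula _ _ _ _).trans ((hP _ _).symm.trans
      (iff_of_eq (congrArg (RelMap adj) (funext (Fin.forall_fin_two.2 ⟨?_, ?_⟩)))))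
    · exact (realize_eq_graphTermVar (ts 0) _).symm
    · exact (realize_eq_graphTermVar (ts 1) _).symm
  | imp φ ψ hφ hψ => rw [relativize, BoundedFormula.realize_imp, BoundedFormula.realize_imp, hφ, hψ]
  | all φ hφ =>
    simp only [relativize, BoundedFormula.realize_all, BoundedFormula.realize_imp,
      BoundedFormula.realize_rel₁, Term.realize_var, Sum.elim_inr, Fin.snoc_last, relMap_point]
    have snoc_inl (p : P) : (Fin.snoc (α := fun _ => P ⊕ Ln) (Sum.inl ∘ y) (Sum.inl p) :
        Fin _ → P ⊕ Ln) = Sum.inl ∘ (Fin.snoc y p : Fin _ → P) := (Fin.comp_snoc _ _ _).symm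
    constructor
    · intro h p
      rw [← hφ, ← snoc_inl]
      exact h _ ⟨p, rfl⟩
    · rintro h _ ⟨p, rfl⟩
      rw [snoc_inl, hφ]
      exact h p

theorem realize_relativize_formula (φ : Language.graph.Formula α) (x : α → P) :
    Formula.Realize (M := P ⊕ Ln) (relativize φ) (Sum.inl ∘ x) ↔ φ.Realize x := by
  rw [Formula.Realize, Formula.Realize, ← realize_relativize hP φ x]
  exact iff_of_eq (congrArg _ (Subsingleton.elim _ _))

end

/-- The formula stating that all entries of the tuple are points and that they satisfy `φ` with
respect to collinearity. -/
noncomputable def pointFormula [Finite α] (φ : Language.graph.Formula α) : plLanguage.Formula α :=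
  (Formula.iInf fun i : α => plPoint.formula₁ (.var i)) ⊓
    relativize φ

variable [Language.graph.Structure P] [Finite α]
  (hP : ∀ p q : P, RelMap adj ![p, q] ↔ p ≠ q ∧ ∃ l ∈ Ln, p ∈ l ∧ q ∈ l)

include hP

theorem realize_pointFormula_comp_inl (φ : Language.graph.Formula α) (y : α → P) :
    (pointFormula φ).Realize (M := P ⊕ Ln) (Sum.inl ∘ y) ↔ φ.Realize y := by
  rw [pointFormula, Formula.realize_inf, realize_relativize_formula hP]
  simp only [Formula.realize_iInf, Formula.realize_rel₁, Term.realize_var, relMap_point]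
  exact and_iff_right fun i => ⟨y i, rfl⟩

theorem realize_pointFormula (φ : Language.graph.Formula α) (x : α → P ⊕ Ln) :
    (pointFormula φ).Realize x ↔ ∃ y : α → P, x = Sum.inl ∘ y ∧ φ.Realize y := by
  constructor
  · intro h
    have hx : ∀ i, ∃ p : P, x i = Sum.inl p := by
      have := (Formula.realize_inf.1 h).1
      simpa only [Formula.realize_iInf, Formula.realize_rel₁, Term.realize_var, relMap_point]
        using this
    choose y hy using hx
    obtain rfl : x = Sum.inl ∘ y := funext hy
    exact ⟨y, rfl, (realize_pointFormula_comp_inl hP φ y).1 h⟩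
  · rintro ⟨y, rfl, hy⟩
    exact (realize_pointFormula_comp_inl hP φ y).2 hy

/-- Tuples of points, as tuples of elements of the geometry. -/
noncomputable def pointFormulaEquiv (φ : Language.graph.Formula α) :
    {y : α → P // φ.Realize y} ≃ {x : α → P ⊕ Ln // (pointFormula φ).Realize x} :=
  Equiv.ofBijective
    (fun y => ⟨Sum.inl ∘ y.1, (realize_pointFormula_comp_inl hP φ y.1).2 y.2⟩)
    ⟨fun _ _ h => Subtype.ext (Sum.inl_injective.comp_left (Subtype.ext_iff.1 h)), fun x => by
      obtain ⟨y, hx, hy⟩ := (realize_pointFormula hP φ x.1).1 x.2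
      exact ⟨⟨y, hy⟩, Subtype.ext hx.symm⟩⟩

end Relativization

/-- The scheme `S` on a collinearity graph, read in the geometry itself. -/
noncomputable def GeometryScheme.relativize (S : GeometryScheme Language.graph) :
    GeometryScheme plLanguage where
  ptDim := S.ptDim
  lnDim := S.lnDim
  ptDom := pointFormula S.ptDom
  ptEq := pointFormula S.ptEq
  lnDom := pointFormula S.lnDom
  lnEq := pointFormula S.lnEq
  inc := pointFormula S.inc
  link := pointFormula S.link

theorem GeometryScheme.Defines.relativize {S : GeometryScheme Language.graph} {P Q : Type*}
    {Ln : Set (Set P)} {Ln' : Set (Set Q)} [Language.graph.Structure P] {R : Q → P → Prop}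
    (hP : ∀ p q : P, RelMap adj ![p, q] ↔ p ≠ q ∧ ∃ l ∈ Ln, p ∈ l ∧ q ∈ l)
    (h : S.Defines P Ln' R) :
    letI := plStructure Ln
    S.relativize.Defines (P ⊕ Ln) Ln' (fun X m => ∃ p : P, m = Sum.inl p ∧ R X p) := by
  let _ := plStructure Ln
  obtain ⟨f, g, hf, hg, hfe, hge, hinc, hlink⟩ := h
  have realize_elim {α β : Type} [Finite α] [Finite β] (φ : Language.graph.Formula (α ⊕ β))
      (x : α → P) (y : β → P) : (pointFormula φ).Realize (M := P ⊕ Ln)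
        (Sum.elim (Sum.inl ∘ x) (Sum.inl ∘ y)) ↔ φ.Realize (Sum.elim x y) := by
    rw [← Sum.comp_elim, realize_pointFormula_comp_inl hP]
  let pt := pointFormulaEquiv hP S.ptDom
  let ln := pointFormulaEquiv hP S.lnDom
  have hpt x : (f ∘ pt.symm) (pt x) = f x := congrArg f (pt.symm_apply_apply x)
  have hln y : (g ∘ ln.symm) (ln y) = g y := congrArg g (ln.symm_apply_apply y)
  refine ⟨f ∘ pt.symm, g ∘ ln.symm, hf.comp pt.symm.surjective, hg.comp ln.symm.surjective,
    pt.surjective.forall₂.2 fun x x' => ?_, ln.surjective.forall₂.2 fun y y' => ?_,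
    pt.surjective.forall.2 fun x => ln.surjective.forall.2 fun y => ?_,
    pt.surjective.forall.2 fun x m => ?_⟩
  · exact (realize_elim _ _ _).trans ((hfe x x').trans (Eq.congr (hpt x) (hpt x')).symm)
  · exact (realize_elim _ _ _).trans ((hge y y').trans (Eq.congr (hln y) (hln y')).symm)
  · refine (realize_elim _ _ _).trans ((hinc x y).trans (iff_of_eq ?_))
    exact congrArg₂ (fun p (l : Ln') => p ∈ l.1) (hpt x).symm (hln y).symm
  · have hR p : R ((f ∘ pt.symm) (pt x)) p ↔ S.link.Realize (Sum.elim x.1 fun _ => p) :=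
      (iff_of_eq (congrArg (R · p) (hpt x))).trans (hlink x p).symm
    constructor
    · intro hm
      obtain ⟨y, hy, -⟩ := (realize_pointFormula hP _ _).1 hm
      obtain rfl : m = Sum.inl (y (Sum.inr ())) := congrFun hy (Sum.inr ())
      exact ⟨_, rfl, (hR _).2 ((realize_elim _ _ _).1 hm)⟩
    · rintro ⟨p, rfl, hp⟩
      exact (realize_elim _ _ _).2 ((hR p).1 hp)

theorem DefinableFromAdjacency.definableFromGrassmann {n k j : ℕ}
    (h : DefinableFromAdjacency.{u, v} n k j) : DefinableFromGrassmann.{u, v} n k j := by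
  obtain ⟨S, hS⟩ := h
  exact ⟨S.relativize, fun K V _ _ _ ξ hξ => (hS K V ξ hξ).relativize fun _ _ => Iff.rfl⟩

end Definability

open Module

/-! ### Dimensions of subspaces -/

section Dimension

variable {K V : Type*} [Field K] [AddCommGroup V] [Module K V]

theorem not_le_of_finrank_lt {S T : Submodule K V} [FiniteDimensional K S]
    (h : finrank K S < finrank K T) : ¬ T ≤ S :=
  fun hle => h.not_ge (Submodule.finrank_mono hle)

theorem exists_mem_notMem_of_finrank_lt {S T : Submodule K V} [FiniteDimensional K S]
    (h : finrank K S < finrank K T) : ∃ v ∈ T, v ∉ S :=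
  Set.not_subset.1 (not_le_of_finrank_lt h)

theorem exists_mem_notMem_notMem {B S T : Submodule K V} (hS : ¬ B ≤ S) (hT : ¬ B ≤ T) :
    ∃ v ∈ B, v ∉ S ∧ v ∉ T := by
  obtain ⟨s, hsB, hsS⟩ := Set.not_subset.1 hS
  obtain ⟨t, htB, htT⟩ := Set.not_subset.1 hT
  by_cases hsT : s ∈ T
  · by_cases htS : t ∈ S
    · exact ⟨s + t, B.add_mem hsB htB, fun h => hsS ((S.add_mem_iff_left htS).1 h),
        fun h => htT ((T.add_mem_iff_right hsT).1 h)⟩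
    · exact ⟨t, htB, htS, htT⟩
  · exact ⟨s, hsB, hsS, hsT⟩

theorem exists_ne_zero_of_finrank_pos {S : Submodule K V} (h : 0 < finrank K S) :
    ∃ v ∈ S, v ≠ 0 :=
  S.exists_mem_ne_zero_of_ne_bot fun h0 => h.ne' (by rw [h0, finrank_bot])

variable [FiniteDimensional K V] {U W : Submodule K V} {k : ℕ}

theorem mem_span_singleton_of_finrank_le_one (h : finrank K U ≤ 1) {v w : V} (hv : v ∈ U)
    (hw : w ∈ U) (hv0 : v ≠ 0) : w ∈ K ∙ v := by
  rwa [Submodule.eq_of_le_of_finrank_le ((Submodule.span_singleton_le_iff_mem v U).2 hv)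
    (by rwa [finrank_span_singleton hv0])]

theorem sup_span_singleton_eq {H : Submodule K V} (hHU : H ≤ U)
    (hd : finrank K U = finrank K H + 1) {w : V} (hw : w ∈ U) (hwH : w ∉ H) : H ⊔ K ∙ w = U :=
  Submodule.eq_of_le_of_finrank_le
    (sup_le hHU ((Submodule.span_singleton_le_iff_mem w U).2 hw))
    (by rw [Submodule.finrank_sup_span_singleton hwH, hd])

theorem finrank_le_finrank_inf_add_one {H S : Submodule K V} (hHU : H ≤ U)
    (hd : finrank K U = finrank K H + 1) (hS : S ≤ U) :
    finrank K S ≤ finrank K ↥(S ⊓ H) + 1 := by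
  have hadd := Submodule.finrank_sup_add_finrank_inf_eq S H
  have hsup := Submodule.finrank_mono (sup_le hS hHU)
  omega

theorem finrank_inf_ker_add_one {f : V →ₗ[K] K} (h : ¬ U ≤ LinearMap.ker f) :
    finrank K ↥(U ⊓ LinearMap.ker f) + 1 = finrank K U := by
  have hf : f.comp U.subtype ≠ 0 := fun h0 => h fun u hu => LinearMap.congr_fun h0 ⟨u, hu⟩
  rw [← Module.Dual.finrank_ker_add_one_of_ne_zero hf, LinearMap.ker_comp,
    ← Submodule.map_comap_subtype, Submodule.finrank_map_subtype_eq]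

theorem finrank_le_finrank_inf_ker_add_one (U : Submodule K V) (f : V →ₗ[K] K) :
    finrank K U ≤ finrank K ↥(U ⊓ LinearMap.ker f) + 1 := by
  by_cases h : U ≤ LinearMap.ker f
  · rw [inf_eq_left.2 h]
    exact Nat.le_succ _
  · exact (finrank_inf_ker_add_one h).ge

theorem finrank_add_finrank_le (U W : Submodule K V) :
    finrank K U + finrank K W ≤ finrank K V + finrank K ↥(U ⊓ W) := by
  rw [← Submodule.finrank_sup_add_finrank_inf_eq]
  exact Nat.add_le_add_right (Submodule.finrank_le _) _

theorem finrank_sup_eq_add_one (hU : finrank K U = k) (hW : finrank K W = k)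
    (h : finrank K ↥(U ⊓ W) + 1 = k) : finrank K ↥(U ⊔ W) = k + 1 := by
  have hadd := Submodule.finrank_sup_add_finrank_inf_eq U W
  omega

theorem finrank_inf_lt (hU : finrank K U = k) (hW : finrank K W = k) (hne : U ≠ W) :
    finrank K ↥(U ⊓ W) < k := by
  by_contra! hle
  exact hne ((Submodule.eq_of_le_of_finrank_le inf_le_left (hU ▸ hle)).symm.trans
    (Submodule.eq_of_le_of_finrank_le inf_le_right (hW ▸ hle)))

theorem finrank_inf_add_one_of_le {Y : Submodule K V} (hU : finrank K U = k)
    (hW : finrank K W = k) (hY : finrank K Y = k + 1) (hUY : U ≤ Y) (hWY : W ≤ Y) (hne : U ≠ W) :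
    finrank K ↥(U ⊓ W) + 1 = k := by
  have hlt := finrank_inf_lt hU hW hne
  have hle := finrank_le_finrank_inf_add_one hWY (by rw [hY, hW]) hUY
  omega

theorem sup_eq_of_le {Y : Submodule K V} (hU : finrank K U = k) (hW : finrank K W = k)
    (hY : finrank K Y = k + 1) (hUY : U ≤ Y) (hWY : W ≤ Y) (hne : U ≠ W) : U ⊔ W = Y :=
  Submodule.eq_of_le_of_finrank_le (sup_le hUY hWY) (by
    rw [hY, finrank_sup_eq_add_one hU hW (finrank_inf_add_one_of_le hU hW hY hUY hWY hne)])

theorem inf_eq_of_ge {X : Submodule K V} (hU : finrank K U = k) (hW : finrank K W = k)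
    (hX : finrank K X + 1 = k) (hXU : X ≤ U) (hXW : X ≤ W) (hne : U ≠ W) : U ⊓ W = X :=
  (Submodule.eq_of_le_of_finrank_le (le_inf hXU hXW)
    (by have := finrank_inf_lt hU hW hne; omega)).symm

theorem finrank_inf_lt_of_not_le {X B S T : Submodule K V} (hd : finrank K S = finrank K X + 1)
    (hXS : X ≤ S) (hXB : X ≤ B) (hSB : ¬ S ≤ B) (hTB : T ≤ B) (hXT : ¬ X ≤ T) :
    finrank K ↥(S ⊓ T) < finrank K X := by
  have hlt := Submodule.finrank_lt_finrank_of_lt (inf_lt_left.2 hSB)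
  have hX : X = S ⊓ B := Submodule.eq_of_le_of_finrank_le (le_inf hXS hXB) (by omega)
  have hle : S ⊓ T ≤ X := hX ▸ inf_le_inf_left S hTB
  exact Submodule.finrank_lt_finrank_of_lt (hle.lt_of_ne fun e => hXT (e ▸ inf_le_right))

/-- Lines of a Grassmannian form triangles only inside a star or inside a top. -/
theorem inf_le_or_le_sup {Z : Submodule K V} (hZ : finrank K Z = k)
    (hUW : finrank K ↥(U ⊓ W) + 1 = k) (hZU : finrank K ↥(Z ⊓ U) + 1 = k)
    (hZW : finrank K ↥(Z ⊓ W) + 1 = k) : U ⊓ W ≤ Z ∨ Z ≤ U ⊔ W := by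
  by_cases h : Z ⊓ U = Z ⊓ W
  · have hle : Z ⊓ U ≤ U ⊓ W := le_inf inf_le_right (h ▸ inf_le_right)
    rw [← Submodule.eq_of_le_of_finrank_le hle (by omega)]
    exact .inl inf_le_left
  · have hsup : Z ⊓ U ⊔ Z ⊓ W = Z := sup_eq_of_le (k := k - 1) (by omega) (by omega)
      (by omega) inf_le_left inf_le_left h
    rw [← hsup]
    exact .inr (sup_le_sup inf_le_right inf_le_right)

end Dimension

/-! ### Radicals -/

section Radical

variable {K V : Type*} [Field K] [AddCommGroup V] [Module K V] {ξ : LinearMap.BilinForm K V}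
  {H U W : Submodule K V}

theorem rad_le (U : Submodule K V) : rad ξ U ≤ U := inf_le_left

theorem rad_inf_le_rad (hHU : H ≤ U) : rad ξ U ⊓ H ≤ rad ξ H :=
  fun _ hx => ⟨hx.2, fun u hu => hx.1.2 u (hHU hu)⟩

theorem rad_eq_inf_rad_of_sup_eq (hξ : ξ.IsRefl) (h : W ⊔ rad ξ U = U) :
    rad ξ W = W ⊓ rad ξ U := by
  refine le_antisymm (le_inf (rad_le W) fun x hx => ⟨h ▸ Submodule.mem_sup_left hx.1, ?_⟩) ?_
  · intro u hu
    rw [← h] at hu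
    obtain ⟨w, hw, r, hr, rfl⟩ := Submodule.mem_sup.1 hu
    rw [map_add, LinearMap.add_apply, hx.2 w hw, zero_add]
    exact hξ _ _ (hr.2 x (h ▸ Submodule.mem_sup_left hx.1))
  · rw [inf_comm]
    exact rad_inf_le_rad (h ▸ le_sup_left)

theorem isRegular_iff : IsRegular ξ U ↔ ∀ x ∈ U, (∀ u ∈ U, ξ u x = 0) → x = 0 := by
  rw [IsRegular, Submodule.eq_bot_iff]
  exact ⟨fun h x hx hU => h x ⟨hx, hU⟩, fun h x hx => h x hx.1 hx.2⟩

theorem IsRegular.nondegenerate_restrict (hξ : ξ.IsRefl) (hU : IsRegular ξ U) :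
    (ξ.restrict U).Nondegenerate :=
  ξ.nondegenerate_restrict_of_disjoint_orthogonal hξ (disjoint_iff.2 hU)

theorem le_orthogonal_comm (hξ : ξ.IsRefl) : U ≤ ξ.orthogonal W ↔ W ≤ ξ.orthogonal U :=
  ⟨fun h _ hw _ hu => hξ _ _ (h hu _ hw), fun h _ hw _ hu => hξ _ _ (h hu _ hw)⟩

theorem orthogonal_sup (hξ : ξ.IsRefl) (U W : Submodule K V) :
    ξ.orthogonal (U ⊔ W) = ξ.orthogonal U ⊓ ξ.orthogonal W :=
  eq_of_forall_le_iff fun Z => by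
    simp only [le_inf_iff, le_orthogonal_comm hξ (U := Z), sup_le_iff]

variable [FiniteDimensional K V]

theorem orthogonal_inf (hξ : ξ.IsRefl) (hN : ξ.Nondegenerate) (U W : Submodule K V) :
    ξ.orthogonal (U ⊓ W) = ξ.orthogonal U ⊔ ξ.orthogonal W := by
  rw [← LinearMap.BilinForm.orthogonal_orthogonal hN hξ (ξ.orthogonal U ⊔ ξ.orthogonal W),
    orthogonal_sup hξ, LinearMap.BilinForm.orthogonal_orthogonal hN hξ,
    LinearMap.BilinForm.orthogonal_orthogonal hN hξ]

theorem isRegular_iff_finrank : IsRegular ξ U ↔ finrank K (rad ξ U) = 0 :=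
  Submodule.finrank_eq_zero.symm

theorem isRegular_or_isTangential_iff :
    IsRegular ξ U ∨ IsTangential ξ U ↔ finrank K (rad ξ U) ≤ 1 := by
  rw [isRegular_iff_finrank, IsTangential]
  omega

theorem IsRegular.finrank_rad_le_one (hU : IsRegular ξ U) : finrank K (rad ξ U) ≤ 1 :=
  isRegular_or_isTangential_iff.1 (.inl hU)

/-- In an odd dimension the Gram matrix `M` would satisfy `det M = det Mᵀ = -det M`. -/
theorem IsRegular.even_finrank (hξ : ξ.IsAlt) (h2 : (2 : K) ≠ 0) (hU : IsRegular ξ U) :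
    Even (finrank K U) := by
  let b := finBasis K U
  let M := LinearMap.BilinForm.toMatrix b (ξ.restrict U)
  have hdet : M.det ≠ 0 := (LinearMap.BilinForm.nondegenerate_iff_det_ne_zero b).1
    (hU.nondegenerate_restrict hξ.isRefl)
  have htranspose : M.transpose = -M := by
    ext i j
    simp only [M, Matrix.transpose_apply, Matrix.neg_apply, LinearMap.BilinForm.toMatrix_apply]
    exact (hξ.neg_eq _ _).symm
  by_contra hodd
  have hneg := congrArg Matrix.det htranspose
  rw [Matrix.det_transpose, Matrix.det_neg, Fintype.card_fin,
    (Nat.not_even_iff_odd.1 hodd).neg_one_pow, neg_one_mul] at hneg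
  have htwo : 2 * M.det = 0 := by linear_combination hneg
  exact hdet ((mul_eq_zero.1 htwo).resolve_left h2)

theorem even_finrank_rad_iff (hξ : ξ.IsAlt) (h2 : (2 : K) ≠ 0) (U : Submodule K V) :
    Even (finrank K (rad ξ U)) ↔ Even (finrank K U) := by
  obtain ⟨Q, hQ⟩ := (rad ξ U).exists_isCompl
  have hsup : Q ⊓ U ⊔ rad ξ U = U := by
    rw [sup_comm, ← sup_inf_assoc_of_le _ (rad_le U), hQ.sup_eq_top, top_inf_eq]
  have hinf : Q ⊓ U ⊓ rad ξ U = ⊥ := by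
    rw [inf_assoc, inf_eq_right.2 (rad_le U), inf_comm, hQ.inf_eq_bot]
  have hreg : IsRegular ξ (Q ⊓ U) := by
    rw [IsRegular, rad_eq_inf_rad_of_sup_eq hξ.isRefl hsup, hinf]
  have hadd := Submodule.finrank_sup_add_finrank_inf_eq (Q ⊓ U) (rad ξ U)
  rw [hsup, hinf, finrank_bot, add_zero] at hadd
  rw [hadd, Nat.even_add]
  exact (iff_true_left (hreg.even_finrank hξ h2)).symm

theorem isRegular_of_even (hξ : ξ.IsAlt) (h2 : (2 : K) ≠ 0) (hU : Even (finrank K U))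
    (h : finrank K (rad ξ U) ≤ 1) : IsRegular ξ U := by
  obtain ⟨r, hr⟩ := (even_finrank_rad_iff hξ h2 U).2 hU
  rw [isRegular_iff_finrank]
  omega

theorem isTangential_of_odd (hξ : ξ.IsAlt) (h2 : (2 : K) ≠ 0) (hU : ¬ Even (finrank K U))
    (h : finrank K (rad ξ U) ≤ 1) : IsTangential ξ U := by
  rw [← even_finrank_rad_iff hξ h2 U, Nat.not_even_iff_odd] at hU
  exact le_antisymm h hU.pos

theorem finrank_inf_orthogonal_le (hHU : H ≤ U) (hd : finrank K U = finrank K H + 1) :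
    finrank K ↥(U ⊓ ξ.orthogonal H) ≤ finrank K (rad ξ U) + 1 := by
  obtain ⟨w, hw, hwH⟩ := exists_mem_notMem_of_finrank_lt (S := H) (T := U) (by omega)
  refine (finrank_le_finrank_inf_ker_add_one _ (ξ w)).trans
    (Nat.succ_le_succ (Submodule.finrank_mono fun x hx => ⟨hx.1.1, fun u hu => ?_⟩))
  rw [← sup_span_singleton_eq hHU hd hw hwH] at hu
  obtain ⟨a, ha, b, hb, rfl⟩ := Submodule.mem_sup.1 hu
  obtain ⟨c, rfl⟩ := Submodule.mem_span_singleton.1 hb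
  have hax : ξ a x = 0 := hx.1.2 a ha
  have hwx : ξ w x = 0 := hx.2
  rw [map_add, map_smul, LinearMap.add_apply, LinearMap.smul_apply, hax, hwx, smul_zero,
    add_zero]

theorem IsRegular.finrank_inf_orthogonal_le_one (hU : IsRegular ξ U) (hHU : H ≤ U)
    (hd : finrank K U = finrank K H + 1) : finrank K ↥(U ⊓ ξ.orthogonal H) ≤ 1 := by
  simpa only [isRegular_iff_finrank.1 hU, zero_add] using finrank_inf_orthogonal_le (ξ := ξ) hHU hd

theorem IsRegular.finrank_rad_le_one_of_le (hU : IsRegular ξ U) (hHU : H ≤ U)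
    (hd : finrank K U = finrank K H + 1) : finrank K (rad ξ H) ≤ 1 :=
  (Submodule.finrank_mono (inf_le_inf_right _ hHU)).trans (hU.finrank_inf_orthogonal_le_one hHU hd)

theorem finrank_rad_le_one_of_inf_eq_bot (hHU : H ≤ U) (hd : finrank K U = finrank K H + 1)
    (h : rad ξ U ⊓ H = ⊥) : finrank K (rad ξ U) ≤ 1 := by
  have hle := finrank_le_finrank_inf_add_one hHU hd (rad_le (ξ := ξ) U)
  rwa [h, finrank_bot] at hle

theorem IsRegular.finrank_rad_le_one_of_ge (hH : IsRegular ξ H) (hHU : H ≤ U)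
    (hd : finrank K U = finrank K H + 1) : finrank K (rad ξ U) ≤ 1 :=
  finrank_rad_le_one_of_inf_eq_bot hHU hd (le_bot_iff.1 ((rad_inf_le_rad hHU).trans hH.le))

theorem finrank_add_finrank_orthogonal (hN : ξ.Nondegenerate) (U : Submodule K V) :
    finrank K U + finrank K (ξ.orthogonal U) = finrank K V := by
  rw [LinearMap.BilinForm.finrank_orthogonal hN, Nat.add_sub_cancel' U.finrank_le]

theorem rad_orthogonal (hξ : ξ.IsRefl) (hN : ξ.Nondegenerate) (U : Submodule K V) :
    rad ξ (ξ.orthogonal U) = rad ξ U := by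
  rw [rad, LinearMap.BilinForm.orthogonal_orthogonal hN hξ, rad, inf_comm]

theorem orthogonal_le_orthogonal_iff (hξ : ξ.IsRefl) (hN : ξ.Nondegenerate) :
    ξ.orthogonal U ≤ ξ.orthogonal W ↔ W ≤ U := by
  rw [le_orthogonal_comm hξ, LinearMap.BilinForm.orthogonal_orthogonal hN hξ]

end Radical

/-! ### Hyperplanes of a regular subspace -/

section PerpIn

variable {K V : Type*} [Field K] [AddCommGroup V] [Module K V]

/-- The subspace of the vectors of `Y` orthogonal to `x`. For regular `Y` these are the
hyperplanes of `Y`. -/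
def perpIn (ξ : LinearMap.BilinForm K V) (Y : Submodule K V) (x : V) : Submodule K V :=
  Y ⊓ LinearMap.ker (ξ x)

variable {ξ : LinearMap.BilinForm K V} {Y : Submodule K V} {x y : V}

theorem perpIn_le : perpIn ξ Y x ≤ Y := inf_le_left

theorem self_mem_perpIn (hξ : ξ.IsAlt) (hx : x ∈ Y) : x ∈ perpIn ξ Y x := ⟨hx, hξ x⟩

theorem isRegular_inf_perpIn_iff (hξ : ξ.IsAlt) (hY : IsRegular ξ Y) (hx : x ∈ Y) (hx0 : x ≠ 0)
    (hy : y ∈ Y) : IsRegular ξ (perpIn ξ Y x ⊓ perpIn ξ Y y) ↔ ξ x y ≠ 0 := by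
  rw [isRegular_iff]
  constructor
  · exact fun h hxy => hx0 (h x ⟨self_mem_perpIn hξ hx, hx, hξ.isRefl _ _ hxy⟩
      fun u hu => hξ.isRefl _ _ hu.1.2)
  · intro hxy z hz h
    have hyx : ξ y x ≠ 0 := fun h0 => hxy (hξ.isRefl _ _ h0)
    refine isRegular_iff.1 hY z hz.1.1 fun u hu => ?_
    -- the projection of `u` along the hyperbolic plane spanned by `x` and `y`
    have hproj : u - (ξ y u / ξ y x) • x - (ξ x u / ξ x y) • y ∈ perpIn ξ Y x ⊓ perpIn ξ Y y := by
      have hmem := Y.sub_mem (Y.sub_mem hu (Y.smul_mem (ξ y u / ξ y x) hx))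
        (Y.smul_mem (ξ x u / ξ x y) hy)
      refine ⟨⟨hmem, ?_⟩, hmem, ?_⟩
      · simp [hξ x, hxy]
      · simp [hξ y, hyx]
    have hxz : ξ x z = 0 := hz.1.2
    have hyz : ξ y z = 0 := hz.2.2
    simpa [hxz, hyz] using h _ hproj

variable [FiniteDimensional K V]

theorem finrank_perpIn (hξ : ξ.IsRefl) (hY : IsRegular ξ Y) (hx : x ∈ Y) (hx0 : x ≠ 0) :
    finrank K (perpIn ξ Y x) + 1 = finrank K Y :=
  finrank_inf_ker_add_one fun h => hx0 (isRegular_iff.1 hY x hx fun _ hu => hξ _ _ (h hu))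

theorem exists_eq_perpIn (hξ : ξ.IsRefl) (hN : ξ.Nondegenerate) (hY : IsRegular ξ Y)
    {H : Submodule K V} (hHY : H ≤ Y) (hd : finrank K H + 1 = finrank K Y) :
    ∃ x ∈ Y, x ≠ 0 ∧ H = perpIn ξ Y x := by
  have hle := finrank_add_finrank_le Y (ξ.orthogonal H)
  have hperp := finrank_add_finrank_orthogonal hN H
  obtain ⟨x, hx, hx0⟩ := exists_ne_zero_of_finrank_pos (S := Y ⊓ ξ.orthogonal H) (by omega)
  have hxd := finrank_perpIn hξ hY hx.1 hx0
  exact ⟨x, hx.1, hx0, Submodule.eq_of_le_of_finrank_le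
    (fun y hy => ⟨hHY hy, hξ _ _ (hx.2 y hy)⟩) (by omega)⟩

theorem mem_span_of_perpIn_eq (hξ : ξ.IsRefl) (hY : IsRegular ξ Y) (hx : x ∈ Y) (hx0 : x ≠ 0)
    (hy : y ∈ Y) (h : perpIn ξ Y x = perpIn ξ Y y) : y ∈ K ∙ x :=
  mem_span_singleton_of_finrank_le_one
    (hY.finrank_inf_orthogonal_le_one perpIn_le (finrank_perpIn hξ hY hx hx0).symm)
    ⟨hx, fun _ hu => hξ _ _ hu.2⟩ ⟨hy, fun _ hu => hξ _ _ (h ▸ hu).2⟩ hx0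

end PerpIn

/-! ### Symplectic Grassmann spaces -/

section Geometry

variable {K V : Type*} [Field K] [AddCommGroup V] [Module K V] {ξ : LinearMap.BilinForm K V}
  {j k : ℕ}

/-- A nondegenerate alternating form in characteristic different from two: the data of
`IsSymplecticSpace` that concern the form alone. -/
structure IsSymplectic (ξ : LinearMap.BilinForm K V) : Prop where
  alt : ξ.IsAlt
  nondeg : ξ.Nondegenerate
  two_ne_zero : (2 : K) ≠ 0

theorem IsSymplecticSpace.isSymplectic {n : ℕ} (h : IsSymplecticSpace ξ n) : IsSymplectic ξ :=
  ⟨h.2.2.2.1, h.2.2.2.2, Ring.two_ne_zero h.1⟩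

theorem IsSymplectic.refl (h : IsSymplectic ξ) : ξ.IsRefl := h.alt.isRefl

theorem TR.finrank_eq (U : TR ξ k) : finrank K U.1 = k := U.2.1

theorem TR.ne {U W : TR ξ k} (h : U ≠ W) : U.1 ≠ W.1 := Subtype.coe_injective.ne h

theorem IsSymplectic.isRegular_top (h : IsSymplectic ξ) : IsRegular ξ ⊤ :=
  isRegular_iff.2 fun x _ hx => h.nondeg.2 x fun u => hx u trivial

variable [FiniteDimensional K V]

theorem IsSymplectic.even_finrank (h : IsSymplectic ξ) : Even (finrank K V) := by
  simpa only [finrank_top] using h.isRegular_top.even_finrank h.alt h.two_ne_zero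

theorem TR.finrank_rad_le (U : TR ξ k) : finrank K (rad ξ U.1) ≤ 1 :=
  isRegular_or_isTangential_iff.1 U.2.2

/-- The element of `TR ξ k` given by a subspace with at most one-dimensional radical. -/
def TR.of (U : Submodule K V) (hd : finrank K U = k) (hr : finrank K (rad ξ U) ≤ 1) : TR ξ k :=
  ⟨U, hd, isRegular_or_isTangential_iff.2 hr⟩

theorem IsSymplectic.finrank_rad_le_one_iff (h : IsSymplectic ξ) {U : Submodule K V}
    (hU : Even (finrank K U)) : finrank K (rad ξ U) ≤ 1 ↔ IsRegular ξ U :=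
  ⟨isRegular_of_even h.alt h.two_ne_zero hU, IsRegular.finrank_rad_le_one⟩

theorem IsSymplectic.isRegular (h : IsSymplectic ξ) (hk : Even k) (U : TR ξ k) :
    IsRegular ξ U.1 :=
  isRegular_of_even h.alt h.two_ne_zero (U.finrank_eq.symm ▸ hk) U.finrank_rad_le

theorem IsSymplectic.isTangential (h : IsSymplectic ξ) (hk : ¬ Even k) (U : TR ξ k) :
    IsTangential ξ U.1 :=
  isTangential_of_odd h.alt h.two_ne_zero (U.finrank_eq.symm ▸ hk) U.finrank_rad_le

/-! ### Lines and adjacency -/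

theorem pencil_eq {l : Set (TR ξ k)} (hl : l ∈ pencils ξ k) {U W : TR ξ k} (hU : U ∈ l)
    (hW : W ∈ l) (hne : U ≠ W) :
    l = {Z | U.1 ⊓ W.1 ≤ Z.1 ∧ Z.1 ≤ U.1 ⊔ W.1} ∧ finrank K ↥(U.1 ⊓ W.1) + 1 = k ∧
      finrank K (rad ξ (U.1 ⊓ W.1)) ≤ 1 ∧ finrank K (rad ξ (U.1 ⊔ W.1)) ≤ 1 := by
  obtain ⟨-, j, H, B, hj, -, rfl⟩ := hl
  have hH : finrank K H.1 + 1 = k := by rw [H.finrank_eq, hj]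
  rw [sup_eq_of_le U.finrank_eq W.finrank_eq B.finrank_eq hU.2 hW.2 (TR.ne hne),
    inf_eq_of_ge U.finrank_eq W.finrank_eq hH hU.1 hW.1 (TR.ne hne)]
  exact ⟨rfl, hH, H.finrank_rad_le, B.finrank_rad_le⟩

theorem pencil_mem {U W : TR ξ k} (h : finrank K ↥(U.1 ⊓ W.1) + 1 = k)
    (hinf : finrank K (rad ξ (U.1 ⊓ W.1)) ≤ 1) (hsup : finrank K (rad ξ (U.1 ⊔ W.1)) ≤ 1) :
    {Z : TR ξ k | U.1 ⊓ W.1 ≤ Z.1 ∧ Z.1 ≤ U.1 ⊔ W.1} ∈ pencils ξ k :=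
  ⟨⟨U, inf_le_left, le_sup_left⟩, _, TR.of _ rfl hinf,
    TR.of _ (finrank_sup_eq_add_one U.finrank_eq W.finrank_eq h) hsup, h,
    inf_le_left.trans (le_sup_left (a := U.1)), rfl⟩

theorem adj_iff {U W : TR ξ k} : (adjacency ξ k).Adj U W ↔ U ≠ W ∧
    finrank K ↥(U.1 ⊓ W.1) + 1 = k ∧ finrank K (rad ξ (U.1 ⊓ W.1)) ≤ 1 ∧
      finrank K (rad ξ (U.1 ⊔ W.1)) ≤ 1 := by
  constructor
  · rintro ⟨hne, l, hl, hU, hW⟩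
    exact ⟨hne, (pencil_eq hl hU hW hne).2⟩
  · rintro ⟨hne, h, hinf, hsup⟩
    exact ⟨hne, _, pencil_mem h hinf hsup, ⟨inf_le_left, le_sup_left⟩,
      ⟨inf_le_right, le_sup_right⟩⟩

theorem IsSymplectic.adj_iff_of_even (h : IsSymplectic ξ) (hk : Even k) {U W : TR ξ k} :
    (adjacency ξ k).Adj U W ↔ U ≠ W ∧ finrank K ↥(U.1 ⊓ W.1) + 1 = k := by
  rw [adj_iff]
  refine and_congr_right fun _ => and_iff_left_of_imp fun hd => ⟨?_, ?_⟩
  · exact (h.isRegular hk U).finrank_rad_le_one_of_le inf_le_left (by rw [U.finrank_eq, hd])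
  · exact (h.isRegular hk U).finrank_rad_le_one_of_ge le_sup_left
      (by rw [U.finrank_eq, finrank_sup_eq_add_one U.finrank_eq W.finrank_eq hd])

theorem IsSymplectic.adj_iff_of_odd (h : IsSymplectic ξ) (hk : ¬ Even k) {U W : TR ξ k} :
    (adjacency ξ k).Adj U W ↔ U ≠ W ∧ finrank K ↥(U.1 ⊓ W.1) + 1 = k ∧
      IsRegular ξ (U.1 ⊓ W.1) ∧ IsRegular ξ (U.1 ⊔ W.1) := by
  rw [adj_iff]
  refine and_congr_right fun _ => and_congr_right fun hd => and_congr
    (h.finrank_rad_le_one_iff ?_) (h.finrank_rad_le_one_iff ?_)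
  · rwa [← hd, Nat.even_add_one, not_not] at hk
  · rwa [finrank_sup_eq_add_one U.finrank_eq W.finrank_eq hd, Nat.even_add_one]

theorem IsTangential.exists_notMem_finrank_rad_sup_span_le_one {H U B : Submodule K V}
    (hB : IsTangential ξ B) (hξ : ξ.IsRefl) (hU : IsRegular ξ U) (hHU : H ≤ U) (hUB : U ≤ B)
    (hdU : finrank K U = finrank K H + 1) (hdB : finrank K B = finrank K U + 1) :
    ∃ v ∈ B, v ∉ U ∧ finrank K (rad ξ (H ⊔ K ∙ v)) ≤ 1 := by
  have hinf : H ⊓ rad ξ B = ⊥ := by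
    rw [inf_comm, ← le_bot_iff, ← hU]
    exact (inf_le_inf_left _ hHU).trans (rad_inf_le_rad hUB)
  have hdim := Submodule.finrank_sup_add_finrank_inf_eq H (rad ξ B)
  rw [hinf, finrank_bot, hB, add_zero, ← hdU] at hdim
  obtain ⟨v, hvB, hvU, hvS⟩ := exists_mem_notMem_notMem
    (not_le_of_finrank_lt (S := U) (T := B) (by omega))
    (not_le_of_finrank_lt (S := H ⊔ rad ξ B) (T := B) (by omega))
  have hsup : H ⊔ K ∙ v ⊔ rad ξ B = B := by
    rw [sup_right_comm]
    exact sup_span_singleton_eq (sup_le (hHU.trans hUB) (rad_le B)) (by rw [hdB, hdim]) hvB hvS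
  refine ⟨v, hvB, hvU, ?_⟩
  rw [rad_eq_inf_rad_of_sup_eq hξ hsup]
  exact (Submodule.finrank_mono inf_le_right).trans hB.le

theorem IsRegular.exists_notMem_finrank_rad_sup_span_le_one {H U B : Submodule K V}
    (hB : IsRegular ξ B) (hHU : H ≤ U) (hUB : U ≤ B) (hdU : finrank K U = finrank K H + 1)
    (hdB : finrank K B = finrank K U + 1) :
    ∃ v ∈ B, v ∉ U ∧ finrank K (rad ξ (H ⊔ K ∙ v)) ≤ 1 := by
  obtain ⟨v, hvB, hvU⟩ := exists_mem_notMem_of_finrank_lt (S := U) (T := B) (by omega)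
  refine ⟨v, hvB, hvU, hB.finrank_rad_le_one_of_le (sup_le (hHU.trans hUB)
    ((Submodule.span_singleton_le_iff_mem v B).2 hvB)) ?_⟩
  rw [Submodule.finrank_sup_span_singleton fun hvH => hvU (hHU hvH), hdB, hdU]

theorem IsSymplectic.exists_ne_mem_pencil (h : IsSymplectic ξ) {l : Set (TR ξ k)}
    (hl : l ∈ pencils ξ k) {U : TR ξ k} (hU : U ∈ l) : ∃ W ∈ l, W ≠ U := by
  obtain ⟨-, j, H, B, hj, -, rfl⟩ := hl
  have hdU : finrank K U.1 = finrank K H.1 + 1 := by rw [U.finrank_eq, H.finrank_eq, hj]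
  have hdB : finrank K B.1 = finrank K U.1 + 1 := by rw [U.finrank_eq, B.finrank_eq]
  obtain ⟨v, hvB, hvU, hrad⟩ : ∃ v ∈ B.1, v ∉ U.1 ∧ finrank K (rad ξ (H.1 ⊔ K ∙ v)) ≤ 1 := by
    by_cases hk : Even k
    · exact (h.isTangential (by rwa [Nat.even_add_one, not_not])
        B).exists_notMem_finrank_rad_sup_span_le_one h.refl (h.isRegular hk U) hU.1 hU.2 hdU hdB
    · exact (h.isRegular (by rwa [Nat.even_add_one])
        B).exists_notMem_finrank_rad_sup_span_le_one hU.1 hU.2 hdU hdB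
  have hd := Submodule.finrank_sup_span_singleton fun hvH => hvU (hU.1 hvH)
  refine ⟨TR.of (H.1 ⊔ K ∙ v) (by rw [hd, H.finrank_eq, hj]) hrad, ⟨le_sup_left,
    sup_le (hU.1.trans hU.2) ((Submodule.span_singleton_le_iff_mem v B.1).2 hvB)⟩, ?_⟩
  rintro rfl
  exact hvU (Submodule.mem_sup_right (Submodule.mem_span_singleton_self v))

/-! ### The duality `U ↦ U^⊥` -/

/-- Passing to the orthogonal complement, as a bijection between the regular or tangential
subspaces of complementary dimensions. -/
def IsSymplectic.dual (h : IsSymplectic ξ) (hkj : k + j = finrank K V) : TR ξ k ≃ TR ξ j where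
  toFun U := TR.of (ξ.orthogonal U.1)
    (by have := finrank_add_finrank_orthogonal h.nondeg U.1; rw [U.finrank_eq] at this; omega)
    (by rw [rad_orthogonal h.refl h.nondeg]; exact U.finrank_rad_le)
  invFun U := TR.of (ξ.orthogonal U.1)
    (by have := finrank_add_finrank_orthogonal h.nondeg U.1; rw [U.finrank_eq] at this; omega)
    (by rw [rad_orthogonal h.refl h.nondeg]; exact U.finrank_rad_le)
  left_inv U := Subtype.ext (LinearMap.BilinForm.orthogonal_orthogonal h.nondeg h.refl U.1)
  right_inv U := Subtype.ext (LinearMap.BilinForm.orthogonal_orthogonal h.nondeg h.refl U.1)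

theorem IsSymplectic.dual_dual (h : IsSymplectic ξ) (hkj : k + j = finrank K V)
    (hjk : j + k = finrank K V) (U : TR ξ k) : h.dual hjk (h.dual hkj U) = U :=
  (h.dual hkj).left_inv U

variable {j' k' : ℕ} {U : TR ξ k} {W : TR ξ k'}

theorem IsSymplectic.dual_le_dual_iff (h : IsSymplectic ξ) (hkj : k + j = finrank K V)
    (hkj' : k' + j' = finrank K V) : (h.dual hkj U).1 ≤ (h.dual hkj' W).1 ↔ W.1 ≤ U.1 :=
  orthogonal_le_orthogonal_iff h.refl h.nondeg

theorem IsSymplectic.le_dual_comm (h : IsSymplectic ξ) (hkj : k + j = finrank K V)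
    (hkj' : k' + j' = finrank K V) : W.1 ≤ (h.dual hkj U).1 ↔ U.1 ≤ (h.dual hkj' W).1 :=
  le_orthogonal_comm h.refl

theorem IsSymplectic.dual_le_comm (h : IsSymplectic ξ) (hkj : k + j = finrank K V)
    (hkj' : k' + j' = finrank K V) : (h.dual hkj U).1 ≤ W.1 ↔ (h.dual hkj' W).1 ≤ U.1 := by
  rw [← h.dual_le_dual_iff hkj' (add_comm k j ▸ hkj : j + k = finrank K V), h.dual_dual]

theorem IsSymplectic.preimage_dual_mem_pencils (h : IsSymplectic ξ) (hkj : k + j = finrank K V)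
    {l : Set (TR ξ j)} (hl : l ∈ pencils ξ j) : h.dual hkj ⁻¹' l ∈ pencils ξ k := by
  obtain ⟨⟨U, hU⟩, i, H, B, hi, hHB, rfl⟩ := hl
  have hB : j + 1 ≤ finrank K V := B.finrank_eq ▸ B.1.finrank_le
  refine ⟨⟨h.dual (by omega) U, ?_⟩, k - 1, h.dual (by omega) B, h.dual (by omega) H, by omega,
    (h.dual_le_dual_iff _ _).2 hHB, ?_⟩
  · rw [Set.mem_preimage, h.dual_dual]
    exact hU
  · ext W
    exact and_comm.trans (and_congr (h.dual_le_comm hkj (by omega)) (h.le_dual_comm hkj (by omega)))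

theorem IsSymplectic.preimage_dual_mem_pencils_iff (h : IsSymplectic ξ)
    (hkj : k + j = finrank K V) {l : Set (TR ξ j)} :
    h.dual hkj ⁻¹' l ∈ pencils ξ k ↔ l ∈ pencils ξ j := by
  refine ⟨fun hl => ?_, h.preimage_dual_mem_pencils hkj⟩
  have hpre := h.preimage_dual_mem_pencils (add_comm k j ▸ hkj : j + k = finrank K V) hl
  rwa [← Set.preimage_comp, show h.dual hkj ∘ h.dual _ = id from funext (h.dual_dual _ _),
    Set.preimage_id] at hpre

theorem IsSymplectic.adj_dual_iff (h : IsSymplectic ξ) (hkj : k + j = finrank K V) {U W : TR ξ k} :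
    (adjacency ξ k).Adj U W ↔ (adjacency ξ j).Adj (h.dual hkj U) (h.dual hkj W) := by
  refine and_congr (h.dual hkj).injective.ne_iff.symm ⟨?_, ?_⟩
  · rintro ⟨l, hl, hU, hW⟩
    refine ⟨_, h.preimage_dual_mem_pencils (add_comm k j ▸ hkj : j + k = finrank K V) hl, ?_, ?_⟩
    · rwa [Set.mem_preimage, h.dual_dual]
    · rwa [Set.mem_preimage, h.dual_dual]
  · rintro ⟨l, hl, hU, hW⟩
    exact ⟨_, h.preimage_dual_mem_pencils hkj hl, hU, hW⟩

end Geometry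

section Existence

variable {K V : Type*} [Field K] [AddCommGroup V] [Module K V] {ξ : LinearMap.BilinForm K V}
  {j k : ℕ} {Y : Submodule K V} {x y : V} {U W : TR ξ k}

theorem TR.ne_zero_of_eq_perpIn (hd : finrank K Y = k + 1) (hU : U.1 = perpIn ξ Y x) : x ≠ 0 := by
  rintro rfl
  have hUY : U.1 = Y := by rw [hU, perpIn, map_zero, LinearMap.ker_zero, inf_top_eq]
  have hdU := U.finrank_eq
  rw [hUY] at hdU
  omega

variable [FiniteDimensional K V]

theorem IsSymplectic.exists_ge_not_le (h : IsSymplectic ξ) (hjk : j + 1 = k) (hk : Even k)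
    (H : TR ξ j) {B : Submodule K V} (hB : B ≠ ⊤) : ∃ Z : TR ξ k, H.1 ≤ Z.1 ∧ ¬ Z.1 ≤ B := by
  have hrad : finrank K (rad ξ H.1) = 1 := h.isTangential (by rwa [← Nat.even_add_one, hjk]) H
  obtain ⟨r, hr, hr0⟩ := exists_ne_zero_of_finrank_pos (S := rad ξ H.1) (by omega)
  obtain ⟨v, -, hvr, hvB⟩ := exists_mem_notMem_notMem (B := ⊤)
    (fun hle => hr0 (h.nondeg.1 r fun y => hle trivial) : ¬ ⊤ ≤ LinearMap.ker (ξ r))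
    (fun hle => hB (top_le_iff.1 hle))
  have hvH : v ∉ H.1 := fun hvH => hvr (h.refl _ _ (hr.2 v hvH))
  have hv : v ∈ H.1 ⊔ K ∙ v := Submodule.mem_sup_right (Submodule.mem_span_singleton_self v)
  have hd : finrank K ↥(H.1 ⊔ K ∙ v) = finrank K H.1 + 1 :=
    Submodule.finrank_sup_span_singleton hvH
  have hinf : rad ξ (H.1 ⊔ K ∙ v) ⊓ H.1 = ⊥ := by
    rw [Submodule.eq_bot_iff]
    intro z hz
    by_contra hz0
    obtain ⟨c, rfl⟩ := Submodule.mem_span_singleton.1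
      (mem_span_singleton_of_finrank_le_one hrad.le (rad_inf_le_rad le_sup_left hz) hr hz0)
    refine hvr (h.refl _ _ ?_)
    rw [map_smul, hz.1.2 v hv, smul_zero]
  exact ⟨TR.of _ (by rw [hd, H.finrank_eq, hjk])
    (finrank_rad_le_one_of_inf_eq_bot le_sup_left hd hinf), le_sup_left, fun hle => hvB (hle hv)⟩

theorem IsSymplectic.exists_le_not_ge (h : IsSymplectic ξ) (hk : Even k) (B : TR ξ (k + 1))
    {H : Submodule K V} (hH : H ≠ ⊥) : ∃ Z : TR ξ k, Z.1 ≤ B.1 ∧ ¬ H ≤ Z.1 := by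
  have hn : k + 1 ≤ finrank K V := B.finrank_eq ▸ B.1.finrank_le
  obtain ⟨j, hj⟩ := Nat.exists_eq_add_of_le hn
  have hj' : Even (j + 1) := by
    have heven := h.even_finrank
    rw [hj, add_right_comm, add_assoc] at heven
    exact (Nat.even_add.1 heven).1 hk
  have htop : ξ.orthogonal H ≠ ⊤ := by
    intro e
    have hperp := finrank_add_finrank_orthogonal h.nondeg H
    rw [e, finrank_top] at hperp
    exact hH (Submodule.finrank_eq_zero.1 (by omega))
  obtain ⟨Z, hBZ, hZ⟩ := h.exists_ge_not_le rfl hj' (h.dual hj.symm B) htop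
  exact ⟨h.dual (by omega) Z, (h.dual_le_comm hj.symm (by omega)).1 hBZ,
    fun hle => hZ ((le_orthogonal_comm h.refl).1 hle)⟩

/-! ### Lines in even dimension -/

theorem IsSymplectic.adj_or_eq_iff (h : IsSymplectic ξ) (hk : Even k) {U W : TR ξ k} :
    (adjacency ξ k).Adj U W ∨ U = W ↔ k ≤ finrank K ↥(U.1 ⊓ W.1) + 1 := by
  rw [h.adj_iff_of_even hk]
  by_cases e : U = W
  · subst e
    rw [inf_idem, U.finrank_eq]
    exact iff_of_true (.inr rfl) k.le_succ
  · have hlt := finrank_inf_lt U.finrank_eq W.finrank_eq (TR.ne e)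
    simp only [ne_eq, e, not_false_eq_true, true_and, or_false]
    omega

theorem IsSymplectic.inf_le_or_le_sup (h : IsSymplectic ξ) (hk : Even k) {U W Z : TR ξ k}
    (hUW : (adjacency ξ k).Adj U W) (hZU : (adjacency ξ k).Adj Z U ∨ Z = U)
    (hZW : (adjacency ξ k).Adj Z W ∨ Z = W) : U.1 ⊓ W.1 ≤ Z.1 ∨ Z.1 ≤ U.1 ⊔ W.1 := by
  rcases hZU with hZU | rfl
  · rcases hZW with hZW | rfl
    · rw [h.adj_iff_of_even hk] at hUW hZU hZW
      exact SympGrassmann.inf_le_or_le_sup Z.finrank_eq hUW.2 hZU.2 hZW.2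
    · exact .inl inf_le_right
  · exact .inl inf_le_left

theorem IsSymplectic.adj_or_eq_of_ge (h : IsSymplectic ξ) (hk : Even k) {X : Submodule K V}
    (hX : finrank K X + 1 = k) {U W : TR ξ k} (hU : X ≤ U.1) (hW : X ≤ W.1) :
    (adjacency ξ k).Adj U W ∨ U = W := by
  rw [h.adj_or_eq_iff hk]
  exact hX.symm.trans_le (Nat.succ_le_succ (Submodule.finrank_mono (le_inf hU hW)))

theorem IsSymplectic.adj_or_eq_of_le (h : IsSymplectic ξ) (hk : Even k) {Y : Submodule K V}
    (hY : finrank K Y = k + 1) {U W : TR ξ k} (hU : U.1 ≤ Y) (hW : W.1 ≤ Y) :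
    (adjacency ξ k).Adj U W ∨ U = W := by
  rw [h.adj_or_eq_iff hk]
  exact U.finrank_eq.symm.trans_le
    (finrank_le_finrank_inf_add_one hW (by rw [hY, W.finrank_eq]) hU)

/-- The line through `U` and `W` is `{U, W}^∼^∼`, where `∼` means adjacent or equal. -/
theorem IsSymplectic.mem_line_iff (h : IsSymplectic ξ) (hk : Even k) (hk2 : 2 ≤ k)
    (hkn : k + 2 ≤ finrank K V) {U W Z : TR ξ k} (hUW : (adjacency ξ k).Adj U W) :
    (U.1 ⊓ W.1 ≤ Z.1 ∧ Z.1 ≤ U.1 ⊔ W.1) ↔ ∀ T : TR ξ k,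
      ((adjacency ξ k).Adj T U ∨ T = U) → ((adjacency ξ k).Adj T W ∨ T = W) →
      ((adjacency ξ k).Adj T Z ∨ T = Z) := by
  obtain ⟨-, hinf, hrinf, hrsup⟩ := adj_iff.1 hUW
  have hsup := finrank_sup_eq_add_one U.finrank_eq W.finrank_eq hinf
  have hle : U.1 ⊓ W.1 ≤ U.1 ⊔ W.1 := inf_le_left.trans le_sup_left
  constructor
  · rintro ⟨hZinf, hZsup⟩ T hTU hTW
    rcases h.inf_le_or_le_sup hk hUW hTU hTW with hT | hT
    · exact h.adj_or_eq_of_ge hk hinf hT hZinf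
    · exact h.adj_or_eq_of_le hk hsup hT hZsup
  · intro hT
    have hZU := (hT U (.inr rfl) (.inl hUW)).imp (fun h => h.symm) Eq.symm
    have hZW := (hT W (.inl hUW.symm) (.inr rfl)).imp (fun h => h.symm) Eq.symm
    rcases h.inf_le_or_le_sup hk hUW hZU hZW with hZ | hZ
    · refine ⟨hZ, ?_⟩
      by_contra hZsup
      obtain ⟨T, hTsup, hTinf⟩ := h.exists_le_not_ge hk (TR.of _ hsup hrsup)
        (H := U.1 ⊓ W.1) (fun e => by rw [e, finrank_bot] at hinf; omega)
      have hTZ := (h.adj_or_eq_iff hk).1 (hT T (h.adj_or_eq_of_le hk hsup hTsup le_sup_left)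
        (h.adj_or_eq_of_le hk hsup hTsup le_sup_right))
      rw [inf_comm] at hTZ
      have hlt := finrank_inf_lt_of_not_le (by rw [hinf, Z.finrank_eq]) hZ hle hZsup hTsup hTinf
      omega
    · refine ⟨?_, hZ⟩
      by_contra hZinf
      obtain ⟨T, hTinf, hTsup⟩ := h.exists_ge_not_le hinf hk (TR.of _ rfl hrinf)
        (B := U.1 ⊔ W.1) (fun e => by rw [e, finrank_top] at hsup; omega)
      have hTZ := (h.adj_or_eq_iff hk).1 (hT T (h.adj_or_eq_of_ge hk hinf hTinf inf_le_left)
        (h.adj_or_eq_of_ge hk hinf hTinf inf_le_right))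
      have hlt := finrank_inf_lt_of_not_le (X := U.1 ⊓ W.1) (by rw [hinf, T.finrank_eq]) hTinf hle
        hTsup hZ hZinf
      omega

/-! ### Hyperplanes of a regular subspace in odd dimension -/

theorem IsRegular.exists_eq_perpIn (hY : IsRegular ξ Y) (hξ : ξ.IsRefl)
    (hd : finrank K Y = k + 1) (hx : x ∈ Y) (hx0 : x ≠ 0) : ∃ U : TR ξ k, U.1 = perpIn ξ Y x := by
  have hperp := finrank_perpIn hξ hY hx hx0
  exact ⟨TR.of _ (by omega) (hY.finrank_rad_le_one_of_le perpIn_le hperp.symm), rfl⟩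

theorem IsSymplectic.adj_iff_of_eq_perpIn (h : IsSymplectic ξ) (hk : ¬ Even k)
    (hY : IsRegular ξ Y) (hd : finrank K Y = k + 1) (hx : x ∈ Y) (hy : y ∈ Y)
    (hU : U.1 = perpIn ξ Y x) (hW : W.1 = perpIn ξ Y y) :
    (adjacency ξ k).Adj U W ↔ ξ x y ≠ 0 := by
  have hx0 := TR.ne_zero_of_eq_perpIn hd hU
  by_cases e : U = W
  · have hyx := mem_span_of_perpIn_eq h.refl hY hx hx0 hy (by rw [← hU, ← hW, e])
    obtain ⟨c, rfl⟩ := Submodule.mem_span_singleton.1 hyx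
    exact iff_of_false (fun hadj => hadj.1 e)
      (not_not.2 (by rw [map_smul, h.alt x, smul_zero]))
  · have hUY : U.1 ≤ Y := hU ▸ perpIn_le
    have hWY : W.1 ≤ Y := hW ▸ perpIn_le
    rw [h.adj_iff_of_odd hk, ← isRegular_inf_perpIn_iff h.alt hY hx hx0 hy, ← hU, ← hW,
      sup_eq_of_le U.finrank_eq W.finrank_eq hd hUY hWY (TR.ne e)]
    exact ⟨fun hadj => hadj.2.2.1, fun hr => ⟨e,
      finrank_inf_add_one_of_le U.finrank_eq W.finrank_eq hd hUY hWY (TR.ne e), hr, hY⟩⟩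

theorem IsSymplectic.le_of_forall_le (h : IsSymplectic ξ) {Y' : Submodule K V}
    (hY : IsRegular ξ Y) (hd : finrank K Y = k + 1) (hle : ∀ U : TR ξ k, U.1 ≤ Y → U.1 ≤ Y') :
    Y ≤ Y' := by
  intro x hx
  by_cases hx0 : x = 0
  · rw [hx0]
    exact zero_mem _
  · obtain ⟨U, hU⟩ := hY.exists_eq_perpIn h.refl hd hx hx0
    exact hle U (hU ▸ perpIn_le) (hU ▸ self_mem_perpIn h.alt hx)

/-! ### Triangular systems -/

theorem card_le_finrank_of_triangular {r : ℕ} {a b : Fin r → V} (ha : ∀ i, a i ∈ Y)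
    (hab : ∀ i, ξ (a i) (b i) ≠ 0) (h0 : ∀ i j, j < i → ξ (a j) (b i) = 0) :
    r ≤ finrank K Y := by
  let M : Matrix (Fin r) (Fin r) K := fun i j => ξ (a i) (b j)
  have hM : M.det ≠ 0 := by
    rw [Matrix.det_of_isLowerTriangular M fun i j hij => h0 j i hij]
    exact Finset.prod_ne_zero_iff.2 fun i _ => hab i
  have hli : LinearIndependent K ((LinearMap.pi fun j => ξ.flip (b j) : V →ₗ[K] Fin r → K) ∘ a) :=
    Matrix.linearIndependent_rows_of_det_ne_zero hM
  have hliY : LinearIndependent K fun i => (⟨a i, ha i⟩ : Y) :=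
    .of_comp Y.subtype (.of_comp _ hli)
  simpa only [Fintype.card_fin] using hliY.fintype_card_le_finrank

theorem IsRegular.exists_triangular (hY : IsRegular ξ Y) (hξ : ξ.IsRefl) {r : ℕ}
    (hr : r ≤ finrank K Y) : ∃ a b : Fin r → V, (∀ i, a i ∈ Y) ∧ (∀ i, b i ∈ Y) ∧
      (∀ i, ξ (a i) (b i) ≠ 0) ∧ ∀ i j, j < i → ξ (a j) (b i) = 0 := by
  have hnd := hY.nondegenerate_restrict hξ
  let b := finBasis K Y
  let a := (ξ.restrict Y).dualBasis hnd b
  have hab : ∀ i j, ξ (a i) (b j) = if j = i then 1 else 0 :=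
    fun i j => LinearMap.BilinForm.apply_dualBasis_left hnd b i j
  refine ⟨fun i => a (i.castLE hr), fun i => b (i.castLE hr), fun i => (a _).2, fun i => (b _).2,
    fun i => ?_, fun i j hij => ?_⟩
  · rw [hab, if_pos rfl]
    exact one_ne_zero
  · exact (hab _ _).trans (if_neg fun e => hij.ne' (Fin.castLE_injective hr e))

/-- There are sequences `a`, `b` of length `r` in `T` for which the relation `A` is triangular.
For orthogonality in a regular subspace the maximal `r` is the dimension, which is thereby
expressed in a first-order way. -/
def HasTriangular {M : Type*} (A : M → M → Prop) (T : M → Prop) (r : ℕ) : Prop :=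
  ∃ a b : Fin r → M, (∀ i, T (a i) ∧ T (b i) ∧ A (a i) (b i)) ∧ ∀ i j, j < i → ¬ A (a j) (b i)

theorem IsSymplectic.hasTriangular_iff (h : IsSymplectic ξ) (hk : ¬ Even k) (hY : IsRegular ξ Y)
    (hd : finrank K Y = k + 1) (r : ℕ) :
    HasTriangular (adjacency ξ k).Adj (fun U => U.1 ≤ Y) r ↔ r ≤ k + 1 := by
  rw [← hd]
  constructor
  · rintro ⟨a, b, hab, h0⟩
    choose x hx _ hax using fun i =>
      exists_eq_perpIn h.refl h.nondeg hY (hab i).1 (by rw [(a i).finrank_eq, hd])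
    choose y hy _ hby using fun i =>
      exists_eq_perpIn h.refl h.nondeg hY (hab i).2.1 (by rw [(b i).finrank_eq, hd])
    have hadj := fun i j => h.adj_iff_of_eq_perpIn hk hY hd (hx i) (hy j) (hax i) (hby j)
    exact card_le_finrank_of_triangular hx (fun i => (hadj i i).1 (hab i).2.2)
      fun i j hij => not_not.1 ((hadj j i).not.1 (h0 i j hij))
  · intro hr
    obtain ⟨x, y, hx, hy, hxy, h0⟩ := hY.exists_triangular h.refl hr
    choose a ha using fun i => hY.exists_eq_perpIn h.refl hd (hx i)
      fun e => hxy i (by rw [e, map_zero, LinearMap.zero_apply])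
    choose b hb using fun i => hY.exists_eq_perpIn h.refl hd (hy i)
      fun e => hxy i (by rw [e, map_zero])
    have hadj := fun i j => h.adj_iff_of_eq_perpIn hk hY hd (hx i) (hy j) (ha i) (hb j)
    exact ⟨a, b, fun i => ⟨(ha i).trans_le perpIn_le, (hb i).trans_le perpIn_le,
      (hadj i i).2 (hxy i)⟩,
      fun i j hij => (hadj j i).not.2 (not_not.2 (h0 i j hij))⟩

end Existence

section Definitions

open FirstOrder FirstOrder.Language

/-! ### Schemes for Grassmann spaces -/

theorem DefinableFromAdjacency.dual {n k j : ℕ} (hk : k ≤ n) (hj : j ≤ n)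
    (h : DefinableFromAdjacency.{u, v} n k j) :
    DefinableFromAdjacency.{u, v} n (n - k) (n - j) := by
  obtain ⟨S, hS⟩ := h
  refine ⟨S, fun K V _ _ _ ξ hξ => ?_⟩
  have := hξ.2.1
  have hs := hξ.isSymplectic
  have hn := hξ.2.2.1
  have hkn : n - k + k = finrank K V := by omega
  have hjn : n - j + j = finrank K V := by omega
  let e : TR ξ (n - k) ≃[Language.graph] TR ξ k :=
    { hs.dual hkn with
      map_fun' := fun f => isEmptyElim f
      map_rel' := fun r x => by
        cases r
        exact (hs.adj_dual_iff hkn).symm }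
  refine (hS K V ξ hξ).of_equiv e (hs.dual hjn) (fun l => hs.preimage_dual_mem_pencils_iff hjn)
    fun X U => or_comm.trans (or_congr ?_ ?_)
  · exact (hs.dual_le_dual_iff hjn hkn).symm
  · exact (hs.dual_le_dual_iff hkn hjn).symm

theorem TupleCoding.definableFromAdjacency {m n k j : ℕ} (C : TupleCoding.{v} m)
    (hC : ∀ (K : Type u) (V : Type v) [Field K] [AddCommGroup V] [Module K V]
      (ξ : LinearMap.BilinForm K V), IsSymplecticSpace ξ n → ∃ f,
        C.Represents (adjacency ξ k).Adj (pencils ξ j) (fun X U => X.1 ≤ U.1 ∨ U.1 ≤ X.1) f) :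
    DefinableFromAdjacency.{u, v} n k j := by
  obtain ⟨S, hS⟩ := C.exists_scheme
  refine ⟨S, fun K V _ _ _ ξ hξ => ?_⟩
  have := hξ.2.1
  obtain ⟨f, hf⟩ := hC K V ξ hξ
  refine hS _ _ _ _ f (fun l hl => ?_) hf
  obtain ⟨U, hU⟩ := hl.1
  obtain ⟨W, hW, hne⟩ := hξ.isSymplectic.exists_ne_mem_pencil hl hU
  exact ⟨W, hW, U, hU, hne⟩

/-- Codes of points by tuples `t` that determine sets `Mem t` of vertices, where distinct points
are collinear if and only if these sets meet, and the line through two points consists of those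
meeting everything that meets both. -/
def TupleCoding.ofMem {m : ℕ} (Dom : GraphRelation.{v} (Fin m))
    (Mem : ∀ M : Type v, (M → M → Prop) → (Fin m → M) → M → Prop) (hDom : UniformlyDefinable Dom)
    (hMem : UniformlyDefinable
      fun M A (x : Fin m ⊕ Unit → M) => Mem M A (x ∘ Sum.inl) (x (Sum.inr ()))) :
    TupleCoding.{v} m where
  Dom := Dom
  Mem := Mem
  Adj M A t t' := (¬ ∀ U, Mem M A t U ↔ Mem M A t' U) ∧ ∃ U, Mem M A t U ∧ Mem M A t' U
  Line M A t t' t'' := ∀ z, Dom M A z → (∃ U, Mem M A z U ∧ Mem M A t U) →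
    (∃ U, Mem M A z U ∧ Mem M A t' U) → ∃ U, Mem M A z U ∧ Mem M A t'' U
  definable_dom := hDom
  definable_mem := hMem
  definable_adj :=
    have mem (i : Fin m → Fin m ⊕ Fin m) := hMem.comp (Sum.map i id)
    .and (.not (.forall_elem ((mem Sum.inl).iff (mem Sum.inr))))
      (.exists_elem ((mem Sum.inl).and (mem Sum.inr)))
  definable_line :=
    have meet (i : Fin m → (Fin m ⊕ Fin m) ⊕ Fin m) : UniformlyDefinable
        fun M A (x : ((Fin m ⊕ Fin m) ⊕ Fin m) ⊕ Fin m → M) =>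
          ∃ U, Mem M A (x ∘ Sum.inr) U ∧ Mem M A (x ∘ Sum.inl ∘ i) U :=
      .exists_elem ((hMem.comp (Sum.map Sum.inr id)).and (hMem.comp (Sum.map (Sum.inl ∘ i) id)))
    .forall_tuple ((hDom.comp Sum.inr).imp ((meet (Sum.inl ∘ Sum.inl)).imp
      ((meet (Sum.inl ∘ Sum.inr)).imp (meet Sum.inr))))

/-! ### Subspaces coded by the hyperplanes they contain -/

section Hyperplanes

variable {K : Type u} {V : Type v} [Field K] [AddCommGroup V] [Module K V]
  {ξ : LinearMap.BilinForm K V} [FiniteDimensional K V] {m k : ℕ}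

theorem IsSymplectic.eq_of_forall_le_iff (h : IsSymplectic ξ) (hk : ¬ Even k)
    {Y Y' : TR ξ (k + 1)} (hY : ∀ U : TR ξ k, U.1 ≤ Y.1 ↔ U.1 ≤ Y'.1) : Y = Y' :=
  have reg := h.isRegular (k := k + 1) (Nat.even_add_one.2 hk)
  Subtype.ext (le_antisymm (h.le_of_forall_le (reg Y) Y.finrank_eq fun U => (hY U).1)
    (h.le_of_forall_le (reg Y') Y'.finrank_eq fun U => (hY U).2))

theorem IsSymplectic.exists_le_and_le_iff (h : IsSymplectic ξ) (hk : ¬ Even k)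
    {Y Y' : TR ξ (k + 1)} :
    (∃ U : TR ξ k, U.1 ≤ Y.1 ∧ U.1 ≤ Y'.1) ↔ (adjacency ξ (k + 1)).Adj Y Y' ∨ Y = Y' := by
  have hk1 := Nat.even_add_one.2 hk
  constructor
  · rintro ⟨U, hU, hU'⟩
    exact h.adj_or_eq_of_ge hk1 (by rw [U.finrank_eq]) hU hU'
  · rintro (hadj | rfl)
    · obtain ⟨-, hd, hrad, -⟩ := adj_iff.1 hadj
      exact ⟨TR.of _ (Nat.succ_injective hd) hrad, inf_le_left, inf_le_right⟩
    · obtain ⟨x, hx, hx0⟩ := exists_ne_zero_of_finrank_pos (S := Y.1) (by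
        rw [Y.finrank_eq]; exact k.succ_pos)
      obtain ⟨U, hU⟩ := (h.isRegular hk1 Y).exists_eq_perpIn h.refl Y.finrank_eq hx hx0
      exact ⟨U, hU ▸ perpIn_le, hU ▸ perpIn_le⟩

variable {Dom : GraphRelation.{v} (Fin m)}
  {Mem : ∀ M : Type v, (M → M → Prop) → (Fin m → M) → M → Prop}

theorem IsSymplectic.represents_ofMem (h : IsSymplectic ξ) (hk : ¬ Even k)
    (hkn : k + 3 ≤ finrank K V) (hDom : UniformlyDefinable Dom)
    (hMem : UniformlyDefinable
      fun M A (x : Fin m ⊕ Unit → M) => Mem M A (x ∘ Sum.inl) (x (Sum.inr ())))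
    {f : {t // Dom (TR ξ k) (adjacency ξ k).Adj t} → TR ξ (k + 1)} (hf : Function.Surjective f)
    (mem_iff : ∀ t U, Mem _ (adjacency ξ k).Adj t.1 U ↔ U.1 ≤ (f t).1) :
    (TupleCoding.ofMem Dom Mem hDom hMem).Represents (adjacency ξ k).Adj (pencils ξ (k + 1))
      (fun X U => X.1 ≤ U.1 ∨ U.1 ≤ X.1) f := by
  have hk1 := Nat.even_add_one.2 hk
  have le_or_ge_iff (X : TR ξ (k + 1)) (U : TR ξ k) : X.1 ≤ U.1 ∨ U.1 ≤ X.1 ↔ U.1 ≤ X.1 :=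
    or_iff_right (not_le_of_finrank_lt (by rw [X.finrank_eq, U.finrank_eq]; exact k.lt_succ_self))
  have same_iff (t t') : (∀ U, Mem _ (adjacency ξ k).Adj t.1 U ↔ Mem _ (adjacency ξ k).Adj t'.1 U) ↔
      f t = f t' := by
    simp only [mem_iff]
    exact ⟨h.eq_of_forall_le_iff hk, fun e U => by rw [e]⟩
  have meet_iff (t t') :
      (∃ U, Mem _ (adjacency ξ k).Adj t.1 U ∧ Mem _ (adjacency ξ k).Adj t'.1 U) ↔
        (adjacency ξ (k + 1)).Adj (f t) (f t') ∨ f t = f t' := by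
    simp only [mem_iff]
    exact h.exists_le_and_le_iff hk
  refine ⟨hf, fun t U => (mem_iff t U).trans (le_or_ge_iff _ U).symm, fun t t' hU => ?_,
    fun t t' => ?_, fun l hl t t' hne ht ht' s => ?_⟩
  · simp only [le_or_ge_iff] at hU
    exact h.eq_of_forall_le_iff hk hU
  · refine (and_congr (not_congr (same_iff t t')) (meet_iff t t')).trans ?_
    exact ⟨fun H => H.2.resolve_right H.1, fun H => ⟨H.1, .inl H⟩⟩
  · have hk2 : 2 ≤ k + 1 := Nat.succ_le_succ (Nat.pos_of_ne_zero fun e => hk (e ▸ Even.zero))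
    rw [(pencil_eq hl ht ht' hne).1, Set.mem_ofPred_eq, h.mem_line_iff hk1 hk2 hkn
      (⟨hne, l, hl, ht, ht'⟩ : (adjacency ξ (k + 1)).Adj (f t) (f t')), hf.forall, Subtype.forall]
    exact forall₂_congr fun z hz => imp_congr (meet_iff ⟨z, hz⟩ t)
      (imp_congr (meet_iff ⟨z, hz⟩ t') (meet_iff ⟨z, hz⟩ s))

end Hyperplanes

theorem definableFromAdjacency_add_one_of_mem {m n k : ℕ} (hk : ¬ Even k) (hkn : k + 3 ≤ n)
    {Dom : GraphRelation.{v} (Fin m)}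
    {Mem : ∀ M : Type v, (M → M → Prop) → (Fin m → M) → M → Prop} (hDom : UniformlyDefinable Dom)
    (hMem : UniformlyDefinable
      fun M A (x : Fin m ⊕ Unit → M) => Mem M A (x ∘ Sum.inl) (x (Sum.inr ())))
    (hY : ∀ (K : Type u) (V : Type v) [Field K] [AddCommGroup V] [Module K V]
      (ξ : LinearMap.BilinForm K V), IsSymplecticSpace ξ n →
      (∀ t, Dom _ (adjacency ξ k).Adj t → ∃ Y : TR ξ (k + 1),
        ∀ U, Mem _ (adjacency ξ k).Adj t U ↔ U.1 ≤ Y.1) ∧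
      ∀ Y : TR ξ (k + 1), ∃ t, Dom _ (adjacency ξ k).Adj t ∧
        ∀ U, Mem _ (adjacency ξ k).Adj t U ↔ U.1 ≤ Y.1) :
    DefinableFromAdjacency.{u, v} n k (k + 1) := by
  refine (TupleCoding.ofMem Dom Mem hDom hMem).definableFromAdjacency fun K V _ _ _ ξ hξ => ?_
  have := hξ.2.1
  have hs := hξ.isSymplectic
  obtain ⟨exists_subspace, exists_code⟩ := hY K V ξ hξ
  choose f hf using fun t : {t // Dom _ (adjacency ξ k).Adj t} => exists_subspace t.1 t.2
  refine ⟨f, hs.represents_ofMem hk (hkn.trans_eq hξ.2.2.1.symm) hDom hMem (fun Y => ?_) hf⟩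
  obtain ⟨t, ht, htY⟩ := exists_code Y
  exact ⟨⟨t, ht⟩, hs.eq_of_forall_le_iff hk fun U => (hf ⟨t, ht⟩ U).symm.trans (htY U)⟩

/-! ### Points of the symplectic space -/

section Points

variable {K V : Type*} [Field K] [AddCommGroup V] [Module K V] {ξ : LinearMap.BilinForm K V}

variable [FiniteDimensional K V]

theorem TR.exists_eq_span (U : TR ξ 1) : ∃ x : V, U.1 = K ∙ x := by
  obtain ⟨x, hx, hx0⟩ := exists_ne_zero_of_finrank_pos (U.finrank_eq.symm ▸ one_pos)
  exact ⟨x, (Submodule.eq_of_le_of_finrank_eq ((Submodule.span_singleton_le_iff_mem x U.1).2 hx)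
    ((finrank_span_singleton hx0).trans U.finrank_eq.symm)).symm⟩

theorem exists_tr_eq_span {x : V} (hx : x ≠ 0) : ∃ U : TR ξ 1, U.1 = K ∙ x :=
  ⟨TR.of _ (finrank_span_singleton hx)
    ((Submodule.finrank_mono (rad_le _)).trans (finrank_span_singleton hx).le), rfl⟩

theorem IsSymplectic.adj_one_iff (h : IsSymplectic ξ) {U W : TR ξ 1} :
    (adjacency ξ 1).Adj U W ↔ ¬ U.1 ≤ ξ.orthogonal W.1 := by
  obtain ⟨x, hx⟩ := U.exists_eq_span
  obtain ⟨y, hy⟩ := W.exists_eq_span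
  obtain ⟨j, hj⟩ := Nat.exists_eq_add_of_le (U.finrank_eq ▸ U.1.finrank_le : 1 ≤ finrank K V)
  have hjodd : ¬ Even j := by rw [← Nat.even_add_one, add_comm, ← hj]; exact h.even_finrank
  have dual_eq (Z : TR ξ 1) (z : V) (hZ : Z.1 = K ∙ z) :
      (h.dual hj.symm Z).1 = perpIn ξ ⊤ z :=
    (congrArg ξ.orthogonal hZ).trans
      ((LinearMap.BilinForm.orthogonal_span_singleton_eq_toLin_ker z).trans (top_inf_eq _).symm)
  rw [h.adj_dual_iff hj.symm, h.adj_iff_of_eq_perpIn hjodd h.isRegular_top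
      (by rw [finrank_top, hj, add_comm]) trivial trivial (dual_eq U x hx) (dual_eq W y hy), hx, hy,
    Submodule.span_singleton_le_iff_mem,
    LinearMap.BilinForm.orthogonal_span_singleton_eq_toLin_ker, LinearMap.mem_ker]
  exact not_congr (h.refl.eq_iff)

theorem IsSymplectic.forall_not_adj_iff (h : IsSymplectic ξ) {U W Z : TR ξ 1} :
    (∀ T, ¬ (adjacency ξ 1).Adj T U → ¬ (adjacency ξ 1).Adj T W → ¬ (adjacency ξ 1).Adj T Z) ↔
      Z.1 ≤ U.1 ⊔ W.1 := by
  simp only [h.adj_one_iff, not_not]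
  rw [← orthogonal_le_orthogonal_iff h.refl h.nondeg]
  constructor
  · intro H x hx
    by_cases hx0 : x = 0
    · rw [hx0]
      exact zero_mem _
    · obtain ⟨T, hT⟩ := exists_tr_eq_span (ξ := ξ) hx0
      have hTx : T.1 ≤ ξ.orthogonal (U.1 ⊔ W.1) := by
        rwa [hT, Submodule.span_singleton_le_iff_mem]
      exact H T (hTx.trans (LinearMap.BilinForm.orthogonal_le le_sup_left))
        (hTx.trans (LinearMap.BilinForm.orthogonal_le le_sup_right))
        (hT ▸ Submodule.mem_span_singleton_self x)
  · intro H T hU hW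
    rw [le_orthogonal_comm h.refl] at hU hW
    exact ((le_orthogonal_comm h.refl).1 (sup_le hU hW)).trans H

theorem IsSymplectic.exists_adj_sup_eq (h : IsSymplectic ξ) (Y : TR ξ 2) :
    ∃ U W : TR ξ 1, (adjacency ξ 1).Adj U W ∧ U.1 ⊔ W.1 = Y.1 := by
  obtain ⟨x, y, hx, hy, hxy, -⟩ := (h.isRegular (by decide) Y).exists_triangular h.refl (r := 1)
    (by rw [Y.finrank_eq]; exact one_le_two)
  obtain ⟨U, hU⟩ := exists_tr_eq_span (ξ := ξ) (x := x 0)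
    fun e => hxy 0 (by rw [e, map_zero, LinearMap.zero_apply])
  obtain ⟨W, hW⟩ := exists_tr_eq_span (ξ := ξ) (x := y 0) fun e => hxy 0 (by rw [e, map_zero])
  have hadj : (adjacency ξ 1).Adj U W := by
    rw [h.adj_one_iff, hU, hW, Submodule.span_singleton_le_iff_mem,
      LinearMap.BilinForm.orthogonal_span_singleton_eq_toLin_ker, LinearMap.mem_ker]
    exact fun e => hxy 0 (h.refl _ _ e)
  refine ⟨U, W, hadj, sup_eq_of_le U.finrank_eq W.finrank_eq Y.finrank_eq ?_ ?_ (TR.ne hadj.1)⟩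
  · rw [hU, Submodule.span_singleton_le_iff_mem]
    exact hx 0
  · rw [hW, Submodule.span_singleton_le_iff_mem]
    exact hy 0

end Points

theorem definableFromAdjacency_one_two {n : ℕ} (hn : 4 ≤ n) :
    DefinableFromAdjacency.{u, v} n 1 2 := by
  refine definableFromAdjacency_add_one_of_mem (m := 2) (by decide) hn
    (Dom := fun M A t => A (t 0) (t 1))
    (Mem := fun M A t U => ∀ z, ¬ A z (t 0) → ¬ A z (t 1) → ¬ A z U) (.rel 0 1)
    (.forall_elem (.imp (.not (.rel _ _)) (.imp (.not (.rel _ _)) (.not (.rel _ _)))))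
    fun K V _ _ _ ξ hξ => ?_
  have := hξ.2.1
  have hs := hξ.isSymplectic
  refine ⟨fun t ht => ?_, fun Y => ?_⟩
  · obtain ⟨-, hd, -, hrad⟩ := adj_iff.1 ht
    exact ⟨TR.of _ (finrank_sup_eq_add_one (t 0).finrank_eq (t 1).finrank_eq hd) hrad,
      fun U => hs.forall_not_adj_iff⟩
  · obtain ⟨U, W, hadj, hsup⟩ := hs.exists_adj_sup_eq Y
    exact ⟨![U, W], hadj, fun Z => hsup ▸ hs.forall_not_adj_iff⟩

theorem exists_separating {m p q : ℕ} (hpq : p ≠ q) {P : ℕ → GraphRelation.{v} (Fin m)}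
    (hP : ∀ r, UniformlyDefinable (P r)) :
    ∃ Q : GraphRelation.{v} (Fin m), UniformlyDefinable Q ∧ ∀ M A t,
      ((∀ r, P r M A t ↔ r ≤ p) → Q M A t) ∧ ((∀ r, P r M A t ↔ r ≤ q) → ¬ Q M A t) := by
  rcases hpq.lt_or_gt with hlt | hlt
  · exact ⟨_, (hP q).not, fun M A t => ⟨fun h hq => hlt.not_ge ((h q).1 hq),
      fun h hq => hq ((h q).2 le_rfl)⟩⟩
  · exact ⟨_, hP p, fun M A t => ⟨fun h => (h p).2 le_rfl, fun h hp => hlt.not_ge ((h p).1 hp)⟩⟩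

end Definitions

/-! ### Pure pairs and their hulls -/

section Graph

variable {M : Type*} (A : M → M → Prop)

/-- The common neighbours of `s` and `t` contain four elements of which exactly one pair is not
adjacent. This tells apart the common neighbours of two subspaces meeting in a hyperplane from the
grid formed by the common neighbours of two subspaces meeting in codimension two. -/
def HasDiamond (s t : M) : Prop :=
  ∃ z : Fin 4 → M, (∀ i, A (z i) s ∧ A (z i) t) ∧ A (z 0) (z 1) ∧ A (z 0) (z 2) ∧ A (z 0) (z 3) ∧
    A (z 1) (z 2) ∧ A (z 1) (z 3) ∧ z 2 ≠ z 3 ∧ ¬ A (z 2) (z 3)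

/-- A pair of non-adjacent vertices whose common neighbours do not form a grid. In the odd case,
these pairs code the regular subspaces spanned by `s` and `t`. -/
def IsPure (s t : M) : Prop := s ≠ t ∧ ¬ A s t ∧ HasDiamond A s t

/-- Being adjacent to two distinct non-adjacent common neighbours of `s` and `t`. For pure pairs
this describes the elements contained in the subspace spanned by `s` and `t`. -/
def InHull (s t x : M) : Prop :=
  ∃ z : Fin 2 → M, (∀ i, A (z i) s ∧ A (z i) t ∧ A x (z i)) ∧ z 0 ≠ z 1 ∧ ¬ A (z 0) (z 1)

end Graph

namespace UniformlyDefinable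

variable {α : Type} (a b : α)

theorem isPure : UniformlyDefinable.{v} fun _ A x => IsPure A (x a) (x b) :=
  .and (.not (.eq a b)) (.and (.not (.rel a b)) (.exists_tuple
    (.and (.forall_index fun _ => .and (.rel _ _) (.rel _ _)) (.and (.rel _ _) (.and (.rel _ _)
      (.and (.rel _ _) (.and (.rel _ _) (.and (.rel _ _) (.and (.not (.eq _ _))
        (.not (.rel _ _)))))))))))

theorem inHull (c : α) : UniformlyDefinable.{v} fun _ A x => InHull A (x a) (x b) (x c) :=
  .exists_tuple (.and (.forall_index fun _ => .and (.rel _ _) (.and (.rel _ _) (.rel _ _)))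
    (.and (.not (.eq _ _)) (.not (.rel _ _))))

theorem hasTriangular_inHull (r : ℕ) :
    UniformlyDefinable.{v} fun _ A x => HasTriangular A (InHull A (x a) (x b)) r :=
  .exists_tuple (.exists_tuple (.and
    (.forall_index fun _ => .and (.inHull _ _ _) (.and (.inHull _ _ _) (.rel _ _)))
    (.forall_index fun _ => .forall_index fun _ => .imp_of_const (.not (.rel _ _)))))

end UniformlyDefinable

section CodimTwo

variable {K V : Type*} [Field K] [AddCommGroup V] [Module K V] [FiniteDimensional K V]
  {S T U W : Submodule K V} {k : ℕ}

theorem inf_sup_inf_eq_of_codim_two (hST : finrank K ↥(S ⊓ T) + 2 = k) (hU : finrank K U = k)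
    (hUS : finrank K ↥(U ⊓ S) + 1 = k) (hUT : finrank K ↥(U ⊓ T) + 1 = k) :
    U ⊓ S ⊔ U ⊓ T = U := by
  refine sup_eq_of_le (k := finrank K ↥(S ⊓ T) + 1) (by omega) (by omega) (by omega)
    inf_le_left inf_le_left fun h => ?_
  have := Submodule.finrank_mono (le_inf inf_le_right (h.le.trans inf_le_right) : U ⊓ S ≤ S ⊓ T)
  omega

theorem le_sup_of_inf_ne (hS : finrank K S = k) (hUS : finrank K ↥(U ⊓ S) + 1 = k)
    (hWS : finrank K ↥(W ⊓ S) + 1 = k) (hne : U ⊓ S ≠ W ⊓ S) : S ≤ U ⊔ W :=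
  (sup_eq_of_le (k := finrank K ↥(U ⊓ S)) rfl (by omega) (by omega) inf_le_right inf_le_right
    hne).ge.trans (sup_le_sup inf_le_left inf_le_left)

theorem inf_eq_or_inf_eq_of_codim_two (hST : finrank K ↥(S ⊓ T) + 2 = k) (hS : finrank K S = k)
    (hT : finrank K T = k) (hUS : finrank K ↥(U ⊓ S) + 1 = k) (hUT : finrank K ↥(U ⊓ T) + 1 = k)
    (hWS : finrank K ↥(W ⊓ S) + 1 = k) (hWT : finrank K ↥(W ⊓ T) + 1 = k)
    (hUW : finrank K ↥(U ⊔ W) = k + 1) : U ⊓ S = W ⊓ S ∨ U ⊓ T = W ⊓ T := by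
  by_contra! hne
  have hle := Submodule.finrank_mono (sup_le (le_sup_of_inf_ne hS hUS hWS hne.1)
    (le_sup_of_inf_ne hT hUT hWT hne.2))
  have := Submodule.finrank_sup_add_finrank_inf_eq S T
  omega

theorem sup_eq_sup_of_codim_two (hST : finrank K ↥(S ⊓ T) + 2 = k) (hT : finrank K T = k)
    (hU : finrank K U = k) (hW : finrank K W = k) (hUS : finrank K ↥(U ⊓ S) + 1 = k)
    (hUT : finrank K ↥(U ⊓ T) + 1 = k) (hWT : finrank K ↥(W ⊓ T) + 1 = k)
    (heq : U ⊓ S = W ⊓ S) (hne : U ≠ W) : U ⊔ T = U ⊔ W := by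
  have hneT : U ⊓ T ≠ W ⊓ T := fun h => hne <| by
    rw [← inf_sup_inf_eq_of_codim_two hST hU hUS hUT, heq, h,
      inf_sup_inf_eq_of_codim_two hST hW (heq ▸ hUS) hWT]
  have hinf : U ⊓ W = U ⊓ S := inf_eq_of_ge hU hW hUS inf_le_left (heq.le.trans inf_le_left) hne
  refine Submodule.eq_of_le_of_finrank_le
    (sup_le le_sup_left (le_sup_of_inf_ne hT hUT hWT hneT)) ?_
  rw [finrank_sup_eq_add_one hU hT hUT, finrank_sup_eq_add_one hU hW (hinf ▸ hUS)]

variable {ξ : LinearMap.BilinForm K V} {s t y z : TR ξ k}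

theorem adj_of_inf_eq_of_codim_two (hst : finrank K ↥(s.1 ⊓ t.1) + 2 = k)
    (hzs : (adjacency ξ k).Adj z s) (hzt : (adjacency ξ k).Adj z t)
    (hyt : (adjacency ξ k).Adj y t) (hne : z ≠ y) (heq : z.1 ⊓ s.1 = y.1 ⊓ s.1) :
    (adjacency ξ k).Adj z y := by
  rw [adj_iff] at hzs hzt hyt ⊢
  have hne' : z.1 ≠ y.1 := fun h => hne (Subtype.ext h)
  have hinf := inf_eq_of_ge z.finrank_eq y.finrank_eq hzs.2.1 inf_le_left
    (heq.le.trans inf_le_left) hne'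
  have hsup := sup_eq_sup_of_codim_two hst t.finrank_eq z.finrank_eq y.finrank_eq hzs.2.1
    hzt.2.1 hyt.2.1 heq hne'
  exact ⟨hne, hinf ▸ hzs.2.1, hinf ▸ hzs.2.2.1, hsup ▸ hzt.2.2.2⟩

/-- A common neighbour `z` is determined by its row `z ⊓ s` and its column `z ⊓ t`, and two of them
are adjacent if and only if they agree in one of the two. -/
theorem not_hasDiamond_of_codim_two (hst : finrank K ↥(s.1 ⊓ t.1) + 2 = k) :
    ¬ HasDiamond (adjacency ξ k).Adj s t := by
  rintro ⟨z, hz, h01, h02, h03, h12, h13, hne, hna⟩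
  have hts : finrank K ↥(t.1 ⊓ s.1) + 2 = k := by rwa [inf_comm]
  have hdim_s (i) : finrank K ↥((z i).1 ⊓ s.1) + 1 = k := (adj_iff.1 (hz i).1).2.1
  have hdim_t (i) : finrank K ↥((z i).1 ⊓ t.1) + 1 = k := (adj_iff.1 (hz i).2).2.1
  have row_or_column (i j) (hij : (adjacency ξ k).Adj (z i) (z j)) :
      (z i).1 ⊓ s.1 = (z j).1 ⊓ s.1 ∨ (z i).1 ⊓ t.1 = (z j).1 ⊓ t.1 :=
    inf_eq_or_inf_eq_of_codim_two hst s.finrank_eq t.finrank_eq (hdim_s i) (hdim_t i) (hdim_s j)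
      (hdim_t j) (finrank_sup_eq_add_one (z i).finrank_eq (z j).finrank_eq (adj_iff.1 hij).2.1)
  have row_ne : (z 2).1 ⊓ s.1 ≠ (z 3).1 ⊓ s.1 := fun e =>
    hna (adj_of_inf_eq_of_codim_two hst (hz 2).1 (hz 2).2 (hz 3).2 hne e)
  have column_ne : (z 2).1 ⊓ t.1 ≠ (z 3).1 ⊓ t.1 := fun e =>
    hna (adj_of_inf_eq_of_codim_two hts (hz 2).2 (hz 2).1 (hz 3).1 hne e)
  have not_both : ¬ ((z 0).1 ⊓ s.1 = (z 1).1 ⊓ s.1 ∧ (z 0).1 ⊓ t.1 = (z 1).1 ⊓ t.1) := by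
    rintro ⟨hrow, hcol⟩
    refine h01.1 (Subtype.ext ?_)
    rw [← inf_sup_inf_eq_of_codim_two hst (z 0).finrank_eq (hdim_s 0) (hdim_t 0), hrow, hcol,
      inf_sup_inf_eq_of_codim_two hst (z 1).finrank_eq (hdim_s 1) (hdim_t 1)]
  have := row_or_column 0 1 h01
  have := row_or_column 0 2 h02
  have := row_or_column 0 3 h03
  have := row_or_column 1 2 h12
  have := row_or_column 1 3 h13
  grind

end CodimTwo

section Pure

variable {K V : Type*} [Field K] [AddCommGroup V] [Module K V] {ξ : LinearMap.BilinForm K V}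
  {k : ℕ} [FiniteDimensional K V] {s t : TR ξ k}

theorem finrank_inf_add_one_of_isPure (h : IsPure (adjacency ξ k).Adj s t) :
    finrank K ↥(s.1 ⊓ t.1) + 1 = k := by
  obtain ⟨hne, -, hD⟩ := h
  obtain ⟨z, hz, -⟩ := id hD
  have hzs := (adj_iff.1 (hz 0).1).2.1
  have hzt := (adj_iff.1 (hz 0).2).2.1
  have hlt := finrank_inf_lt s.finrank_eq t.finrank_eq fun e => hne (Subtype.ext e)
  have hge := finrank_le_finrank_inf_add_one (inf_le_left : (z 0).1 ⊓ t.1 ≤ (z 0).1)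
    (by rw [(z 0).finrank_eq, hzt]) (inf_le_left : (z 0).1 ⊓ s.1 ≤ (z 0).1)
  have hle := Submodule.finrank_mono (inf_le_inf inf_le_right inf_le_right :
    (z 0).1 ⊓ s.1 ⊓ ((z 0).1 ⊓ t.1) ≤ s.1 ⊓ t.1)
  have hne2 : finrank K ↥(s.1 ⊓ t.1) + 2 ≠ k := fun e => not_hasDiamond_of_codim_two e hD
  omega

theorem finrank_rad_sup_le_one_or_of_isPure (h : IsPure (adjacency ξ k).Adj s t) :
    finrank K (rad ξ (s.1 ⊔ t.1)) ≤ 1 ∨ finrank K (rad ξ (s.1 ⊓ t.1)) ≤ 1 := by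
  have hd := finrank_inf_add_one_of_isPure h
  obtain ⟨-, -, z, hz, -⟩ := h
  obtain ⟨-, hzs, hrinf, hrsup⟩ := adj_iff.1 (hz 0).1
  obtain ⟨-, hzt, -⟩ := adj_iff.1 (hz 0).2
  rcases inf_le_or_le_sup (z 0).finrank_eq hd hzs hzt with hle | hle
  · rw [Submodule.eq_of_le_of_finrank_eq (le_inf hle inf_le_left : s.1 ⊓ t.1 ≤ (z 0).1 ⊓ s.1)
      (by omega)]
    exact .inr hrinf
  · rw [← Submodule.eq_of_le_of_finrank_eq (sup_le hle le_sup_left : (z 0).1 ⊔ s.1 ≤ s.1 ⊔ t.1)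
      (by rw [finrank_sup_eq_add_one s.finrank_eq t.finrank_eq hd,
        finrank_sup_eq_add_one (z 0).finrank_eq s.finrank_eq hzs])]
    exact .inl hrsup

theorem le_sup_of_adj {z : TR ξ k} (hne : s ≠ t) (hst : ¬ (adjacency ξ k).Adj s t)
    (hd : finrank K ↥(s.1 ⊓ t.1) + 1 = k) (hrad : finrank K (rad ξ (s.1 ⊔ t.1)) ≤ 1)
    (hs : (adjacency ξ k).Adj z s) (ht : (adjacency ξ k).Adj z t) : z.1 ≤ s.1 ⊔ t.1 := by
  obtain ⟨-, hzs, hrinf, -⟩ := adj_iff.1 hs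
  refine (inf_le_or_le_sup z.finrank_eq hd hzs (adj_iff.1 ht).2.1).resolve_left fun hle => hst ?_
  have heq : s.1 ⊓ t.1 = z.1 ⊓ s.1 :=
    Submodule.eq_of_le_of_finrank_eq (le_inf hle inf_le_left) (by omega)
  exact adj_iff.2 ⟨hne, hd, heq ▸ hrinf, hrad⟩

end Pure

section Vectors

variable {K V : Type*} [Field K] [AddCommGroup V] [Module K V] {ξ : LinearMap.BilinForm K V}
  {Y : Submodule K V} {s t x : V}

theorem exists_mem_notMem_notMem_notMem (h2 : (2 : K) ≠ 0) {B R S T : Submodule K V}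
    (hR : ¬ B ≤ R) (hS : ¬ B ≤ S) (hT : ¬ B ≤ T) : ∃ v ∈ B, v ∉ R ∧ v ∉ S ∧ v ∉ T := by
  obtain ⟨v, hvB, hvS, hvT⟩ := exists_mem_notMem_notMem hS hT
  by_cases hvR : v ∈ R
  swap
  · exact ⟨v, hvB, hvR, hvS, hvT⟩
  obtain ⟨w, hwB, hwR⟩ := Set.not_subset.1 hR
  have unique {S : Submodule K V} (hv : v ∉ S) {c d : K} (hc : w + c • v ∈ S)
      (hd : w + d • v ∈ S) : c = d := by
    by_contra hcd
    refine hv ((S.smul_mem_iff (sub_ne_zero.2 hcd)).1 ?_)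
    convert S.sub_mem hc hd using 1
    module
  obtain ⟨c, hcS, hcT⟩ : ∃ c : K, w + c • v ∉ S ∧ w + c • v ∉ T := by
    have h01 : (0 : K) ≠ 1 := zero_ne_one
    have h02 : (0 : K) ≠ -1 := fun h => one_ne_zero (neg_eq_zero.1 h.symm)
    have h12 : (1 : K) ≠ -1 := fun h => h2 (by linear_combination h)
    by_contra! hall
    have cover (c : K) : w + c • v ∈ S ∨ w + c • v ∈ T := or_iff_not_imp_left.2 (hall c)
    grind [cover 0, cover 1, cover (-1)]
  exact ⟨w + c • v, B.add_mem hwB (B.smul_mem c hvB),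
    fun h => hwR ((R.add_mem_iff_left (R.smul_mem c hvR)).1 h), hcS, hcT⟩

theorem IsRegular.not_le_ker (hξ : ξ.IsRefl) (hY : IsRegular ξ Y) (hx : x ∈ Y) (hx0 : x ≠ 0) :
    ¬ Y ≤ LinearMap.ker (ξ x) :=
  fun hle => hx0 (isRegular_iff.1 hY x hx fun _ hu => hξ _ _ (hle hu))

variable [FiniteDimensional K V]

theorem IsSymplectic.exists_perp_pair (h : IsSymplectic ξ) (hY : IsRegular ξ Y)
    (hd : 4 ≤ finrank K Y) (hs : s ∈ Y) (ht : t ∈ Y) (hx : x ∈ Y) (hs0 : s ≠ 0) (ht0 : t ≠ 0)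
    (hx0 : x ≠ 0) : ∃ d ∈ Y, ∃ e ∈ Y, ξ d e = 0 ∧ e ∉ K ∙ d ∧
      (ξ s d ≠ 0 ∧ ξ t d ≠ 0 ∧ ξ x d ≠ 0) ∧ ξ s e ≠ 0 ∧ ξ t e ≠ 0 ∧ ξ x e ≠ 0 := by
  obtain ⟨d, hdY, hsd, htd, hxd⟩ := exists_mem_notMem_notMem_notMem h.two_ne_zero
    (hY.not_le_ker h.refl hs hs0) (hY.not_le_ker h.refl ht ht0) (hY.not_le_ker h.refl hx hx0)
  obtain ⟨p, ⟨⟨⟨hpY, hsp : ξ s p = 0⟩, htp : ξ t p = 0⟩, hdp : ξ d p = 0⟩, hp0⟩ :=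
    exists_ne_zero_of_finrank_pos
      (S := Y ⊓ LinearMap.ker (ξ s) ⊓ LinearMap.ker (ξ t) ⊓ LinearMap.ker (ξ d)) (by
      have := finrank_le_finrank_inf_ker_add_one Y (ξ s)
      have := finrank_le_finrank_inf_ker_add_one (Y ⊓ LinearMap.ker (ξ s)) (ξ t)
      have := finrank_le_finrank_inf_ker_add_one
        (Y ⊓ LinearMap.ker (ξ s) ⊓ LinearMap.ker (ξ t)) (ξ d)
      omega)
  rw [LinearMap.mem_ker] at hsd htd hxd
  obtain ⟨c, hc0, hc⟩ : ∃ c : K, c ≠ 0 ∧ ξ x d + c * ξ x p ≠ 0 := by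
    by_contra! hall
    have hplus := hall 1 one_ne_zero
    have hminus := hall (-1) (neg_ne_zero.2 one_ne_zero)
    exact mul_ne_zero h.two_ne_zero hxd (by linear_combination hplus + hminus)
  refine ⟨d, hdY, d + c • p, Y.add_mem hdY (Y.smul_mem c hpY), ?_, fun hmem => ?_,
    ⟨hsd, htd, hxd⟩, ?_, ?_, ?_⟩
  · simp [h.alt d, hdp]
  · obtain ⟨b, hb⟩ := Submodule.mem_span_singleton.1 hmem
    have hb1 : b = 1 := by
      have := congrArg (ξ s) hb
      simpa [hsp, hsd] using this
    rw [hb1, one_smul, left_eq_add, smul_eq_zero] at hb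
    exact hb.elim hc0 hp0
  · simpa [hsp] using hsd
  · simpa [htp] using htd
  · simpa using hc

theorem IsRegular.exists_frame (hξ : ξ.IsAlt) (hY : IsRegular ξ Y) (hs : s ∈ Y) (ht : t ∈ Y)
    (hs0 : s ≠ 0) (hst : t ∉ K ∙ s) (h0 : ξ s t = 0) :
    ∃ f ∈ Y, ∃ g ∈ Y, ξ s f = 1 ∧ ξ t f = 0 ∧ ξ s g = 0 ∧ ξ t g = 1 ∧ ξ f g = 0 := by
  have exists_dual {p q : V} (hp : p ∈ Y) (hq : q ∈ Y) (hp0 : p ≠ 0) (hpq : q ∉ K ∙ p) :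
      ∃ f ∈ Y, ξ p f = 0 ∧ ξ q f = 1 := by
    have hq0 : q ≠ 0 := fun e => hpq (e ▸ zero_mem _)
    have hne : ¬ perpIn ξ Y p ≤ perpIn ξ Y q := fun hle => hpq <|
      mem_span_of_perpIn_eq hξ.isRefl hY hp hp0 hq (Submodule.eq_of_le_of_finrank_eq hle (by
        have := finrank_perpIn hξ.isRefl hY hp hp0
        have := finrank_perpIn hξ.isRefl hY hq hq0
        omega))
    obtain ⟨f, ⟨hf, hpf : ξ p f = 0⟩, hqf⟩ := Set.not_subset.1 hne
    have hqf0 : ξ q f ≠ 0 := fun e => hqf ⟨hf, e⟩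
    exact ⟨(ξ q f)⁻¹ • f, Y.smul_mem _ hf, by simp [hpf], by simp [hqf0]⟩
  have ht0 : t ≠ 0 := fun e => hst (e ▸ zero_mem _)
  have hts : s ∉ K ∙ t := fun hmem => hst (mem_span_singleton_of_finrank_le_one
    (finrank_span_singleton ht0).le hmem (Submodule.mem_span_singleton_self t) hs0)
  obtain ⟨g, hg, hsg, htg⟩ := exists_dual hs ht hs0 hst
  obtain ⟨f, hf, htf, hsf⟩ := exists_dual ht hs ht0 hts
  have hfs : ξ f s = -1 := by rw [← hξ.neg_eq s f, hsf]
  refine ⟨f, hf, g + ξ f g • s, Y.add_mem hg (Y.smul_mem _ hs), hsf, htf, ?_, ?_, ?_⟩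
  · simp [hsg, hξ s]
  · simp [htg, hξ.isRefl _ _ h0]
  · simp [hfs]

theorem IsSymplectic.exists_diamond (h : IsSymplectic ξ) (hY : IsRegular ξ Y) (hs : s ∈ Y)
    (ht : t ∈ Y) (hs0 : s ≠ 0) (hst : t ∉ K ∙ s) (h0 : ξ s t = 0) :
    ∃ w : Fin 4 → V, (∀ i, w i ∈ Y ∧ ξ s (w i) ≠ 0 ∧ ξ t (w i) ≠ 0) ∧ ξ (w 0) (w 1) ≠ 0 ∧
      ξ (w 0) (w 2) ≠ 0 ∧ ξ (w 0) (w 3) ≠ 0 ∧ ξ (w 1) (w 2) ≠ 0 ∧ ξ (w 1) (w 3) ≠ 0 ∧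
      w 3 ∉ K ∙ w 2 ∧ ξ (w 2) (w 3) = 0 := by
  obtain ⟨f, hf, g, hg, hsf, htf, hsg, htg, hfg⟩ := hY.exists_frame h.alt hs ht hs0 hst h0
  have hfs : ξ f s = -1 := by rw [← h.alt.neg_eq s f, hsf]
  have hgs : ξ g s = 0 := h.refl _ _ hsg
  have hgf : ξ g f = 0 := h.refl _ _ hfg
  have hts : ξ t s = 0 := h.refl _ _ h0
  have hfgY := Y.add_mem hf hg
  refine ⟨![f + g + s, f + g - s, f + g, f - g], ?_, ?_, ?_, ?_, ?_, ?_, fun hmem => ?_, ?_⟩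
  · simp [Fin.forall_fin_succ, hsf, hsg, htf, htg, hts, h.alt s, hfgY, Y.add_mem hfgY hs,
      Y.sub_mem hfgY hs, Y.sub_mem hf hg]
  · have htwo : ξ (f + g + s) (f + g - s) = 2 := by
      simp [hsf, hsg, hfg, hgf, hfs, hgs, h.alt s, h.alt f, h.alt g, one_add_one_eq_two]
    exact htwo.trans_ne h.two_ne_zero
  iterate 4 simp [hsf, hsg, hfg, hgf, h.alt f, h.alt g]
  · obtain ⟨c, hc⟩ := Submodule.mem_span_singleton.1 hmem
    have heval : c * ξ (s - t) (f + g) = ξ (s - t) (f - g) :=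
      (map_smul (ξ (s - t)) c (f + g)).symm.trans (congrArg (ξ (s - t)) hc)
    simp only [map_add, map_sub, LinearMap.sub_apply, hsf, hsg, htf, htg]
      at heval
    exact h.two_ne_zero (by linear_combination -heval)
  · simp [hfg, hgf, h.alt f, h.alt g]

end Vectors

section Hulls

variable {K V : Type*} [Field K] [AddCommGroup V] [Module K V] {ξ : LinearMap.BilinForm K V}
  {j k : ℕ} [FiniteDimensional K V]

theorem IsSymplectic.exists_isPure (h : IsSymplectic ξ) (hk : ¬ Even k) (hk3 : 3 ≤ k)
    (Y : TR ξ (k + 1)) : ∃ s t : TR ξ k, IsPure (adjacency ξ k).Adj s t ∧ s.1 ⊔ t.1 = Y.1 := by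
  have hY := h.isRegular (Nat.even_add_one.2 hk) Y
  have hd := Y.finrank_eq
  obtain ⟨s, hs, hs0⟩ := exists_ne_zero_of_finrank_pos (S := Y.1) (by omega)
  obtain ⟨t, ⟨ht, hst⟩, hts⟩ := exists_mem_notMem_of_finrank_lt
    (S := K ∙ s) (T := perpIn ξ Y.1 s) (by
      have := finrank_perpIn h.refl hY hs hs0
      rw [finrank_span_singleton hs0]
      omega)
  obtain ⟨w, hw, h01, h02, h03, h12, h13, h23, hperp⟩ := h.exists_diamond hY hs ht hs0 hts hst
  have ht0 : t ≠ 0 := fun e => hts (e ▸ zero_mem _)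
  have hw0 (i) : w i ≠ 0 := fun e => (hw i).2.1 (by rw [e, map_zero])
  obtain ⟨S, hS⟩ := hY.exists_eq_perpIn h.refl hd hs hs0
  obtain ⟨T, hT⟩ := hY.exists_eq_perpIn h.refl hd ht ht0
  choose Z hZ using fun i => hY.exists_eq_perpIn h.refl hd (hw i).1 (hw0 i)
  have hST : S.1 ≠ T.1 := fun e => hts <|
    mem_span_of_perpIn_eq h.refl hY hs hs0 ht (hS.symm.trans (e.trans hT))
  have adj_iff (i j) : (adjacency ξ k).Adj (Z i) (Z j) ↔ ξ (w i) (w j) ≠ 0 :=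
    h.adj_iff_of_eq_perpIn hk hY hd (hw i).1 (hw j).1 (hZ i) (hZ j)
  refine ⟨S, T, ⟨fun e => hST (congrArg _ e), ?_, Z, fun i => ⟨?_, ?_⟩, (adj_iff 0 1).2 h01,
    (adj_iff 0 2).2 h02, (adj_iff 0 3).2 h03, (adj_iff 1 2).2 h12, (adj_iff 1 3).2 h13,
    fun e => h23 ?_, fun hadj => (adj_iff 2 3).1 hadj hperp⟩, ?_⟩
  · rw [h.adj_iff_of_eq_perpIn hk hY hd hs ht hS hT]
    exact not_not.2 hst
  · exact ((h.adj_iff_of_eq_perpIn hk hY hd hs (hw i).1 hS (hZ i)).2 (hw i).2.1).symm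
  · exact ((h.adj_iff_of_eq_perpIn hk hY hd ht (hw i).1 hT (hZ i)).2 (hw i).2.2).symm
  · exact mem_span_of_perpIn_eq h.refl hY (hw 2).1 (hw0 2) (hw 3).1 (by rw [← hZ, ← hZ, e])
  · exact sup_eq_of_le S.finrank_eq T.finrank_eq hd (hS.le.trans perpIn_le) (hT.le.trans perpIn_le)
      hST

variable {s t : TR ξ k}

theorem le_sup_of_inHull (hne : s ≠ t)
    (hst : ¬ (adjacency ξ k).Adj s t) (hd : finrank K ↥(s.1 ⊓ t.1) + 1 = k)
    (hrad : finrank K (rad ξ (s.1 ⊔ t.1)) ≤ 1) {x : TR ξ k}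
    (hx : InHull (adjacency ξ k).Adj s t x) : x.1 ≤ s.1 ⊔ t.1 := by
  obtain ⟨z, hz, hz_ne, hz_adj⟩ := hx
  have hle (i) : (z i).1 ≤ s.1 ⊔ t.1 := le_sup_of_adj hne hst hd hrad (hz i).1 (hz i).2.1
  have hY := finrank_sup_eq_add_one s.finrank_eq t.finrank_eq hd
  have hne' : (z 0).1 ≠ (z 1).1 := fun e => hz_ne (Subtype.ext e)
  have hsup := sup_eq_of_le (z 0).finrank_eq (z 1).finrank_eq hY (hle 0) (hle 1) hne'
  have hinf := finrank_inf_add_one_of_le (z 0).finrank_eq (z 1).finrank_eq hY (hle 0) (hle 1) hne'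
  rw [← hsup]
  exact le_sup_of_adj hz_ne hz_adj hinf (hsup ▸ hrad) (hz 0).2.2 (hz 1).2.2

theorem IsSymplectic.inHull_of_le_sup (h : IsSymplectic ξ) (hk : ¬ Even k) (hk3 : 3 ≤ k)
    (hd : finrank K ↥(s.1 ⊓ t.1) + 1 = k) (hrad : finrank K (rad ξ (s.1 ⊔ t.1)) ≤ 1) {x : TR ξ k}
    (hx : x.1 ≤ s.1 ⊔ t.1) : InHull (adjacency ξ k).Adj s t x := by
  have hdY := finrank_sup_eq_add_one s.finrank_eq t.finrank_eq hd
  have hY : IsRegular ξ (s.1 ⊔ t.1) :=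
    isRegular_of_even h.alt h.two_ne_zero (hdY ▸ Nat.even_add_one.2 hk) hrad
  have exists_vector {U : TR ξ k} (hU : U.1 ≤ s.1 ⊔ t.1) :
      ∃ u ∈ s.1 ⊔ t.1, u ≠ 0 ∧ U.1 = perpIn ξ (s.1 ⊔ t.1) u :=
    exists_eq_perpIn h.refl h.nondeg hY hU (by rw [hdY, U.finrank_eq])
  obtain ⟨s', hs', hs0, hs⟩ := exists_vector le_sup_left
  obtain ⟨t', ht', ht0, ht⟩ := exists_vector le_sup_right
  obtain ⟨x', hx', hx0, hx⟩ := exists_vector hx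
  obtain ⟨d, hdmem, e, hemem, hde, hind, ⟨hsd, htd, hxd⟩, hse, hte, hxe⟩ :=
    h.exists_perp_pair hY (by omega) hs' ht' hx' hs0 ht0 hx0
  have hd0 : d ≠ 0 := fun hd0 => hsd (by rw [hd0, map_zero])
  have he0 : e ≠ 0 := fun he0 => hse (by rw [he0, map_zero])
  obtain ⟨D, hD⟩ := hY.exists_eq_perpIn h.refl hdY hdmem hd0
  obtain ⟨E, hE⟩ := hY.exists_eq_perpIn h.refl hdY hemem he0
  have adj_iff {U W : TR ξ k} {u w : V} (hu : u ∈ s.1 ⊔ t.1) (hw : w ∈ s.1 ⊔ t.1) :=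
    h.adj_iff_of_eq_perpIn (U := U) (W := W) hk hY hdY hu hw
  refine ⟨![D, E], Fin.forall_fin_two.2 ⟨⟨?_, ?_, ?_⟩, ?_, ?_, ?_⟩, fun h01 => hind ?_, ?_⟩
  · exact ((adj_iff hs' hdmem hs hD).2 hsd).symm
  · exact ((adj_iff ht' hdmem ht hD).2 htd).symm
  · exact (adj_iff hx' hdmem hx hD).2 hxd
  · exact ((adj_iff hs' hemem hs hE).2 hse).symm
  · exact ((adj_iff ht' hemem ht hE).2 hte).symm
  · exact (adj_iff hx' hemem hx hE).2 hxe
  · exact mem_span_of_perpIn_eq h.refl hY hdmem hd0 hemem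
      (hD.symm.trans ((congrArg Subtype.val h01).trans hE))
  · exact fun hadj => (adj_iff hdmem hemem hD hE).1 hadj hde

theorem IsSymplectic.inHull_iff (h : IsSymplectic ξ) (hk : ¬ Even k) (hk3 : 3 ≤ k) (hne : s ≠ t)
    (hst : ¬ (adjacency ξ k).Adj s t) (hd : finrank K ↥(s.1 ⊓ t.1) + 1 = k)
    (hrad : finrank K (rad ξ (s.1 ⊔ t.1)) ≤ 1) (x : TR ξ k) :
    InHull (adjacency ξ k).Adj s t x ↔ x.1 ≤ s.1 ⊔ t.1 :=
  ⟨le_sup_of_inHull hne hst hd hrad, h.inHull_of_le_sup hk hk3 hd hrad⟩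

theorem IsSymplectic.hasTriangular_inHull_iff_of_sup (h : IsSymplectic ξ) (hk : ¬ Even k)
    (hk3 : 3 ≤ k) (hne : s ≠ t) (hst : ¬ (adjacency ξ k).Adj s t)
    (hd : finrank K ↥(s.1 ⊓ t.1) + 1 = k) (hrad : finrank K (rad ξ (s.1 ⊔ t.1)) ≤ 1) (r : ℕ) :
    HasTriangular (adjacency ξ k).Adj (InHull (adjacency ξ k).Adj s t) r ↔ r ≤ k + 1 := by
  have hdY := finrank_sup_eq_add_one s.finrank_eq t.finrank_eq hd
  rw [← h.hasTriangular_iff hk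
    (isRegular_of_even h.alt h.two_ne_zero (hdY ▸ Nat.even_add_one.2 hk) hrad) hdY r]
  simp only [HasTriangular, h.inHull_iff hk hk3 hne hst hd hrad]

theorem IsSymplectic.hasTriangular_inHull_iff_of_inf (h : IsSymplectic ξ)
    (hkj : k + j = finrank K V) (hk : ¬ Even k) (hj3 : 3 ≤ j) (hne : s ≠ t)
    (hst : ¬ (adjacency ξ k).Adj s t) (hd : finrank K ↥(s.1 ⊓ t.1) + 1 = k)
    (hrad : finrank K (rad ξ (s.1 ⊓ t.1)) ≤ 1) (r : ℕ) :
    HasTriangular (adjacency ξ k).Adj (InHull (adjacency ξ k).Adj s t) r ↔ r ≤ j + 1 := by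
  have hj : ¬ Even j := by
    have := h.even_finrank
    rw [← hkj, Nat.even_add] at this
    exact fun hj => hk (this.2 hj)
  have transfer := (UniformlyDefinable.hasTriangular_inHull (0 : Fin 2) 1 r).iff_of_equiv
    (h.dual hkj) (fun a b => h.adj_dual_iff hkj) ![s, t]
  refine transfer.trans (h.hasTriangular_inHull_iff_of_sup hj hj3
    ((h.dual hkj).injective.ne hne) ?_ ?_ ?_ r)
  · rwa [← h.adj_dual_iff]
  · have hdim := finrank_add_finrank_orthogonal h.nondeg (s.1 ⊔ t.1)
    rw [finrank_sup_eq_add_one s.finrank_eq t.finrank_eq hd, orthogonal_sup h.refl] at hdim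
    change finrank K ↥(ξ.orthogonal s.1 ⊓ ξ.orthogonal t.1) + 1 = j
    omega
  · change finrank K (rad ξ (ξ.orthogonal s.1 ⊔ ξ.orthogonal t.1)) ≤ 1
    rwa [← orthogonal_inf h.refl h.nondeg, rad_orthogonal h.refl h.nondeg]

end Hulls

theorem definableFromAdjacency_add_one_of_odd {n k : ℕ} (hk : ¬ Even k) (hk3 : 3 ≤ k)
    (hkn : k + 3 ≤ n) (hne : k ≠ n - k) : DefinableFromAdjacency.{u, v} n k (k + 1) := by
  obtain ⟨Q, hQ, hQ_iff⟩ := exists_separating (show k + 1 ≠ n - k + 1 by omega)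
    fun r => UniformlyDefinable.hasTriangular_inHull.{v} (0 : Fin 2) 1 r
  refine definableFromAdjacency_add_one_of_mem hk hkn
    (Dom := fun M A t => IsPure A (t 0) (t 1) ∧ Q M A t)
    (Mem := fun M A t => InHull A (t 0) (t 1)) (.and (.isPure 0 1) hQ) (.inHull _ _ _)
    fun K V _ _ _ ξ hξ => ?_
  have := hξ.2.1
  have hs := hξ.isSymplectic
  have hn := hξ.2.2.1
  refine ⟨fun t ⟨hp, hq⟩ => ?_, fun Y => ?_⟩
  · have hd := finrank_inf_add_one_of_isPure hp
    rcases finrank_rad_sup_le_one_or_of_isPure hp with hrad | hrad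
    · exact ⟨TR.of _ (finrank_sup_eq_add_one (t 0).finrank_eq (t 1).finrank_eq hd) hrad,
        hs.inHull_iff hk hk3 hp.1 hp.2.1 hd hrad⟩
    · exact absurd hq ((hQ_iff _ _ t).2 (hs.hasTriangular_inHull_iff_of_inf (by omega) hk
        (by omega) hp.1 hp.2.1 hd hrad))
  · obtain ⟨s, t, hp, hY⟩ := hs.exists_isPure hk hk3 Y
    have hrad : finrank K (rad ξ (s.1 ⊔ t.1)) ≤ 1 := hY ▸ Y.finrank_rad_le
    have hd := finrank_inf_add_one_of_isPure hp
    exact ⟨![s, t], ⟨hp, (hQ_iff _ _ _).1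
      (hs.hasTriangular_inHull_iff_of_sup hk hk3 hp.1 hp.2.1 hd hrad)⟩,
      fun U => hY ▸ hs.inHull_iff hk hk3 hp.1 hp.2.1 hd hrad U⟩

/-! ### Maximal cliques coded by triples -/

section Graph

variable {M : Type*} (A : M → M → Prop)

/-- The clique coded by the triple `t`: the elements related or equal to each entry of `t`. -/
def InClique (t : Fin 3 → M) (z : M) : Prop := ∀ i, A z (t i) ∨ z = t i

/-- The triples of pairwise adjacent vertices contained in exactly one maximal clique. In the even
case these are the codes for the subspaces of dimension `k - 1` and `k + 1`. -/
def IsClass (t : Fin 3 → M) : Prop :=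
  A (t 0) (t 1) ∧ A (t 0) (t 2) ∧ A (t 1) (t 2) ∧
    ∀ z w, InClique A t z → InClique A t w → A z w ∨ z = w

/-- Equality of coded cliques. -/
def SameClique (s t : Fin 3 → M) : Prop := ∀ z, InClique A s z ↔ InClique A t z

/-- The cliques of `s` and `t` share exactly one element. For cliques of subspaces of dimension `k`
containing a given subspace of dimension `k - 1`, this says that the two given subspaces lie in a
common one, see `Joinable`. -/
def MeetOnce (s t : Fin 3 → M) : Prop := ∃! z, InClique A s z ∧ InClique A t z

/-- The adjacency of the subspaces coded by `s` and `t`, see `AdjByJoin`. -/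
def CliqueAdj (s t : Fin 3 → M) : Prop :=
  MeetOnce A s t ∧ ∃ d e g : Fin 3 → M, (IsClass A d ∧ IsClass A e ∧ IsClass A g) ∧
    (∀ z, InClique A s z → InClique A t z → ¬ InClique A d z ∧ ¬ InClique A e z) ∧
    (MeetOnce A s d ∧ MeetOnce A t d ∧ MeetOnce A s e ∧ MeetOnce A t e) ∧
    (¬ MeetOnce A d e ∧ ¬ SameClique A d e) ∧ (MeetOnce A d g ∧ MeetOnce A e g) ∧
    ¬ MeetOnce A s g ∧ ¬ MeetOnce A t g

/-- Triangular systems of length `r` of cliques through an element of the clique of `t`. The maximal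
`r` tells apart the triples that code subspaces of dimension `k - 1` and `k + 1`. -/
def HasCliqueTriangular (t : Fin 3 → M) (r : ℕ) : Prop :=
  ∃ z, InClique A t z ∧ HasTriangular (CliqueAdj A)
    (fun c => IsClass A c ∧ InClique A c z ∧ (SameClique A t c ∨ MeetOnce A t c)) r

variable {A} {t : Fin 3 → M} {z : M}

theorem inClique_iff : InClique A t z ↔
    (A z (t 0) ∨ z = t 0) ∧ (A z (t 1) ∨ z = t 1) ∧ (A z (t 2) ∨ z = t 2) := by
  simp only [InClique, Fin.forall_fin_succ, Fin.succ_zero_eq_one, Fin.succ_one_eq_two,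
    IsEmpty.forall_iff, and_true]

end Graph

namespace UniformlyDefinable

variable {α : Type} (t t' : Fin 3 → α)

theorem inClique (a : α) : UniformlyDefinable.{v} fun _ A x => InClique A (x ∘ t) (x a) :=
  .forall_index fun _ => .or (.rel _ _) (.eq _ _)

theorem isClass : UniformlyDefinable.{v} fun _ A x => IsClass A (x ∘ t) :=
  have mem := inClique.{v} (α := (α ⊕ Unit) ⊕ Unit) (Sum.inl ∘ Sum.inl ∘ t)
  .and (.rel _ _) (.and (.rel _ _) (.and (.rel _ _) (.forall_elem (.forall_elem
    (.imp (mem (.inl (.inr ()))) (.imp (mem (.inr ())) (.or (.rel _ _) (.eq _ _))))))))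

theorem sameClique : UniformlyDefinable.{v} fun _ A x => SameClique A (x ∘ t) (x ∘ t') :=
  .forall_elem (.iff (.inClique (Sum.inl ∘ t) _) (.inClique (Sum.inl ∘ t') _))

theorem meetOnce : UniformlyDefinable.{v} fun _ A x => MeetOnce A (x ∘ t) (x ∘ t') :=
  have mem {β : Type} (i : α → β) (b : β) :
      UniformlyDefinable.{v} fun _ A x => InClique A (x ∘ i ∘ t) (x b) ∧
        InClique A (x ∘ i ∘ t') (x b) :=
    .and (.inClique (i ∘ t) b) (.inClique (i ∘ t') b)
  .exists_elem (.and (mem Sum.inl _)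
    (.forall_elem (.imp (mem (Sum.inl ∘ Sum.inl) (.inr ())) (.eq _ _))))

theorem cliqueAdj : UniformlyDefinable.{v} fun _ A x => CliqueAdj A (x ∘ t) (x ∘ t') :=
  let s : Fin 3 → ((α ⊕ Fin 3) ⊕ Fin 3) ⊕ Fin 3 := Sum.inl ∘ Sum.inl ∘ Sum.inl ∘ t
  let s' : Fin 3 → ((α ⊕ Fin 3) ⊕ Fin 3) ⊕ Fin 3 := Sum.inl ∘ Sum.inl ∘ Sum.inl ∘ t'
  let d : Fin 3 → ((α ⊕ Fin 3) ⊕ Fin 3) ⊕ Fin 3 := Sum.inl ∘ Sum.inl ∘ Sum.inr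
  let e : Fin 3 → ((α ⊕ Fin 3) ⊕ Fin 3) ⊕ Fin 3 := Sum.inl ∘ Sum.inr
  let g : Fin 3 → ((α ⊕ Fin 3) ⊕ Fin 3) ⊕ Fin 3 := Sum.inr
  have mem (c : Fin 3 → ((α ⊕ Fin 3) ⊕ Fin 3) ⊕ Fin 3) := inClique.{v} (Sum.inl ∘ c) (.inr ())
  .and (meetOnce t t') (.exists_tuple (.exists_tuple (.exists_tuple
    (.and (.and (isClass d) (.and (isClass e) (isClass g)))
    (.and (.forall_elem (.imp (mem s) (.imp (mem s') (.and (.not (mem d)) (.not (mem e))))))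
    (.and (.and (meetOnce s d) (.and (meetOnce s' d) (.and (meetOnce s e) (meetOnce s' e))))
    (.and (.and (.not (meetOnce d e)) (.not (sameClique d e)))
    (.and (.and (meetOnce d g) (meetOnce e g))
      (.and (.not (meetOnce s g)) (.not (meetOnce s' g)))))))))))

theorem hasCliqueTriangular (r : ℕ) :
    UniformlyDefinable.{v} fun _ A x => HasCliqueTriangular A (x ∘ t) r :=
  let β := ((α ⊕ Unit) ⊕ Fin r × Fin 3) ⊕ Fin r × Fin 3
  let s : Fin 3 → β := Sum.inl ∘ Sum.inl ∘ Sum.inl ∘ t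
  let a (i : Fin r) (j : Fin 3) : β := .inl (.inr (i, j))
  let b (i : Fin r) (j : Fin 3) : β := .inr (i, j)
  have admissible (c : Fin 3 → β) : UniformlyDefinable.{v} fun _ A x => IsClass A (x ∘ c) ∧
      InClique A (x ∘ c) (x (.inl (.inl (.inr ())))) ∧
        (SameClique A (x ∘ s) (x ∘ c) ∨ MeetOnce A (x ∘ s) (x ∘ c)) :=
    .and (isClass c) (.and (inClique c _) (.or (sameClique s c) (meetOnce s c)))
  .exists_elem (.and (inClique (Sum.inl ∘ t) _) (.exists_family (.exists_family (.and
    (.forall_index fun i => .and (admissible (a i)) (.and (admissible (b i)) (cliqueAdj _ _)))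
    (.forall_index fun i => .forall_index fun j =>
      .imp_of_const (.not (cliqueAdj (a j) (b i))))))))

end UniformlyDefinable

section Stars

variable {K V : Type*} [Field K] [AddCommGroup V] [Module K V] {ξ : LinearMap.BilinForm K V}
  {j k : ℕ} {t t' : Fin 3 → TR ξ k} {X X' : TR ξ j}

/-- The clique of `t` is the star of `X`: it consists of the elements above `X`. -/
def StarAt (t : Fin 3 → TR ξ k) (X : TR ξ j) : Prop :=
  ∀ z, InClique (adjacency ξ k).Adj t z ↔ X.1 ≤ z.1

/-- The clique of `t` is the top of `Y`: it consists of the elements below `Y`. -/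
def TopAt (t : Fin 3 → TR ξ k) (Y : TR ξ j) : Prop :=
  ∀ z, InClique (adjacency ξ k).Adj t z ↔ z.1 ≤ Y.1

/-- Being distinct and lying in a common element of `TR ξ k`. -/
def Joinable (k : ℕ) (X X' : TR ξ j) : Prop := X ≠ X' ∧ ∃ U : TR ξ k, X.1 ≤ U.1 ∧ X'.1 ≤ U.1

variable [FiniteDimensional K V]

theorem IsSymplectic.inClique_iff_ge (h : IsSymplectic ξ) (hk : Even k)
    (h01 : (adjacency ξ k).Adj (t 0) (t 1)) (hle : (t 0).1 ⊓ (t 1).1 ≤ (t 2).1)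
    (hnle : ¬ (t 2).1 ≤ (t 0).1 ⊔ (t 1).1) (z : TR ξ k) :
    InClique (adjacency ξ k).Adj t z ↔ (t 0).1 ⊓ (t 1).1 ≤ z.1 := by
  have hinf := (adj_iff.1 h01).2.1
  refine inClique_iff.trans ⟨fun ⟨hz0, hz1, hz2⟩ => ?_, fun hz =>
    ⟨h.adj_or_eq_of_ge hk hinf hz inf_le_left, h.adj_or_eq_of_ge hk hinf hz inf_le_right,
      h.adj_or_eq_of_ge hk hinf hz hle⟩⟩
  refine (h.inf_le_or_le_sup hk h01 hz0 hz1).elim id fun hsup => ?_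
  by_contra hz
  have hlt := finrank_inf_lt_of_not_le (by rw [hinf, (t 2).finrank_eq]) hle
    (inf_le_left.trans le_sup_left) hnle hsup hz
  rw [h.adj_or_eq_iff hk, inf_comm] at hz2
  omega

theorem IsSymplectic.inClique_iff_le (h : IsSymplectic ξ) (hk : Even k)
    (h01 : (adjacency ξ k).Adj (t 0) (t 1)) (hle : (t 2).1 ≤ (t 0).1 ⊔ (t 1).1)
    (hnle : ¬ (t 0).1 ⊓ (t 1).1 ≤ (t 2).1) (z : TR ξ k) :
    InClique (adjacency ξ k).Adj t z ↔ z.1 ≤ (t 0).1 ⊔ (t 1).1 := by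
  have hinf := (adj_iff.1 h01).2.1
  have hsup := finrank_sup_eq_add_one (t 0).finrank_eq (t 1).finrank_eq hinf
  refine inClique_iff.trans ⟨fun ⟨hz0, hz1, hz2⟩ => ?_, fun hz =>
    ⟨h.adj_or_eq_of_le hk hsup hz le_sup_left, h.adj_or_eq_of_le hk hsup hz le_sup_right,
      h.adj_or_eq_of_le hk hsup hz hle⟩⟩
  refine (h.inf_le_or_le_sup hk h01 hz0 hz1).elim (fun hle' => ?_) id
  by_contra hz
  have hlt := finrank_inf_lt_of_not_le (by rw [hinf, z.finrank_eq]) hle'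
    (inf_le_left.trans le_sup_left) hz hle hnle
  rw [h.adj_or_eq_iff hk] at hz2
  omega

theorem IsSymplectic.not_isClass_of_mem_line (h : IsSymplectic ξ) (hk : Even k) (hk2 : 2 ≤ k)
    (hkn : k + 2 ≤ finrank K V) (hle : (t 0).1 ⊓ (t 1).1 ≤ (t 2).1)
    (hle' : (t 2).1 ≤ (t 0).1 ⊔ (t 1).1) : ¬ IsClass (adjacency ξ k).Adj t := by
  rintro ⟨h01, -, -, hclique⟩
  obtain ⟨-, hinf, hrinf, -⟩ := adj_iff.1 h01
  have hsup := finrank_sup_eq_add_one (t 0).finrank_eq (t 1).finrank_eq hinf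
  have mem_clique : ∀ z : TR ξ k, ((adjacency ξ k).Adj z (t 0) ∨ z = t 0) →
      ((adjacency ξ k).Adj z (t 1) ∨ z = t 1) → InClique (adjacency ξ k).Adj t z :=
    fun z hz0 hz1 => inClique_iff.2
      ⟨hz0, hz1, (h.mem_line_iff hk hk2 hkn h01).1 ⟨hle, hle'⟩ z hz0 hz1⟩
  obtain ⟨z, hz, hzsup⟩ := h.exists_ge_not_le hinf hk (TR.of ((t 0).1 ⊓ (t 1).1) rfl hrinf)
    (B := (t 0).1 ⊔ (t 1).1) (fun e => by rw [e, finrank_top] at hsup; omega)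
  have hzt := mem_clique z (h.adj_or_eq_of_ge hk hinf hz inf_le_left)
    (h.adj_or_eq_of_ge hk hinf hz inf_le_right)
  exact hzsup ((h.mem_line_iff hk hk2 hkn h01).2
    fun w hw0 hw1 => hclique w z (mem_clique w hw0 hw1) hzt).2

theorem IsSymplectic.starAt_or_topAt (h : IsSymplectic ξ) (hjk : j + 1 = k) (hk : Even k)
    (hk2 : 2 ≤ k) (hkn : k + 2 ≤ finrank K V) (ht : IsClass (adjacency ξ k).Adj t) :
    (∃ X : TR ξ j, StarAt t X) ∨ ∃ Y : TR ξ (k + 1), TopAt t Y := by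
  obtain ⟨-, hinf, hrinf, hrsup⟩ := adj_iff.1 ht.1
  by_cases hle : (t 0).1 ⊓ (t 1).1 ≤ (t 2).1
  · exact .inl ⟨TR.of _ (by omega) hrinf, h.inClique_iff_ge hk ht.1 hle
      fun hle' => h.not_isClass_of_mem_line hk hk2 hkn hle hle' ht⟩
  · have hle' := (h.inf_le_or_le_sup hk ht.1 (.inl ht.2.1.symm)
      (.inl ht.2.2.1.symm)).resolve_left hle
    exact .inr ⟨TR.of _ (finrank_sup_eq_add_one (t 0).finrank_eq (t 1).finrank_eq hinf) hrsup,
      h.inClique_iff_le hk ht.1 hle' hle⟩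

theorem IsSymplectic.exists_inf_eq (h : IsSymplectic ξ) (hjk : j + 1 = k) (hk : Even k)
    (hkn : k < finrank K V) (X : TR ξ j) : ∃ z w : TR ξ k, z ≠ w ∧ z.1 ⊓ w.1 = X.1 := by
  have ne_top {S : Submodule K V} (hS : finrank K S ≤ k) : S ≠ ⊤ := by
    rintro rfl
    rw [finrank_top] at hS
    omega
  obtain ⟨z, hz, -⟩ := h.exists_ge_not_le hjk hk X (ne_top (S := ⊥) (by simp))
  obtain ⟨w, hw, hwz⟩ := h.exists_ge_not_le hjk hk X (ne_top z.finrank_eq.le)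
  have hne : z ≠ w := fun e => hwz e.ge
  exact ⟨z, w, hne, inf_eq_of_ge z.finrank_eq w.finrank_eq (by rw [X.finrank_eq, hjk]) hz hw
    (TR.ne hne)⟩

theorem IsSymplectic.exists_starAt (h : IsSymplectic ξ) (hjk : j + 1 = k) (hk : Even k)
    (hkn : k + 2 ≤ finrank K V) (X : TR ξ j) :
    ∃ t : Fin 3 → TR ξ k, IsClass (adjacency ξ k).Adj t ∧ StarAt t X := by
  have hX : finrank K X.1 + 1 = k := by rw [X.finrank_eq, hjk]
  obtain ⟨z, w, hne, hzw⟩ := h.exists_inf_eq hjk hk (by omega) X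
  have hsup := finrank_sup_eq_add_one z.finrank_eq w.finrank_eq (hzw.symm ▸ hX)
  obtain ⟨y, hy, hyzw⟩ := h.exists_ge_not_le hjk hk X (B := z.1 ⊔ w.1)
    (fun e => by rw [e, finrank_top] at hsup; omega)
  have adj {U W : TR ξ k} (hU : X.1 ≤ U.1) (hW : X.1 ≤ W.1) := h.adj_or_eq_of_ge hk hX hU hW
  have hz : X.1 ≤ z.1 := hzw ▸ inf_le_left
  have hw : X.1 ≤ w.1 := hzw ▸ inf_le_right
  have hadj := (adj hz hw).resolve_right hne
  have hstar : StarAt ![z, w, y] X := fun U =>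
    hzw ▸ h.inClique_iff_ge (t := ![z, w, y]) hk hadj (hzw.trans_le hy) hyzw U
  exact ⟨![z, w, y], ⟨hadj, (adj hz hy).resolve_right fun e => hyzw (e ▸ le_sup_left),
    (adj hw hy).resolve_right fun e => hyzw (e ▸ le_sup_right),
    fun U W hU hW => adj ((hstar U).1 hU) ((hstar W).1 hW)⟩, hstar⟩

theorem IsSymplectic.le_of_forall_ge (h : IsSymplectic ξ) (hjk : j + 1 = k) (hk : Even k)
    (hkn : k < finrank K V) (hle : ∀ U : TR ξ k, X'.1 ≤ U.1 → X.1 ≤ U.1) : X.1 ≤ X'.1 := by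
  obtain ⟨z, w, -, hzw⟩ := h.exists_inf_eq hjk hk hkn X'
  exact (le_inf (hle z (hzw.ge.trans inf_le_left)) (hle w (hzw.ge.trans inf_le_right))).trans hzw.le

theorem IsSymplectic.sameClique_iff (h : IsSymplectic ξ) (hjk : j + 1 = k) (hk : Even k)
    (hkn : k < finrank K V) (ht : StarAt t X) (ht' : StarAt t' X') :
    SameClique (adjacency ξ k).Adj t t' ↔ X = X' := by
  constructor
  · intro hs
    exact Subtype.ext (le_antisymm
      (h.le_of_forall_ge hjk hk hkn fun U hU => (ht U).1 ((hs U).2 ((ht' U).2 hU)))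
      (h.le_of_forall_ge hjk hk hkn fun U hU => (ht' U).1 ((hs U).1 ((ht U).2 hU))))
  · rintro rfl z
    exact (ht z).trans (ht' z).symm

theorem Joinable.sup_eq (hX : Joinable k X X') (hjk : j + 1 = k) {U : TR ξ k} (hU : X.1 ≤ U.1)
    (hU' : X'.1 ≤ U.1) : X.1 ⊔ X'.1 = U.1 :=
  sup_eq_of_le X.finrank_eq X'.finrank_eq (by rw [U.finrank_eq, hjk]) hU hU' (TR.ne hX.1)

theorem IsSymplectic.meetOnce_iff (h : IsSymplectic ξ) (hjk : j + 1 = k) (hk : Even k)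
    (hkn : k < finrank K V) (ht : StarAt t X) (ht' : StarAt t' X') :
    MeetOnce (adjacency ξ k).Adj t t' ↔ Joinable k X X' := by
  simp only [MeetOnce, ht _, ht' _]
  constructor
  · rintro ⟨U, hU, huniq⟩
    refine ⟨?_, U, hU⟩
    rintro rfl
    obtain ⟨z, w, hne, hzw⟩ := h.exists_inf_eq hjk hk hkn X
    have hz : X.1 ≤ z.1 := hzw ▸ inf_le_left
    have hw : X.1 ≤ w.1 := hzw ▸ inf_le_right
    exact hne ((huniq z ⟨hz, hz⟩).trans (huniq w ⟨hw, hw⟩).symm)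
  · intro hX
    obtain ⟨-, U, hU, hU'⟩ := id hX
    exact ⟨U, ⟨hU, hU'⟩, fun W hW => Subtype.ext
      ((hX.sup_eq hjk hW.1 hW.2).symm.trans (hX.sup_eq hjk hU hU'))⟩

theorem IsSymplectic.not_meetOnce (h : IsSymplectic ξ) (hjk : j + 1 = k) {Y : TR ξ (k + 1)}
    (ht : StarAt t X) (ht' : TopAt t' Y) : ¬ MeetOnce (adjacency ξ k).Adj t t' := by
  simp only [MeetOnce, ht _, ht' _]
  rintro ⟨U, hU, huniq⟩
  obtain ⟨W, hW, hne⟩ := h.exists_ne_mem_pencil (l := {U : TR ξ k | X.1 ≤ U.1 ∧ U.1 ≤ Y.1})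
    ⟨⟨U, hU⟩, j, X, Y, hjk, hU.1.trans hU.2, rfl⟩ hU
  exact hne (huniq W hW)

theorem IsSymplectic.exists_starAt_of_meetOnce (h : IsSymplectic ξ) (hjk : j + 1 = k)
    (hk : Even k) (hk2 : 2 ≤ k) (hkn : k + 2 ≤ finrank K V) (ht : StarAt t X)
    (ht' : IsClass (adjacency ξ k).Adj t') (hm : MeetOnce (adjacency ξ k).Adj t t') :
    ∃ X' : TR ξ j, StarAt t' X' :=
  (h.starAt_or_topAt hjk hk hk2 hkn ht').resolve_right fun ⟨_, hY⟩ => h.not_meetOnce hjk ht hY hm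

end Stars

/-! ### Adjacency in terms of joins -/

section Joins

variable {K V : Type*} [Field K] [AddCommGroup V] [Module K V] {ξ : LinearMap.BilinForm K V}
  {j k : ℕ} {H : Submodule K V} {X X' D E G : TR ξ j}

/-- The adjacency of the `j`-dimensional subspaces `X` and `X'`, expressed by joins in dimension
`k = j + 1`, for `j` odd. As `X ⊔ X'` is regular, only the regularity of `X ⊓ X'` has to be
expressed; it amounts to the existence of `D`, `E` and `G` as below. -/
def AdjByJoin (k : ℕ) (X X' : TR ξ j) : Prop :=
  Joinable k X X' ∧ ∃ D E G : TR ξ j,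
    (∀ U : TR ξ k, X.1 ≤ U.1 → X'.1 ≤ U.1 → ¬ D.1 ≤ U.1 ∧ ¬ E.1 ≤ U.1) ∧
    (Joinable k X D ∧ Joinable k X' D ∧ Joinable k X E ∧ Joinable k X' E) ∧
    (¬ Joinable k D E ∧ D ≠ E) ∧ (Joinable k D G ∧ Joinable k E G) ∧
    ¬ Joinable k X G ∧ ¬ Joinable k X' G

variable [FiniteDimensional K V]

theorem Joinable.finrank_inf (hX : Joinable k X X') (hjk : j + 1 = k) :
    finrank K ↥(X.1 ⊓ X'.1) + 1 = j := by
  obtain ⟨hne, U, hU, hU'⟩ := hX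
  exact finrank_inf_add_one_of_le X.finrank_eq X'.finrank_eq (by rw [U.finrank_eq, hjk]) hU hU'
    (TR.ne hne)

theorem IsSymplectic.joinable_iff (h : IsSymplectic ξ) (hjk : j + 1 = k) (hk : Even k) :
    Joinable k X X' ↔
      X ≠ X' ∧ finrank K ↥(X.1 ⊓ X'.1) + 1 = j ∧ IsRegular ξ (X.1 ⊔ X'.1) := by
  constructor
  · intro hX
    obtain ⟨hne, U, hU, hU'⟩ := id hX
    exact ⟨hne, hX.finrank_inf hjk, (hX.sup_eq hjk hU hU').symm ▸ h.isRegular hk U⟩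
  · rintro ⟨hne, hinf, hreg⟩
    exact ⟨hne, TR.of _ ((finrank_sup_eq_add_one X.finrank_eq X'.finrank_eq hinf).trans hjk)
      hreg.finrank_rad_le_one, le_sup_left, le_sup_right⟩

theorem Joinable.inf_le_or_le_sup (hX : Joinable k X X') (hXD : Joinable k X D)
    (hXD' : Joinable k X' D) (hjk : j + 1 = k) : X.1 ⊓ X'.1 ≤ D.1 ∨ D.1 ≤ X.1 ⊔ X'.1 :=
  SympGrassmann.inf_le_or_le_sup D.finrank_eq (hX.finrank_inf hjk)
    (inf_comm D.1 X.1 ▸ hXD.finrank_inf hjk) (inf_comm D.1 X'.1 ▸ hXD'.finrank_inf hjk)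

theorem Joinable.inf_le_of_not_joinable (hDG : Joinable k D G) (hEG : Joinable k E G)
    (hjk : j + 1 = k) (hne : D ≠ E) (hinf : finrank K ↥(D.1 ⊓ E.1) + 1 = j)
    (hDE : ¬ Joinable k D E) : D.1 ⊓ E.1 ≤ G.1 := by
  refine (SympGrassmann.inf_le_or_le_sup G.finrank_eq hinf (inf_comm G.1 D.1 ▸ hDG.finrank_inf hjk)
    (inf_comm G.1 E.1 ▸ hEG.finrank_inf hjk)).resolve_right fun hle => hDE ?_
  obtain ⟨hneG, U, hD, hG⟩ := hDG
  have hsup : D.1 ⊔ G.1 = D.1 ⊔ E.1 := sup_eq_of_le D.finrank_eq G.finrank_eq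
    (finrank_sup_eq_add_one D.finrank_eq E.finrank_eq hinf) le_sup_left hle (TR.ne hneG)
  exact ⟨hne, U, hD, le_sup_right.trans (hsup.ge.trans (sup_le hD hG))⟩

theorem IsSymplectic.rad_le_of_not_isRegular (h : IsSymplectic ξ) (hj : ¬ Even j)
    (hH : finrank K H + 1 = j) (hreg : ¬ IsRegular ξ H) (hX : H ≤ X.1) : rad ξ X.1 ≤ H := by
  have hHeven : Even (finrank K H) := by rwa [← hH, Nat.even_add_one, not_not] at hj
  have htwo : 2 ≤ finrank K (rad ξ H) :=
    not_le.1 ((h.finrank_rad_le_one_iff hHeven).not.2 hreg)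
  obtain ⟨r, ⟨hrH, hrX⟩, hr0⟩ := exists_ne_zero_of_finrank_pos
    (S := rad ξ H ⊓ ξ.orthogonal X.1) (by
      have hdH := finrank_add_finrank_orthogonal h.nondeg H
      have hdX := finrank_add_finrank_orthogonal h.nondeg X.1
      rw [X.finrank_eq] at hdX
      have := finrank_le_finrank_inf_add_one (S := rad ξ H)
        (LinearMap.BilinForm.orthogonal_le hX) (by omega) inf_le_right
      omega)
  have hr : r ∈ rad ξ X.1 := ⟨hX hrH.1, hrX⟩
  exact fun y hy => (Submodule.span_singleton_le_iff_mem r H).2 hrH.1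
    (mem_span_singleton_of_finrank_le_one X.finrank_rad_le hr hy hr0)

theorem TR.rad_eq_span (X : TR ξ j) {r : V} (hr : r ∈ rad ξ X.1) (hr0 : r ≠ 0) :
    rad ξ X.1 = K ∙ r :=
  le_antisymm (fun _ hy => mem_span_singleton_of_finrank_le_one X.finrank_rad_le hr hy hr0)
    ((Submodule.span_singleton_le_iff_mem r _).2 hr)

theorem IsSymplectic.isRegular_sup_iff_rad_ne (h : IsSymplectic ξ) (hj : ¬ Even j)
    (hH : finrank K H + 1 = j) (hreg : ¬ IsRegular ξ H) (hX : H ≤ X.1) (hX' : H ≤ X'.1)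
    (hne : X ≠ X') : IsRegular ξ (X.1 ⊔ X'.1) ↔ rad ξ X.1 ≠ rad ξ X'.1 := by
  constructor
  · intro hsup hrad
    obtain ⟨r, hr, hr0⟩ := exists_ne_zero_of_finrank_pos ((h.isTangential hj X).symm ▸ one_pos)
    have hr' : r ∈ rad ξ X'.1 := hrad ▸ hr
    refine hr0 ((Submodule.mem_bot K).1 (hsup.le ⟨le_sup_left (a := X.1) hr.1, ?_⟩))
    rw [orthogonal_sup h.refl]
    exact ⟨hr.2, hr'.2⟩
  · intro hrad
    by_contra hsup
    have hd := finrank_sup_eq_add_one X.finrank_eq X'.finrank_eq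
      (inf_eq_of_ge X.finrank_eq X'.finrank_eq hH hX hX' (TR.ne hne) ▸ hH)
    have htwo : 2 ≤ finrank K (rad ξ (X.1 ⊔ X'.1)) :=
      not_le.1 ((h.finrank_rad_le_one_iff (by rwa [hd, Nat.even_add_one])).not.2 hsup)
    obtain ⟨r, ⟨hr, hrX⟩, hr0⟩ := exists_ne_zero_of_finrank_pos
      (S := rad ξ (X.1 ⊔ X'.1) ⊓ X.1) (by
        have := finrank_le_finrank_inf_add_one (le_sup_left : X.1 ≤ X.1 ⊔ X'.1)
          (by rw [hd, X.finrank_eq]) (rad_le (ξ := ξ) (X.1 ⊔ X'.1))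
        omega)
    have hperp : r ∈ ξ.orthogonal X.1 ⊓ ξ.orthogonal X'.1 := orthogonal_sup h.refl X.1 X'.1 ▸ hr.2
    have hrX' : r ∈ X'.1 := hX' (h.rad_le_of_not_isRegular hj hH hreg hX ⟨hrX, hperp.1⟩)
    exact hrad ((X.rad_eq_span ⟨hrX, hperp.1⟩ hr0).trans
      (X'.rad_eq_span ⟨hrX', hperp.2⟩ hr0).symm)

-- Over a nonregular hyperplane, joinability is thus the adjacency of a complete multipartite graph.
theorem IsSymplectic.joinable_iff_rad_ne (h : IsSymplectic ξ) (hjk : j + 1 = k) (hk : Even k)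
    (hH : finrank K H + 1 = j) (hreg : ¬ IsRegular ξ H) (hX : H ≤ X.1) (hX' : H ≤ X'.1) :
    Joinable k X X' ↔ rad ξ X.1 ≠ rad ξ X'.1 := by
  have hj : ¬ Even j := by rwa [← hjk, Nat.even_add_one] at hk
  rw [h.joinable_iff hjk hk]
  constructor
  · rintro ⟨hne, -, hsup⟩
    exact (h.isRegular_sup_iff_rad_ne hj hH hreg hX hX' hne).1 hsup
  · intro hrad
    have hne : X ≠ X' := fun e => hrad (by rw [e])
    exact ⟨hne, inf_eq_of_ge X.finrank_eq X'.finrank_eq hH hX hX' (TR.ne hne) ▸ hH,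
      (h.isRegular_sup_iff_rad_ne hj hH hreg hX hX' hne).2 hrad⟩

theorem IsSymplectic.adj_of_adjByJoin (h : IsSymplectic ξ) (hjk : j + 1 = k) (hk : Even k)
    (hX : AdjByJoin k X X') : (adjacency ξ j).Adj X X' := by
  obtain ⟨hXX, D, E, G, hU, ⟨hXD, hXD', hXE, hXE'⟩, ⟨hDE, hne⟩, ⟨hDG, hEG⟩, hXG, hXG'⟩ := hX
  have hj : ¬ Even j := by rwa [← hjk, Nat.even_add_one] at hk
  have hinf := hXX.finrank_inf hjk
  refine (h.adj_iff_of_odd hj).2 ⟨hXX.1, hinf, ?_, ((h.joinable_iff hjk hk).1 hXX).2.2⟩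
  by_contra hreg
  have joinable_iff {Z Z' : TR ξ j} := h.joinable_iff_rad_ne (X := Z) (X' := Z') hjk hk hinf hreg
  obtain ⟨-, U, hXU, hXU'⟩ := id hXX
  have hUDE := hU U hXU hXU'
  have hD := (hXX.inf_le_or_le_sup hXD hXD' hjk).resolve_right
    fun hle => hUDE.1 (hle.trans (sup_le hXU hXU'))
  have hE := (hXX.inf_le_or_le_sup hXE hXE' hjk).resolve_right
    fun hle => hUDE.2 (hle.trans (sup_le hXU hXU'))
  have hinfDE := inf_eq_of_ge D.finrank_eq E.finrank_eq hinf hD hE (TR.ne hne)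
  have hG : X.1 ⊓ X'.1 ≤ G.1 :=
    hinfDE ▸ hDG.inf_le_of_not_joinable hEG hjk hne (hinfDE.symm ▸ hinf) hDE
  have hradX := not_not.1 ((joinable_iff inf_le_left hG).not.1 hXG)
  have hradX' := not_not.1 ((joinable_iff inf_le_right hG).not.1 hXG')
  exact (joinable_iff inf_le_left inf_le_right).1 hXX (hradX.trans hradX'.symm)

end Joins

section JoinsOverRegular

variable {K V : Type*} [Field K] [AddCommGroup V] [Module K V] {ξ : LinearMap.BilinForm K V}
  {j k l : ℕ} {Y H : Submodule K V} {X X' : TR ξ j} {x y : V} [FiniteDimensional K V]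

theorem IsSymplectic.exists_witnesses (h : IsSymplectic ξ) (hY : IsRegular ξ Y)
    (hd : 4 ≤ finrank K Y) (hx : x ∈ Y) (hy : y ∈ Y) (hxy : ξ x y ≠ 0) :
    ∃ d ∈ Y, ∃ e ∈ Y, ∃ g ∈ Y, (ξ x d ≠ 0 ∧ ξ y d ≠ 0 ∧ ξ x e ≠ 0 ∧ ξ y e ≠ 0) ∧
      (ξ d e = 0 ∧ e ∉ K ∙ d) ∧ (ξ d g ≠ 0 ∧ ξ e g ≠ 0) ∧ ξ x g = 0 ∧ ξ y g = 0 := by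
  have hx0 : x ≠ 0 := fun e => hxy (by rw [e, map_zero, LinearMap.zero_apply])
  have hdim : 1 ≤ finrank K ↥(perpIn ξ Y x ⊓ perpIn ξ Y y) := by
    have hdx := finrank_perpIn h.refl hY hx hx0
    have hdy := finrank_le_finrank_inf_ker_add_one (perpIn ξ Y x) (ξ y)
    have hle : perpIn ξ Y x ⊓ LinearMap.ker (ξ y) ≤ perpIn ξ Y x ⊓ perpIn ξ Y y :=
      le_inf inf_le_left (inf_le_inf_right _ perpIn_le)
    have := Submodule.finrank_mono hle
    omega
  obtain ⟨a, b, ha, hb, hab, -⟩ :=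
    ((isRegular_inf_perpIn_iff h.alt hY hx hx0 hy).2 hxy).exists_triangular h.refl hdim
  obtain ⟨⟨hf, hxf : ξ x (a 0) = 0⟩, -, hyf : ξ y (a 0) = 0⟩ := ha 0
  obtain ⟨⟨hg, hxg : ξ x (b 0) = 0⟩, -, hyg : ξ y (b 0) = 0⟩ := hb 0
  have hfg := hab 0
  set f := a 0
  set g := b 0
  have hfx : ξ f x = 0 := h.refl _ _ hxf
  have hfy : ξ f y = 0 := h.refl _ _ hyf
  have hgx : ξ g x = 0 := h.refl _ _ hxg
  have hgy : ξ g y = 0 := h.refl _ _ hyg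
  have hgf : ξ g f = -ξ f g := (h.alt.neg_eq f g).symm
  have hyx : ξ y x = -ξ x y := (h.alt.neg_eq x y).symm
  have hxyY := Y.add_mem hx hy
  refine ⟨x + y + f, Y.add_mem hxyY hf, x + y - f, Y.sub_mem hxyY hf, g, hg, ?_,
    ⟨?_, fun hmem => ?_⟩, ?_, hxg, hyg⟩
  · simp [h.alt x, h.alt y, hxf, hyf, hyx, hxy]
  · simp [h.alt x, h.alt y, h.alt f, hxf, hyf, hfx, hfy, hyx]
  · obtain ⟨c, hc⟩ := Submodule.mem_span_singleton.1 hmem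
    have heval (p : V) : c * ξ p (x + y + f) = ξ p (x + y - f) :=
      (map_smul (ξ p) c _).symm.trans (congrArg (ξ p) hc)
    have hevalx := heval x
    have hevalg := heval g
    simp only [map_add, map_sub, h.alt x, hxf, hgx, hgy, hgf] at hevalx hevalg
    have hc1 : c = 1 := mul_right_cancel₀ hxy (by linear_combination hevalx)
    exact mul_ne_zero h.two_ne_zero hfg (by rw [hc1] at hevalg; linear_combination -hevalg)
  · simp [hxg, hyg, hfg]

theorem IsSymplectic.joinable_iff_adj (h : IsSymplectic ξ) (hjk : j + 1 = k) (hk : Even k)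
    (hH : IsRegular ξ H) (hd : finrank K H + 1 = j) (hX : H ≤ X.1) (hX' : H ≤ X'.1) :
    Joinable k X X' ↔ (adjacency ξ j).Adj X X' := by
  have hj : ¬ Even j := by rwa [← hjk, Nat.even_add_one] at hk
  rw [h.joinable_iff hjk hk, h.adj_iff_of_odd hj]
  refine and_congr_right fun hne => and_congr_right fun _ => (and_iff_right ?_).symm
  rwa [inf_eq_of_ge X.finrank_eq X'.finrank_eq hd hX hX' (TR.ne hne)]

theorem IsSymplectic.joinable_iff_of_dual_eq_perpIn (h : IsSymplectic ξ) (hjk : j + 1 = k)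
    (hk : Even k) (hH : IsRegular ξ H) (hd : finrank K H + 1 = j) (hjl : j + l = finrank K V)
    (hx : x ∈ ξ.orthogonal H) (hy : y ∈ ξ.orthogonal H)
    (hX : (h.dual hjl X).1 = perpIn ξ (ξ.orthogonal H) x)
    (hX' : (h.dual hjl X').1 = perpIn ξ (ξ.orthogonal H) y) : Joinable k X X' ↔ ξ x y ≠ 0 := by
  have hl : ¬ Even l := by
    have := h.even_finrank
    grind
  have hdY := finrank_add_finrank_orthogonal h.nondeg H
  have le_of_dual {Z : TR ξ j} {z : V} (hZ : (h.dual hjl Z).1 = perpIn ξ (ξ.orthogonal H) z) :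
      H ≤ Z.1 := (orthogonal_le_orthogonal_iff h.refl h.nondeg).1 (hZ.trans_le perpIn_le)
  rw [h.joinable_iff_adj hjk hk hH hd (le_of_dual hX) (le_of_dual hX'), h.adj_dual_iff hjl,
    h.adj_iff_of_eq_perpIn hl ((rad_orthogonal h.refl h.nondeg H).trans hH) (by omega) hx hy hX hX']

theorem IsSymplectic.exists_dual_eq_perpIn (h : IsSymplectic ξ) (hH : IsRegular ξ H)
    (hd : finrank K H + 1 = j) (hjl : j + l = finrank K V) (hx : x ∈ ξ.orthogonal H)
    (hx0 : x ≠ 0) : ∃ X : TR ξ j, (h.dual hjl X).1 = perpIn ξ (ξ.orthogonal H) x := by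
  have hdY := finrank_add_finrank_orthogonal h.nondeg H
  have hY : IsRegular ξ (ξ.orthogonal H) := (rad_orthogonal h.refl h.nondeg H).trans hH
  obtain ⟨W, hW⟩ := hY.exists_eq_perpIn (k := l) h.refl (by omega) hx hx0
  exact ⟨(h.dual hjl).symm W, by rw [Equiv.apply_symm_apply, hW]⟩

theorem IsSymplectic.exists_eq_perpIn_of_ge (h : IsSymplectic ξ) (hH : IsRegular ξ H)
    (hd : finrank K H + 1 = j) (hjl : j + l = finrank K V) (hX : H ≤ X.1) :
    ∃ x ∈ ξ.orthogonal H, (h.dual hjl X).1 = perpIn ξ (ξ.orthogonal H) x := by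
  have hdY := finrank_add_finrank_orthogonal h.nondeg H
  have hY : IsRegular ξ (ξ.orthogonal H) := (rad_orthogonal h.refl h.nondeg H).trans hH
  obtain ⟨x, hx, -, hXx⟩ := exists_eq_perpIn h.refl h.nondeg hY (H := (h.dual hjl X).1)
    (LinearMap.BilinForm.orthogonal_le hX) (by rw [TR.finrank_eq]; omega)
  exact ⟨x, hx, hXx⟩

theorem IsSymplectic.adjByJoin_of_adj (h : IsSymplectic ξ) (hjk : j + 1 = k) (hk : Even k)
    (hkn : k + 2 ≤ finrank K V) (hX : (adjacency ξ j).Adj X X') : AdjByJoin k X X' := by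
  have hj : ¬ Even j := by rwa [← hjk, Nat.even_add_one] at hk
  obtain ⟨l, hjl⟩ : ∃ l, j + l = finrank K V := ⟨finrank K V - j, by omega⟩
  obtain ⟨-, hd, hH, -⟩ := (h.adj_iff_of_odd hj).1 hX
  have hdY := finrank_add_finrank_orthogonal h.nondeg (X.1 ⊓ X'.1)
  have hY : IsRegular ξ (ξ.orthogonal (X.1 ⊓ X'.1)) :=
    (rad_orthogonal h.refl h.nondeg _).trans hH
  have joinable_iff {Z Z' : TR ξ j} {z z' : V} := h.joinable_iff_of_dual_eq_perpIn (X := Z)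
    (X' := Z') (x := z) (y := z') hjk hk hH hd hjl
  obtain ⟨x, hx, hXx⟩ := h.exists_eq_perpIn_of_ge hH hd hjl inf_le_left
  obtain ⟨y, hy, hXy⟩ := h.exists_eq_perpIn_of_ge hH hd hjl inf_le_right
  have hXX := (h.joinable_iff_adj hjk hk hH hd inf_le_left inf_le_right).2 hX
  obtain ⟨d, hdm, e, hem, g, hg, ⟨hxd, hyd, hxe, hye⟩, ⟨hde, hspan⟩, ⟨hdg, heg⟩, hxg, hyg⟩ :=
    h.exists_witnesses hY (by omega) hx hy ((joinable_iff hx hy hXx hXy).1 hXX)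
  obtain ⟨D, hD⟩ := h.exists_dual_eq_perpIn hH hd hjl hdm fun e0 => hxd (by rw [e0, map_zero])
  obtain ⟨E, hE⟩ := h.exists_dual_eq_perpIn hH hd hjl hem fun e0 => hxe (by rw [e0, map_zero])
  obtain ⟨G, hG⟩ := h.exists_dual_eq_perpIn hH hd hjl hg fun e0 => hdg (by rw [e0, map_zero])
  have not_le {U : TR ξ k} {Z : TR ξ j} {z : V} (hU : X.1 ≤ U.1) (hU' : X'.1 ≤ U.1)
      (hZ : (h.dual hjl Z).1 = perpIn ξ (ξ.orthogonal (X.1 ⊓ X'.1)) z) (hzg : ξ z g ≠ 0) :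
      ¬ Z.1 ≤ U.1 := by
    intro hle
    have hgU : g ∈ ξ.orthogonal U.1 := by
      rw [← hXX.sup_eq hjk hU hU', orthogonal_sup h.refl]
      exact ⟨hXx.ge ⟨hg, hxg⟩, hXy.ge ⟨hg, hyg⟩⟩
    exact hzg (hZ.le (LinearMap.BilinForm.orthogonal_le hle hgU)).2
  refine ⟨hXX, D, E, G, fun U hU hU' => ⟨not_le hU hU' hD hdg, not_le hU hU' hE heg⟩, ?_⟩
  simp only [joinable_iff hx hdm hXx hD, joinable_iff hy hdm hXy hD, joinable_iff hx hem hXx hE,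
    joinable_iff hy hem hXy hE, joinable_iff hdm hem hD hE, joinable_iff hdm hg hD hG,
    joinable_iff hem hg hE hG, joinable_iff hx hg hXx hG, joinable_iff hy hg hXy hG, not_not]
  refine ⟨⟨hxd, hyd, hxe, hye⟩, ⟨hde, fun hDE => hspan ?_⟩, ⟨hdg, heg⟩, hxg, hyg⟩
  exact mem_span_of_perpIn_eq h.refl hY hdm (fun e0 => hxd (by rw [e0, map_zero])) hem
    (hD.symm.trans (hDE ▸ hE))

end JoinsOverRegular

theorem HasTriangular.transfer {M P : Type*} {A : M → M → Prop} {T : M → Prop}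
    {A' : P → P → Prop} {T' : P → Prop} {R : M → P → Prop} {r : ℕ}
    (h : HasTriangular A T r) (hT : ∀ c, T c → ∃ Z, T' Z ∧ R c Z)
    (hA : ∀ {c c' Z Z'}, R c Z → R c' Z' → (A c c' ↔ A' Z Z')) : HasTriangular A' T' r := by
  obtain ⟨a, b, hab, hnot⟩ := h
  choose a' ha' hRa using fun i => hT (a i) (hab i).1
  choose b' hb' hRb using fun i => hT (b i) (hab i).2.1
  exact ⟨a', b', fun i => ⟨ha' i, hb' i, (hA (hRa i) (hRb i)).1 (hab i).2.2⟩,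
    fun i j hij => (hA (hRa j) (hRb i)).not.1 (hnot i j hij)⟩

section CliqueAdj

variable {K V : Type*} [Field K] [AddCommGroup V] [Module K V] {ξ : LinearMap.BilinForm K V}
  {j k l : ℕ} {t t' : Fin 3 → TR ξ k} {X X' X'' : TR ξ j} [FiniteDimensional K V]

theorem IsSymplectic.cliqueAdj_iff (h : IsSymplectic ξ) (hjk : j + 1 = k) (hk : Even k)
    (hk2 : 2 ≤ k) (hkn : k + 2 ≤ finrank K V) (ht : StarAt t X) (ht' : StarAt t' X') :
    CliqueAdj (adjacency ξ k).Adj t t' ↔ (adjacency ξ j).Adj X X' := by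
  have meet {c c' : Fin 3 → TR ξ k} {Z Z' : TR ξ j} (hc : StarAt c Z) (hc' : StarAt c' Z') :=
    h.meetOnce_iff hjk hk (by omega) hc hc'
  have same {c c' : Fin 3 → TR ξ k} {Z Z' : TR ξ j} (hc : StarAt c Z) (hc' : StarAt c' Z') :=
    h.sameClique_iff hjk hk (by omega) hc hc'
  constructor
  · rintro ⟨htt, d, e, g, ⟨cd, ce, cg⟩, hU, ⟨htd, htd', hte, hte'⟩, ⟨hde, hne⟩, ⟨hdg, heg⟩,
      htg, htg'⟩
    obtain ⟨D, hD⟩ := h.exists_starAt_of_meetOnce hjk hk hk2 hkn ht cd htd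
    obtain ⟨E, hE⟩ := h.exists_starAt_of_meetOnce hjk hk hk2 hkn ht ce hte
    obtain ⟨G, hG⟩ := h.exists_starAt_of_meetOnce hjk hk hk2 hkn hD cg hdg
    refine h.adj_of_adjByJoin hjk hk ⟨(meet ht ht').1 htt, D, E, G, fun U hX hX' => ?_,
      ⟨(meet ht hD).1 htd, (meet ht' hD).1 htd', (meet ht hE).1 hte, (meet ht' hE).1 hte'⟩,
      ⟨(meet hD hE).not.1 hde, (same hD hE).not.1 hne⟩, ⟨(meet hD hG).1 hdg, (meet hE hG).1 heg⟩,
      (meet ht hG).not.1 htg, (meet ht' hG).not.1 htg'⟩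
    rw [← hD U, ← hE U]
    exact hU U ((ht U).2 hX) ((ht' U).2 hX')
  · intro hX
    obtain ⟨hXX, D, E, G, hU, ⟨hXD, hXD', hXE, hXE'⟩, ⟨hDE, hne⟩, ⟨hDG, hEG⟩, hXG, hXG'⟩ :=
      h.adjByJoin_of_adj hjk hk hkn hX
    obtain ⟨d, cd, hD⟩ := h.exists_starAt hjk hk hkn D
    obtain ⟨e, ce, hE⟩ := h.exists_starAt hjk hk hkn E
    obtain ⟨g, cg, hG⟩ := h.exists_starAt hjk hk hkn G
    refine ⟨(meet ht ht').2 hXX, d, e, g, ⟨cd, ce, cg⟩, fun z hz hz' => ?_,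
      ⟨(meet ht hD).2 hXD, (meet ht' hD).2 hXD', (meet ht hE).2 hXE, (meet ht' hE).2 hXE'⟩,
      ⟨(meet hD hE).not.2 hDE, (same hD hE).not.2 hne⟩, ⟨(meet hD hG).2 hDG, (meet hE hG).2 hEG⟩,
      (meet ht hG).not.2 hXG, (meet ht' hG).not.2 hXG'⟩
    rw [hD z, hE z]
    exact hU z ((ht z).1 hz) ((ht' z).1 hz')

theorem IsSymplectic.hasCliqueTriangular_iff (h : IsSymplectic ξ) (hjk : j + 1 = k) (hk : Even k)
    (hk2 : 2 ≤ k) (hkn : k + 2 ≤ finrank K V) (ht : StarAt t X) (r : ℕ) :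
    HasCliqueTriangular (adjacency ξ k).Adj t r ↔ r ≤ k := by
  have hj : ¬ Even j := by rwa [← hjk, Nat.even_add_one] at hk
  have adj {c c' : Fin 3 → TR ξ k} {Z Z' : TR ξ j} (hc : StarAt c Z) (hc' : StarAt c' Z') :=
    h.cliqueAdj_iff hjk hk hk2 hkn hc hc'
  have triangular_iff (z : TR ξ k) : HasTriangular (adjacency ξ j).Adj (·.1 ≤ z.1) r ↔ r ≤ k :=
    by rw [h.hasTriangular_iff hj (h.isRegular hk z) (by rw [z.finrank_eq, hjk]) r, hjk]
  constructor
  · rintro ⟨z, hz, hT⟩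
    refine (triangular_iff z).1 (hT.transfer (R := StarAt) ?_ adj)
    rintro c ⟨hc, hcz, hs | hm⟩
    · exact ⟨X, (ht z).1 hz, fun w => (hs w).symm.trans (ht w)⟩
    · obtain ⟨Z, hZ⟩ := h.exists_starAt_of_meetOnce hjk hk hk2 hkn ht hc hm
      exact ⟨Z, (hZ z).1 hcz, hZ⟩
  · intro hr
    obtain ⟨z, w, -, hzw⟩ := h.exists_inf_eq hjk hk (by omega) X
    have hz : X.1 ≤ z.1 := hzw ▸ inf_le_left
    refine ⟨z, (ht z).2 hz, ((triangular_iff z).2 hr).transfer (R := flip StarAt)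
      (fun Z hZ => ?_) fun hZ hZ' => (adj hZ hZ').symm⟩
    obtain ⟨c, hc, hcZ⟩ := h.exists_starAt hjk hk hkn Z
    refine ⟨c, ⟨hc, (hcZ z).2 hZ, ?_⟩, hcZ⟩
    rw [h.sameClique_iff hjk hk (by omega) ht hcZ, h.meetOnce_iff hjk hk (by omega) ht hcZ]
    exact or_iff_not_imp_left.2 fun hne => ⟨hne, z, hz, hZ⟩

theorem IsSymplectic.starAt_dual (h : IsSymplectic ξ) {m : ℕ} (hkl : k + l = finrank K V)
    (hjm : j + m = finrank K V) (ht : TopAt t X) : StarAt (h.dual hkl ∘ t) (h.dual hjm X) := by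
  intro z
  obtain ⟨w, rfl⟩ := (h.dual hkl).surjective z
  rw [h.dual_le_dual_iff, ← ht w]
  simp only [InClique, Function.comp_apply, ← h.adj_dual_iff, (h.dual hkl).injective.eq_iff]

theorem IsSymplectic.hasCliqueTriangular_iff_of_topAt (h : IsSymplectic ξ)
    (hkl : k + l = finrank K V) (hk : Even k) (hk2 : 2 ≤ k) (hl2 : 2 ≤ l) {Y : TR ξ (k + 1)}
    (ht : TopAt t Y) (r : ℕ) : HasCliqueTriangular (adjacency ξ k).Adj t r ↔ r ≤ l := by
  have hl : Even l := (Nat.even_add.1 (hkl ▸ h.even_finrank)).1 hk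
  have hdual := (UniformlyDefinable.hasCliqueTriangular (id : Fin 3 → Fin 3) r).iff_of_equiv
    (h.dual hkl) (fun a b => h.adj_dual_iff hkl) t
  exact hdual.trans (h.hasCliqueTriangular_iff (j := l - 1) (by omega) hl hl2 (by omega)
    (h.starAt_dual hkl (by omega) ht) r)

theorem IsSymplectic.adj_iff_notMem (h : IsSymplectic ξ) (hj : ¬ Even j) {Y : Submodule K V}
    (hY : IsRegular ξ Y) (hd : finrank K Y = j + 1) {z : V} (hz : z ∈ Y)
    (hX : X.1 = perpIn ξ Y z) (hX' : X'.1 ≤ Y) : (adjacency ξ j).Adj X X' ↔ z ∉ X'.1 := by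
  obtain ⟨x, hx, -, hXx⟩ := exists_eq_perpIn h.refl h.nondeg hY hX' (by rw [X'.finrank_eq, hd])
  rw [h.adj_iff_of_eq_perpIn hj hY hd hz hx hX hXx, hXx]
  exact not_congr ⟨fun hzx => ⟨hz, h.refl _ _ hzx⟩, fun hmem => h.refl _ _ hmem.2⟩

theorem IsSymplectic.mem_line_iff_of_odd (h : IsSymplectic ξ) (hjk : j + 1 = k) (hk : Even k)
    (hX : (adjacency ξ j).Adj X X') :
    (X.1 ⊓ X'.1 ≤ X''.1 ∧ X''.1 ≤ X.1 ⊔ X'.1) ↔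
      ∃ U : TR ξ k, X.1 ≤ U.1 ∧ X'.1 ≤ U.1 ∧ X''.1 ≤ U.1 ∧ ∀ Z : TR ξ j, Z.1 ≤ U.1 →
        ¬ (adjacency ξ j).Adj Z X → ¬ (adjacency ξ j).Adj Z X' → ¬ (adjacency ξ j).Adj Z X'' := by
  have hj : ¬ Even j := by rwa [← hjk, Nat.even_add_one] at hk
  obtain ⟨hne, hinf, -, hsup⟩ := (h.adj_iff_of_odd hj).1 hX
  have hd (U : TR ξ k) : finrank K U.1 = j + 1 := by rw [U.finrank_eq, hjk]
  constructor
  · rintro ⟨hle, hle'⟩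
    have hdsup := finrank_sup_eq_add_one X.finrank_eq X'.finrank_eq hinf
    refine ⟨TR.of (X.1 ⊔ X'.1) (hdsup.trans hjk) hsup.finrank_rad_le_one, le_sup_left,
      le_sup_right, hle', fun Z hZ => ?_⟩
    obtain ⟨z, hz, -, hZz⟩ := exists_eq_perpIn h.refl h.nondeg hsup hZ (by
      rw [Z.finrank_eq, hdsup])
    rw [h.adj_iff_notMem hj hsup hdsup hz hZz le_sup_left,
      h.adj_iff_notMem hj hsup hdsup hz hZz le_sup_right,
      h.adj_iff_notMem hj hsup hdsup hz hZz hle', not_not, not_not, not_not]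
    exact fun hzX hzX' => hle ⟨hzX, hzX'⟩
  · rintro ⟨U, hXU, hXU', hXU'', hline⟩
    have hU := h.isRegular hk U
    refine ⟨fun z hz => ?_, hXU''.trans_eq
      (sup_eq_of_le X.finrank_eq X'.finrank_eq (hd U) hXU hXU' (TR.ne hne)).symm⟩
    obtain rfl | hz0 := eq_or_ne z 0
    · exact zero_mem _
    have hzU := hXU hz.1
    obtain ⟨Z, hZ⟩ := hU.exists_eq_perpIn h.refl (hd U) hzU hz0
    have hZ'' := hline Z (hZ.trans_le perpIn_le)
    rw [h.adj_iff_notMem hj hU (hd U) hzU hZ hXU, h.adj_iff_notMem hj hU (hd U) hzU hZ hXU',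
      h.adj_iff_notMem hj hU (hd U) hzU hZ hXU'', not_not, not_not, not_not] at hZ''
    exact hZ'' hz.1 hz.2

end CliqueAdj

/-! ### Definability of the neighbouring Grassmann spaces -/

/-- Codes of the subspaces of dimension `k - 1` by their stars, for `k` even; `Q` is meant to single
out the stars among the maximal cliques. -/
def TupleCoding.ofClique (Q : GraphRelation.{v} (Fin 3)) (hQ : UniformlyDefinable Q) :
    TupleCoding.{v} 3 where
  Dom M A t := IsClass A t ∧ Q M A t
  Mem _ A t U := InClique A t U
  Adj _ A t t' := CliqueAdj A t t'
  Line M A t t' t'' := ∃ U, InClique A t U ∧ InClique A t' U ∧ InClique A t'' U ∧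
    ∀ z, IsClass A z ∧ Q M A z → InClique A z U →
      ¬ CliqueAdj A z t → ¬ CliqueAdj A z t' → ¬ CliqueAdj A z t''
  definable_dom := .and (.isClass id) hQ
  definable_mem := .inClique Sum.inl _
  definable_adj := .cliqueAdj Sum.inl Sum.inr
  definable_line :=
    have mem (i : Fin 3 → (Fin 3 ⊕ Fin 3) ⊕ Fin 3) := UniformlyDefinable.inClique.{v}
      (Sum.inl ∘ i) (.inr () : ((Fin 3 ⊕ Fin 3) ⊕ Fin 3) ⊕ Unit)
    have notAdj (i : Fin 3 → (Fin 3 ⊕ Fin 3) ⊕ Fin 3) := (UniformlyDefinable.cliqueAdj.{v}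
      (Sum.inr : Fin 3 → (((Fin 3 ⊕ Fin 3) ⊕ Fin 3) ⊕ Unit) ⊕ Fin 3) (Sum.inl ∘ Sum.inl ∘ i)).not
    .exists_elem (.and (mem _) (.and (mem _) (.and (mem _) (.forall_tuple
      (.imp (.and (.isClass Sum.inr) (hQ.comp Sum.inr)) (.imp (.inClique Sum.inr _)
        (.imp (notAdj (Sum.inl ∘ Sum.inl)) (.imp (notAdj (Sum.inl ∘ Sum.inr))
          (notAdj Sum.inr)))))))))

theorem IsSymplectic.represents_ofClique {K : Type u} {V : Type v} [Field K] [AddCommGroup V]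
    [Module K V] {ξ : LinearMap.BilinForm K V} [FiniteDimensional K V] {j k : ℕ}
    (h : IsSymplectic ξ) (hjk : j + 1 = k) (hk : Even k) (hk2 : 2 ≤ k)
    (hkn : k + 2 ≤ finrank K V) {Q : GraphRelation.{v} (Fin 3)} (hQ : UniformlyDefinable Q)
    {f : {t // (TupleCoding.ofClique Q hQ).Dom (TR ξ k) (adjacency ξ k).Adj t} → TR ξ j}
    (hf : Function.Surjective f) (star : ∀ t, StarAt t.1 (f t)) :
    (TupleCoding.ofClique Q hQ).Represents (adjacency ξ k).Adj (pencils ξ j)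
      (fun X U => X.1 ≤ U.1 ∨ U.1 ≤ X.1) f := by
  have le_or_ge_iff (X : TR ξ j) (U : TR ξ k) : X.1 ≤ U.1 ∨ U.1 ≤ X.1 ↔ X.1 ≤ U.1 :=
    or_iff_left (not_le_of_finrank_lt (by rw [X.finrank_eq, U.finrank_eq]; omega))
  have adj_iff (t t') := h.cliqueAdj_iff hjk hk hk2 hkn (star t) (star t')
  refine ⟨hf, fun t U => (star t U).trans (le_or_ge_iff _ U).symm, fun t t' hU => ?_, adj_iff,
    fun l hl t t' hne ht ht' s => ?_⟩
  · simp only [le_or_ge_iff] at hU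
    exact Subtype.ext (le_antisymm (h.le_of_forall_ge hjk hk (by omega) fun U => (hU U).2)
      (h.le_of_forall_ge hjk hk (by omega) fun U => (hU U).1))
  · rw [(pencil_eq hl ht ht' hne).1, Set.mem_ofPred_eq, h.mem_line_iff_of_odd hjk hk
      (⟨hne, l, hl, ht, ht'⟩ : (adjacency ξ j).Adj (f t) (f t'))]
    refine exists_congr fun U => and_congr (star t U) (and_congr (star t' U)
      (and_congr (star s U) ?_))
    rw [hf.forall, Subtype.forall]
    exact forall₂_congr fun z hz => imp_congr (star ⟨z, hz⟩ U)
      (imp_congr (adj_iff ⟨z, hz⟩ t).not (imp_congr (adj_iff ⟨z, hz⟩ t').not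
        (adj_iff ⟨z, hz⟩ s).not))

theorem definableFromAdjacency_pred_of_even {n k : ℕ} (hk : Even k) (hk2 : 2 ≤ k)
    (hkn : k + 2 ≤ n) (hne : k ≠ n - k) : DefinableFromAdjacency.{u, v} n k (k - 1) := by
  obtain ⟨Q, hQ, hsep⟩ := exists_separating hne (UniformlyDefinable.hasCliqueTriangular.{v} id)
  refine (TupleCoding.ofClique Q hQ).definableFromAdjacency fun K V _ _ _ ξ hξ => ?_
  have := hξ.2.1
  have hs := hξ.isSymplectic
  have hn := hξ.2.2.1
  have hjk : k - 1 + 1 = k := by omega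
  have hkn' : k + 2 ≤ finrank K V := hkn.trans_eq hn.symm
  have exists_star (t : {t // (TupleCoding.ofClique Q hQ).Dom (TR ξ k) (adjacency ξ k).Adj t}) :
      ∃ X : TR ξ (k - 1), StarAt t.1 X :=
    (hs.starAt_or_topAt hjk hk hk2 hkn' t.2.1).resolve_right fun ⟨Y, hY⟩ => (hsep _ _ t.1).2
      (hs.hasCliqueTriangular_iff_of_topAt (by omega) hk hk2 (by omega) hY) t.2.2
  choose f hf using exists_star
  refine ⟨f, hs.represents_ofClique hjk hk hk2 hkn' hQ (fun X => ?_) hf⟩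
  obtain ⟨t, ct, ht⟩ := hs.exists_starAt hjk hk hkn' X
  have hQt := (hsep _ _ t).1 (hs.hasCliqueTriangular_iff hjk hk hk2 hkn' ht)
  exact ⟨⟨t, ct, hQt⟩, (hs.sameClique_iff hjk hk (by omega) (hf _) ht).1 fun _ => Iff.rfl⟩

theorem definableFromAdjacency_of_not_even {n k j : ℕ} (hn : ¬ Even n) :
    DefinableFromAdjacency.{u, v} n k j := by
  refine ⟨⟨0, 0, ⊥, ⊥, ⊥, ⊥, ⊥, ⊥⟩, fun K V _ _ _ ξ hξ => absurd ?_ hn⟩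
  have := hξ.2.1
  rw [← hξ.2.2.1]
  exact hξ.isSymplectic.even_finrank

theorem definableFromAdjacency_add_one_of_not_even {n k : ℕ} (hk : ¬ Even k) (hkn : k + 3 ≤ n)
    (hne : k ≠ n - k) : DefinableFromAdjacency.{u, v} n k (k + 1) := by
  obtain rfl | hk3 : k = 1 ∨ 3 ≤ k := by grind
  · exact definableFromAdjacency_one_two hkn
  · exact definableFromAdjacency_add_one_of_odd hk hk3 hkn hne

theorem definableFromAdjacency_pred {n k : ℕ} (hk : 1 < k) (hkn : k < n) (hne : k ≠ n - k) :
    DefinableFromAdjacency.{u, v} n k (k - 1) := by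
  by_cases hn : Even n
  swap
  · exact definableFromAdjacency_of_not_even hn
  by_cases hkeven : Even k
  · exact definableFromAdjacency_pred_of_even hkeven hk (by grind) hne
  · have hnk : ¬ Even (n - k) := by rwa [Nat.even_sub hkn.le, iff_true_left hn]
    have hdual := (definableFromAdjacency_add_one_of_not_even.{u, v} (n := n) hnk (by grind)
      (by omega)).dual (by omega) (by omega)
    rwa [Nat.sub_sub_self hkn.le, show n - (n - k + 1) = k - 1 by omega] at hdual

theorem definableFromAdjacency_add_one {n k : ℕ} (hk : 1 ≤ k) (hkn : k + 1 < n)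
    (hne : k ≠ n - k) : DefinableFromAdjacency.{u, v} n k (k + 1) := by
  have hdual := (definableFromAdjacency_pred.{u, v} (n := n) (k := n - k) (by omega) (by omega)
    (by omega)).dual (by omega) (by omega)
  rwa [Nat.sub_sub_self (by omega), show n - (n - k - 1) = k + 1 by omega] at hdual

end SympGrassmann

theorem proposition2 (n k : ℕ) (hk1 : 1 ≤ k) (hkn : k ≤ n - 1) (hk : k ≠ n - k) :
    (1 < k →
      SympGrassmann.DefinableFromAdjacency.{u, v} n k (k - 1) ∧
      SympGrassmann.DefinableFromGrassmann.{u, v} n k (k - 1)) ∧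
    (k < n - 1 →
      SympGrassmann.DefinableFromAdjacency.{u, v} n k (k + 1) ∧
      SympGrassmann.DefinableFromGrassmann.{u, v} n k (k + 1)) := by
  refine ⟨fun h => ?_, fun h => ?_⟩
  · have hdef := SympGrassmann.definableFromAdjacency_pred.{u, v} h (by omega) hk
    exact ⟨hdef, hdef.definableFromGrassmann⟩
  · have hdef := SympGrassmann.definableFromAdjacency_add_one.{u, v} hk1 (by omega) hk
    exact ⟨hdef, hdef.definableFromGrassmann⟩
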